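/- **Setting.** Let $F,f:\mathbb R^n\times\mathbb R^m\to\mathbb R$, $H,G,h,g$ be maps from $\mathbb R^n\times\mathbb R^m$ to $\mathbb R^p,\mathbb R^q,\mathbb R^r,\mathbb R^s$ respectively, and consider the bilevel program (BP): minimize $F(x,y)$ subject to $H(x,y)=0$, $G(x,y)\le 0$, and $y$ solves the lower-level problem $(P_x)$: $\min_y f(x,y)$ s.t. $y\in Y(x):=\{y: h(x,y)=0,\ g(x,y)\le 0\}$. Put $\Phi=\{(x,y):H(x,y)=0,\ G(x,y)\le 0\}$, let $B_\delta(\cdot)$ denote closed Euclidean balls, and let $\mathcal L(x;y,\mu,\xi)=f(x,y)+\mu^Th(x,y)+\xi^Tg(x,y)$. *Bi-local solution.* $(x^*,y^*)$ is a bi-local solution of (BP) if $(x^*,y^*)\in\Phi$, $y^*\in Y(x^*)$ and there are $\delta_0>0$ and $\eta:(0,\delta_0]\to(0,\infty)$ with $\eta(\delta)\to0$ as $\delta\to0$ such that for every $\delta\in(0,\delta_0]$: $f(x^*,y^*)\le f(x^*,z)$ for all $z\in Y(x^*)\cap B_{\eta(\delta)}(y^*)$, and $F(x^*,y^*)\le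 F(x,y)$ for all $(x,y)\in\Phi\cap[B_\delta(x^*)\times B_{\eta(\delta)}(y^*)]$ with $y\in\operatorname{argmin}_z\{f(x,z):z\in Y(x)\cap B_{\eta(\delta)}(y^*)\}$. *Jacobian uniqueness conditions* of $(P_x)$ at $(y,\mu,\xi)$: (a) KKT: $\nabla_y\mathcal L(x;y,\mu,\xi)=0$, $h(x,y)=0$, $0\le\xi\perp g(x,y)\le0$; (b) LICQ: the gradients $\nabla_yh_j(x,y)$ ($j=1,\dots,r$) and $\nabla_yg_i(x,y)$ ($i$ with $g_i(x,y)=0$) are linearly independent; (c) $\xi_i-g_i(x,y)>0$ for all $i$; (d) $\langle\nabla^2_{yy}\mathcal L(x;y,\mu,\xi)d_y,d_y\rangle>0$ for all $d_y\ne0$ with $\mathcal J_yh(x,y)d_y=0$, $\nabla_yg_i(x,y)^Td_y\le0$ whenever $g_i(x,y)=0$, and $\nabla_yf(x,y)^Td_y\le0$. *MFCQ* at a point for constraints $h_j=0$, $g_i\le0$: the gradients of all $h_j$ are linearly independent there and there is $d$ with $\nabla h_j^Td=0$ for all $j$ and $\nabla g_i^Td<0$ for all $i$ with $g_i=0$ at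 the point. *Lower-level solution mapping.* Given $(y^*,\mu^*,\xi^*)$, this is a continuously differentiable $(y(\cdot),\mu(\cdot),\xi(\cdot))$ on some ball $B_{\delta_1}(x^*)$, with values in $B_{\varepsilon_1}(y^*)\times B_{\varepsilon_1}(\mu^*)\times B_{\varepsilon_1}(\xi^*)$ for some $\varepsilon_1>0$, equal to $(y^*,\mu^*,\xi^*)$ at $x^*$, such that for every $x\in B_{\delta_1}(x^*)$ the Jacobian uniqueness conditions of $(P_x)$ hold at $(y(x),\mu(x),\xi(x))$. Put $U(x^*)d_x=(d_x,\mathcal Jy(x^*)d_x,\mathcal J\mu(x^*)d_x,\mathcal J\xi(x^*)d_x)$. *(SP)* is: $\min_x F(x,y(x))$ s.t. $H(x,y(x))=0$, $G(x,y(x))\le0$, with Lagrangian $L^{SP}(x;\lambda_H,\lambda_G)=F(x,y(x))+\lambda_H^TH(x,y(x))+\lambda_G^TG(x,y(x))$. $\Lambda(x^*)$ is the set of $(\lambda_H,\lambda_G)\in\mathbb R^p\times\mathbb R^q$ with $\nabla_xL^{SP}(x^*;\lambda_H,\lambda_G)=0$, $H(x^*,y^*)=0$, $0\le\lambda_G\perp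 G(x^*,y^*)\le0$. The critical cone $\mathcal C(x^*)$ is the set of $d_x\in\mathbb R^n$ with $(\mathcal J_xH+\mathcal J_yH\,\mathcal Jy(x^*))d_x=0$, $(\nabla_xG_i^T+\nabla_yG_i^T\mathcal Jy(x^*))d_x\le0$ for $i$ with $G_i(x^*,y^*)=0$, and $(\nabla_xF^T+\nabla_yF^T\mathcal Jy(x^*))d_x\le0$, all partial derivatives being taken at $(x^*,y^*)$. *(FP)* is: $\min F(x,y)$ over $u=(x,y,\mu,\xi)$ s.t. $H(x,y)=0$, $G(x,y)\le0$, $\nabla_y\mathcal L(x;y,\mu,\xi)=0$, $h(x,y)=0$, $g(x,y)-\Pi(g(x,y)+\xi)=0$, where $\Pi$ is the projection onto $\mathbb R^s_-$. For $\lambda=(\lambda_H,\lambda_G,\lambda_{\mathcal L},\lambda_h,\lambda_g)$ its Lagrangian is $L^{FP}(u;\lambda)=F+\lambda_H^TH+\lambda_G^TG+\lambda_{\mathcal L}^T\nabla_y\mathcal L+\lambda_h^Th+\lambda_g^T(g-\Pi(g+\xi))$. With $u^*=(x^*,y^*,\mu^*,\xi^*)$, $\Lambda(u^*)$ is the set of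 $\lambda$ with $\nabla_uL^{FP}(u^*;\lambda)=0$, $0\le\lambda_G\perp G(x^*,y^*)\le0$ and all equality constraints of (FP) holding at $u^*$. The critical cone $\mathcal C(u^*)$ is the set of $d=(d_x,d_y,d_\mu,d_\xi)$ with $Ad=0$, $\nabla_xG_i^Td_x+\nabla_yG_i^Td_y\le0$ for $i$ with $G_i(x^*,y^*)=0$, and $\nabla_xF^Td_x+\nabla_yF^Td_y\le0$, where, at $u^*$ and with $W^*=\mathcal J\Pi(g(x^*,y^*)+\xi^*)$, $$A=\begin{bmatrix}\mathcal J_xH&\mathcal J_yH&0&0\\ \nabla^2_{yx}\mathcal L&\nabla^2_{yy}\mathcal L&\mathcal J_yh^T&\mathcal J_yg^T\\ \mathcal J_xh&\mathcal J_yh&0&0\\ (I-W^*)\mathcal J_xg&(I-W^*)\mathcal J_yg&0&-W^*\end{bmatrix}.$$ **Theorem (Second-order Necessary Optimality Conditions).** Suppose that around $(x^*,y^*)$ the functions $F,G,H$ are twice continuously differentiable, that $f,g,h$ are twice continuously differentiable, and that their partial derivatives $\nabla_yf,\mathcal J_yg,\mathcal J_yh$ are twice continuously differentiable in $(x,y)$.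 Suppose that the Jacobian uniqueness conditions of $(P_{x^*})$ hold at $(y^*,\mu^*,\xi^*)$. Then a lower-level solution mapping exists; every such mapping is twice continuously differentiable around $x^*$, and $L^{SP}(\cdot;\lambda_H,\lambda_G)$ and $L^{FP}(\cdot;\lambda)$ are twice continuously differentiable around $x^*$ and $u^*$ for all multipliers. For every such mapping, the following hold. If moreover $(x^*,y^*)$ is a bi-local solution of (BP), then: (i) If MFCQ holds at $x^*$ for (SP), then $\Lambda(x^*)$ is nonempty, compact and convex, and for every $d_x\in\mathcal C(x^*)$ the following maximum is attained and satisfies $$\max_{(\lambda_H,\lambda_G)\in\Lambda(x^*)} d_x^T\nabla^2_{xx}L^{SP}(x^*;\lambda_H,\lambda_G)d_x\ge0 .$$ (ii) If MFCQ holds at $u^*$ for (FP), then $\Lambda(u^*)$ is nonempty, compact and convex, and for every $d\in\mathcal C(u^*)$ the following maximum is attained and satisfies $$\max_{\lambda\in\Lambda(u^*)} d^T\nabla^2_{uu}L^{FP}(u^*;\lambda)d\ge0 .$$ Furthermore, (i) and (ii) are equivalent, in the following sense (whether or not $(x^*,y^*)$ is a bi-local solution): MFCQ holds at $x^*$ for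 (SP) if and only if it holds at $u^*$ for (FP); the conclusion of (i) holds if and only if the conclusion of (ii) holds; $\mathcal C(u^*)=\{U(x^*)d_x:d_x\in\mathcal C(x^*)\}$; every $(\lambda_H,\lambda_G)\in\Lambda(x^*)$ extends by a unique $(\lambda_{\mathcal L},\lambda_h,\lambda_g)$ to an element of $\Lambda(u^*)$, and the $(\lambda_H,\lambda_G)$-part of every element of $\Lambda(u^*)$ lies in $\Lambda(x^*)$; and for every $d_x\in\mathcal C(x^*)$ and $d=U(x^*)d_x$, one of the two maxima above exists if and only if the other does, and then they are equal. -/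

import Mathlib

open Set Filter Topology

noncomputable section

/-- `ℝⁿ` with the Euclidean norm. -/
abbrev Vec (n : ℕ) : Type := EuclideanSpace ℝ (Fin n)

/-- The data of a bilevel program: minimise `F (x, y)` subject to `H (x, y) = 0`, `G (x, y) ≤ 0`
and `y` solving the lower level problem `(P_x)`: minimise `f (x, y)` over `y` with
`h (x, y) = 0`, `g (x, y) ≤ 0`. -/
structure BilevelProgram (n m p q r s : ℕ) where
  F : Vec n × Vec m → ℝ
  H : Vec n × Vec m → Vec p
  G : Vec n × Vec m → Vec q
  f : Vec n × Vec m → ℝ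
  h : Vec n × Vec m → Vec r
  g : Vec n × Vec m → Vec s

/-- The partial derivative `𝒥_x θ (x, y)`. -/
def partialX {n m : ℕ} {V : Type*} [NormedAddCommGroup V] [NormedSpace ℝ V]
    (θ : Vec n × Vec m → V) (x : Vec n) (y : Vec m) : Vec n →L[ℝ] V :=
  fderiv ℝ (fun x' => θ (x', y)) x

/-- The partial derivative `𝒥_y θ (x, y)`. -/
def partialY {n m : ℕ} {V : Type*} [NormedAddCommGroup V] [NormedSpace ℝ V]
    (θ : Vec n × Vec m → V) (x : Vec n) (y : Vec m) : Vec m →L[ℝ] V :=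
  fderiv ℝ (fun y' => θ (x, y')) y

/-- Around `(x, y)`, `θ` is twice continuously differentiable, and so is its partial derivative
with respect to `y`. -/
def IsC2WithC3InY {n m : ℕ} {V : Type*} [NormedAddCommGroup V] [NormedSpace ℝ V]
    (θ : Vec n × Vec m → V) (x : Vec n) (y : Vec m) : Prop :=
  ContDiffAt ℝ 2 θ (x, y) ∧
    ContDiffAt ℝ 2 (fun z : Vec n × Vec m => partialY θ z.1 z.2) (x, y)

/-- The projection `Π` onto the nonpositive orthant `ℝ_-^s`. -/
def projNeg {s : ℕ} (v : Vec s) : Vec s := WithLp.toLp 2 (fun i => min (v i) 0)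

/-- The quadratic form `d ↦ dᵀ ∇²φ(x) d`. -/
def hessQuad {E : Type*} [NormedAddCommGroup E] [NormedSpace ℝ E]
    (φ : E → ℝ) (x d : E) : ℝ :=
  fderiv ℝ (fderiv ℝ φ) x d d

/-- The Mangasarian-Fromovitz constraint qualification at `x` for the constraints
`h j = 0` (all `j`), `g i ≤ 0` (all `i`). -/
def MFCQ {E ι κ : Type*} [NormedAddCommGroup E] [NormedSpace ℝ E]
    (h : ι → E → ℝ) (g : κ → E → ℝ) (x : E) : Prop :=
  LinearIndependent ℝ (fun j => fderiv ℝ (h j) x) ∧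
    ∃ d : E, (∀ j, fderiv ℝ (h j) x d = 0) ∧ ∀ i, g i x = 0 → fderiv ℝ (g i) x d < 0

namespace BilevelProgram

variable {n m p q r s : ℕ} (D : BilevelProgram n m p q r s)

/-- The upper level constraint set `Φ`. -/
def upperFeasible : Set (Vec n × Vec m) :=
  {z | D.H z = 0 ∧ ∀ i, D.G z i ≤ 0}

/-- The lower level feasible set `Y(x)`. -/
def lowerFeasible (x : Vec n) : Set (Vec m) :=
  {y | D.h (x, y) = 0 ∧ ∀ i, D.g (x, y) i ≤ 0}

/-- Bi-local optimal solutions; the radius function `η` takes positive values. -/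
def IsBiLocalSolution (xs : Vec n) (ys : Vec m) : Prop :=
  (xs, ys) ∈ D.upperFeasible ∧ ys ∈ D.lowerFeasible xs ∧
    ∃ δ₀ : ℝ, 0 < δ₀ ∧ ∃ η : ℝ → ℝ,
      (∀ δ ∈ Ioc 0 δ₀, 0 < η δ) ∧ Tendsto η (𝓝[>] 0) (𝓝 0) ∧
      ∀ δ ∈ Ioc 0 δ₀,
        (∀ z ∈ D.lowerFeasible xs ∩ Metric.closedBall ys (η δ), D.f (xs, ys) ≤ D.f (xs, z)) ∧
        ∀ x ∈ Metric.closedBall xs δ, ∀ y ∈ Metric.closedBall ys (η δ),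
          (x, y) ∈ D.upperFeasible →
          y ∈ D.lowerFeasible x →
          (∀ z ∈ D.lowerFeasible x ∩ Metric.closedBall ys (η δ), D.f (x, y) ≤ D.f (x, z)) →
          D.F (xs, ys) ≤ D.F (x, y)

/-! ### The lower level problem -/

/-- The lower level Lagrangian `ℒ(x; y, μ, ξ) = f + μᵀh + ξᵀg`. -/
def lowerLagrangian (x : Vec n) (y : Vec m) (μ : Vec r) (ξ : Vec s) : ℝ :=
  D.f (x, y) + inner ℝ μ (D.h (x, y)) + inner ℝ ξ (D.g (x, y))

/-- The gradient `∇_y ℒ(x; y, μ, ξ)`. -/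
def gradLowerLagrangian (x : Vec n) (y : Vec m) (μ : Vec r) (ξ : Vec s) : Vec m :=
  gradient (fun y' => D.lowerLagrangian x y' μ ξ) y

/-- `(y, μ, ξ)` satisfies the KKT conditions of `(P_x)`. -/
def IsLowerKKT (x : Vec n) (y : Vec m) (μ : Vec r) (ξ : Vec s) : Prop :=
  D.gradLowerLagrangian x y μ ξ = 0 ∧ D.h (x, y) = 0 ∧
    (∀ i, 0 ≤ ξ i) ∧ (∀ i, D.g (x, y) i ≤ 0) ∧ inner ℝ ξ (D.g (x, y)) = 0

/-- LICQ for `(P_x)` at `y`. -/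
def LowerLICQ (x : Vec n) (y : Vec m) : Prop :=
  LinearIndependent ℝ
    (Sum.elim (fun j : Fin r => gradient (fun y' => D.h (x, y') j) y)
      (fun i : {i : Fin s // D.g (x, y) i = 0} => gradient (fun y' => D.g (x, y') i.1) y))

/-- The critical cone of `(P_x)` at `y`. -/
def lowerCriticalCone (x : Vec n) (y : Vec m) : Set (Vec m) :=
  {d | partialY D.h x y d = 0 ∧
    (∀ i, D.g (x, y) i = 0 → inner ℝ (gradient (fun y' => D.g (x, y') i) y) d ≤ 0) ∧
    inner ℝ (gradient (fun y' => D.f (x, y')) y) d ≤ 0}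

/-- The Jacobian uniqueness conditions of `(P_x)` at `(y, μ, ξ)`: KKT, LICQ, strict
complementarity and the second-order sufficient condition. -/
structure JacobianUniqueness (x : Vec n) (y : Vec m) (μ : Vec r) (ξ : Vec s) : Prop where
  kkt : D.IsLowerKKT x y μ ξ
  licq : D.LowerLICQ x y
  strict : ∀ i, 0 < ξ i - D.g (x, y) i
  sosc : ∀ d ∈ D.lowerCriticalCone x y \ {0},
    0 < hessQuad (fun y' => D.lowerLagrangian x y' μ ξ) y d

/-- `(y(·), μ(·), ξ(·))` is a continuously differentiable mapping defined on a ball around `xs`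
which passes through `(ys, μs, ξs)` at `xs` and along which the Jacobian uniqueness conditions of
`(P_x)` hold. Its values outside that ball are irrelevant. -/
def IsLowerSolutionMap (xs : Vec n) (ys : Vec m) (μs : Vec r) (ξs : Vec s)
    (y : Vec n → Vec m) (μ : Vec n → Vec r) (ξ : Vec n → Vec s) : Prop :=
  y xs = ys ∧ μ xs = μs ∧ ξ xs = ξs ∧
    ∃ δ ε : ℝ, 0 < δ ∧ 0 < ε ∧
      ContDiffOn ℝ 1 y (Metric.closedBall xs δ) ∧
      ContDiffOn ℝ 1 μ (Metric.closedBall xs δ) ∧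
      ContDiffOn ℝ 1 ξ (Metric.closedBall xs δ) ∧
      ∀ x ∈ Metric.closedBall xs δ,
        y x ∈ Metric.closedBall ys ε ∧ μ x ∈ Metric.closedBall μs ε ∧
        ξ x ∈ Metric.closedBall ξs ε ∧ D.JacobianUniqueness x (y x) (μ x) (ξ x)

/-! ### The reduced problem (SP)

Minimise `F (x, y(x))` subject to `H (x, y(x)) = 0`, `G (x, y(x)) ≤ 0`. -/

/-- MFCQ for (SP) at `xs`. -/
def MFCQSP (y : Vec n → Vec m) (xs : Vec n) : Prop :=
  MFCQ (fun (j : Fin p) (x : Vec n) => D.H (x, y x) j)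
    (fun (i : Fin q) (x : Vec n) => D.G (x, y x) i) xs

/-- The Lagrangian `L^SP(x; λ_H, λ_G)`, with `l = (λ_H, λ_G)`. -/
def lagrangianSP (y : Vec n → Vec m) (l : Vec p × Vec q) (x : Vec n) : ℝ :=
  D.F (x, y x) + inner ℝ l.1 (D.H (x, y x)) + inner ℝ l.2 (D.G (x, y x))

/-- The multiplier set `Λ(xs)` of (SP). -/
def multipliersSP (y : Vec n → Vec m) (xs : Vec n) : Set (Vec p × Vec q) :=
  {l | fderiv ℝ (D.lagrangianSP y l) xs = 0 ∧ D.H (xs, y xs) = 0 ∧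
    (∀ i, 0 ≤ l.2 i) ∧ (∀ i, D.G (xs, y xs) i ≤ 0) ∧ inner ℝ l.2 (D.G (xs, y xs)) = 0}

/-- The critical cone `𝒞(xs)` of (SP). -/
def criticalConeSP (y : Vec n → Vec m) (xs : Vec n) : Set (Vec n) :=
  {d | partialX D.H xs (y xs) d + partialY D.H xs (y xs) (fderiv ℝ y xs d) = 0 ∧
    (∀ i, D.G (xs, y xs) i = 0 →
      (partialX D.G xs (y xs) d + partialY D.G xs (y xs) (fderiv ℝ y xs d)) i ≤ 0) ∧
    partialX D.F xs (y xs) d + partialY D.F xs (y xs) (fderiv ℝ y xs d) ≤ 0}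

/-- The multiplier set of (SP) is nonempty, compact and convex, and for every critical direction
the maximum over the multipliers of the quadratic form of the Hessian of `L^SP` exists and is
nonnegative. -/
def SecondOrderSP (y : Vec n → Vec m) (xs : Vec n) : Prop :=
  (D.multipliersSP y xs).Nonempty ∧ IsCompact (D.multipliersSP y xs) ∧
    Convex ℝ (D.multipliersSP y xs) ∧
    ∀ d ∈ D.criticalConeSP y xs, ∃ v : ℝ,
      IsGreatest ((fun l => hessQuad (D.lagrangianSP y l) xs d) '' D.multipliersSP y xs) v ∧
        0 ≤ v

/-! ### The first-order reformulation (FP)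

Minimise `F (x, y)` over `u = (x, y, μ, ξ)` subject to `H (x, y) = 0`, `G (x, y) ≤ 0`,
`∇_y ℒ(x; y, μ, ξ) = 0`, `h (x, y) = 0`, `g (x, y) - Π (g (x, y) + ξ) = 0`. -/

/-- The residual `g (x, y) - Π (g (x, y) + ξ)`. -/
def compResidual (x : Vec n) (y : Vec m) (ξ : Vec s) : Vec s :=
  D.g (x, y) - projNeg (D.g (x, y) + ξ)

/-- The scalar equality constraints of (FP). -/
def eqConstraintsFP :
    Fin p ⊕ Fin m ⊕ Fin r ⊕ Fin s → Vec n × Vec m × Vec r × Vec s → ℝ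
  | .inl j, (x, y, _, _) => D.H (x, y) j
  | .inr (.inl j), (x, y, μ, ξ) => D.gradLowerLagrangian x y μ ξ j
  | .inr (.inr (.inl j)), (x, y, _, _) => D.h (x, y) j
  | .inr (.inr (.inr j)), (x, y, _, ξ) => D.compResidual x y ξ j

/-- MFCQ for (FP) at `(xs, ys, μs, ξs)`. -/
def MFCQFP (xs : Vec n) (ys : Vec m) (μs : Vec r) (ξs : Vec s) : Prop :=
  MFCQ D.eqConstraintsFP
    (fun (i : Fin q) (u : Vec n × Vec m × Vec r × Vec s) => D.G (u.1, u.2.1) i)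
    (xs, ys, μs, ξs)

/-- The Lagrangian `L^FP(u; λ)`, with `l = (λ_H, λ_G, λ_ℒ, λ_h, λ_g)` and `u = (x, y, μ, ξ)`. -/
def lagrangianFP (l : Vec p × Vec q × Vec m × Vec r × Vec s) :
    Vec n × Vec m × Vec r × Vec s → ℝ
  | (x, y, μ, ξ) =>
    D.F (x, y) + inner ℝ l.1 (D.H (x, y)) + inner ℝ l.2.1 (D.G (x, y))
      + inner ℝ l.2.2.1 (D.gradLowerLagrangian x y μ ξ) + inner ℝ l.2.2.2.1 (D.h (x, y))
      + inner ℝ l.2.2.2.2 (D.compResidual x y ξ)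

/-- The multiplier set `Λ(xs, ys, μs, ξs)` of (FP). -/
def multipliersFP (xs : Vec n) (ys : Vec m) (μs : Vec r) (ξs : Vec s) :
    Set (Vec p × Vec q × Vec m × Vec r × Vec s) :=
  {l | fderiv ℝ (D.lagrangianFP l) (xs, ys, μs, ξs) = 0 ∧ D.H (xs, ys) = 0 ∧
    (∀ i, 0 ≤ l.2.1 i) ∧ (∀ i, D.G (xs, ys) i ≤ 0) ∧ inner ℝ l.2.1 (D.G (xs, ys)) = 0 ∧
    D.gradLowerLagrangian xs ys μs ξs = 0 ∧ D.h (xs, ys) = 0 ∧ D.compResidual xs ys ξs = 0}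

/-- The Jacobian `W` of the projection `Π` at `g (x, y) + ξ`. -/
def projJacobian (x : Vec n) (y : Vec m) (ξ : Vec s) : Vec s →L[ℝ] Vec s :=
  fderiv ℝ (projNeg (s := s)) (D.g (x, y) + ξ)

/-- The product `A d` with `d = (d_x, d_y, d_μ, d_ξ)` and
`A = [𝒥_x H, 𝒥_y H, 0, 0; ∇²_yx ℒ, ∇²_yy ℒ, (𝒥_y h)ᵀ, (𝒥_y g)ᵀ; 𝒥_x h, 𝒥_y h, 0, 0;
(I - W) 𝒥_x g, (I - W) 𝒥_y g, 0, -W]`. -/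
def jacobianFP (x : Vec n) (y : Vec m) (μ : Vec r) (ξ : Vec s) :
    Vec n × Vec m × Vec r × Vec s → Vec p × Vec m × Vec r × Vec s
  | (dx, dy, dμ, dξ) =>
    (partialX D.H x y dx + partialY D.H x y dy,
      fderiv ℝ (fun x' => D.gradLowerLagrangian x' y μ ξ) x dx
        + fderiv ℝ (fun y' => D.gradLowerLagrangian x y' μ ξ) y dy
        + ContinuousLinearMap.adjoint (partialY D.h x y) dμ
        + ContinuousLinearMap.adjoint (partialY D.g x y) dξ,
      partialX D.h x y dx + partialY D.h x y dy,
      (partialX D.g x y dx - D.projJacobian x y ξ (partialX D.g x y dx))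
        + (partialY D.g x y dy - D.projJacobian x y ξ (partialY D.g x y dy))
        - D.projJacobian x y ξ dξ)

/-- The critical cone `𝒞(xs, ys, μs, ξs)` of (FP). -/
def criticalConeFP (xs : Vec n) (ys : Vec m) (μs : Vec r) (ξs : Vec s) :
    Set (Vec n × Vec m × Vec r × Vec s) :=
  {d | (∀ i, D.G (xs, ys) i = 0 →
      (partialX D.G xs ys d.1 + partialY D.G xs ys d.2.1) i ≤ 0) ∧
    D.jacobianFP xs ys μs ξs d = 0 ∧
    partialX D.F xs ys d.1 + partialY D.F xs ys d.2.1 ≤ 0}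

/-- The multiplier set of (FP) is nonempty, compact and convex, and for every critical direction
the maximum over the multipliers of the quadratic form of the Hessian of `L^FP` exists and is
nonnegative. -/
def SecondOrderFP (xs : Vec n) (ys : Vec m) (μs : Vec r) (ξs : Vec s) : Prop :=
  (D.multipliersFP xs ys μs ξs).Nonempty ∧ IsCompact (D.multipliersFP xs ys μs ξs) ∧
    Convex ℝ (D.multipliersFP xs ys μs ξs) ∧
    ∀ d ∈ D.criticalConeFP xs ys μs ξs, ∃ v : ℝ,
      IsGreatest ((fun l => hessQuad (D.lagrangianFP l) (xs, ys, μs, ξs) d) ''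
        D.multipliersFP xs ys μs ξs) v ∧ 0 ≤ v

end BilevelProgram

/-- The product `U(xs) d_x`, with `U = [I; 𝒥y; 𝒥μ; 𝒥ξ]`. -/
def solutionTangent {n m r s : ℕ} (y : Vec n → Vec m) (μ : Vec n → Vec r) (ξ : Vec n → Vec s)
    (xs dx : Vec n) : Vec n × Vec m × Vec r × Vec s :=
  (dx, fderiv ℝ y xs dx, fderiv ℝ μ xs dx, fderiv ℝ ξ xs dx)

end

/-!
The reduced problem (SP) is (FP) restricted to a curve, and everything follows from that together
with the second-order necessary conditions for (SP).

*The lower level.* Strict complementarity fixes the active set `I` of the lower level problem near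
the base point `u* = (x*, y*, μ*, ξ*)`, and makes the projection `Π` linear near `g + ξ*`. Hence the
lower level equations of (FP) coincide near `u*` with the smooth system `lowerResidual I = 0`. LICQ
and the second-order sufficient condition make the derivative of this residual in `(y, μ, ξ)`
invertible (`JacobianUniqueness.injective_residualPartial`), so the implicit function theorem
describes its zeros as a `C²` curve `x ↦ (x, y x, μ x, ξ x)`. The Jacobian uniqueness conditions
persist along the curve (`JacobianUniqueness.eventually`), and by the uniqueness in the implicit
function theorem every lower level solution map is this curve near `x*`
(`IsLowerSolutionMap.contDiffAt_and_isStrictKKT`).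

*Bi-local solutions.* For a bi-local solution `(x*, y*)` to be a local solution of (SP), `y x` has
to minimise the lower level problem of `x` on a ball around `y*` whose radius does not depend on
`x`. After addition of a quadratic penalty of the active constraints, the lower level Lagrangian
has a positive definite Hessian in `y` (Finsler's lemma, `exists_penalty_pos`); hence its gradient
in `y` is monotone near `(x*, y*)`, and its critical point `y x` is a minimiser there, uniformly in
`x`. On feasible points the penalised Lagrangian is at most `f`, with equality at `y x`
(`eventually_lower_le`).

*Second-order conditions.* For a nonlinear program under MFCQ, if no multiplier had a nonnegative
Hessian form in a critical direction `d`, then a separation argument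
(`exists_multipliers_of_infeasible`) would give a solution `w` of the second-order linearised
system, and the parabola `x* + t d + (t² / 2) w` could be corrected by Lyusternik's theorem to a
feasible curve along which the objective decreases (`exists_multiplier_hessQuad_nonneg`).

*Equivalence.* The derivative of the residual at `u*` is surjective, and its kernel is the tangent
space `{U(x*) d_x}` of the curve (`fderiv_lowerResidual_eq_zero_iff`). So a functional stationary on
the kernel is a unique combination of the rows of that derivative; this identifies multipliers, MFCQ
and critical cones of the two problems (`exists_multiplier_map`, `mfcqSP_iff_mfcqFP`,
`criticalConeFP_eq`). Finally `L^SP` is `L^FP` along the curve, and at a multiplier the gradient of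
`L^FP` vanishes, so that the second-order chain rule has no first-order term and the two Hessian
forms agree (`hessQuad_lagrangianSP`).
-/

noncomputable section

/-! ### Second-order necessary conditions for a nonlinear program -/

/-- Lyusternik's theorem: near a zero `x` of a map with surjective strict derivative, the
distance from `b` to the zero set is at most a constant times `‖H b‖`. -/
theorem HasStrictFDerivAt.exists_zero_near {E V : Type*} [NormedAddCommGroup E] [NormedSpace ℝ E]
    [CompleteSpace E] [NormedAddCommGroup V] [NormedSpace ℝ V] [CompleteSpace V]
    {H : E → V} {H' : E →L[ℝ] V} {x : E} (hH : HasStrictFDerivAt H H' x)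
    (hsurj : Function.Surjective H') (h0 : H x = 0) :
    ∃ K : ℝ, ∀ᶠ b in 𝓝 x, ∃ z, H z = 0 ∧ ‖z - b‖ ≤ K * ‖H b‖ := by
  have hr : LinearMap.range (H' : E →ₗ[ℝ] V) = ⊤ := LinearMap.range_eq_top.2 hsurj
  set N := H'.nonlinearRightInverseOfSurjective hr
  have hNpos : 0 < N.nnnorm := H'.nonlinearRightInverseOfSurjective_nnnorm_pos hr
  set c : NNReal := N.nnnorm⁻¹ / 2 with hc
  have hcpos : 0 < c := by positivity
  obtain ⟨s, hs, happ⟩ := hH.approximates_deriv_on_nhds (Or.inr hcpos)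
  obtain ⟨ρ, hρ, hρs⟩ := Metric.mem_nhds_iff.1 hs
  set K : ℝ := 2 * N.nnnorm with hK
  have hKc : ((N.nnnorm : ℝ)⁻¹ - c) * K = 1 := by
    have : (N.nnnorm : ℝ) ≠ 0 := by positivity
    rw [hc, hK]; push_cast; field_simp; norm_num
  refine ⟨K, ?_⟩
  have hcont : Tendsto (fun b => K * ‖H b‖) (𝓝 x) (𝓝 0) := by
    have h1 : ContinuousAt (fun b => K * ‖H b‖) x :=
      continuousAt_const.mul hH.continuousAt.norm
    simpa [ContinuousAt, h0] using h1
  filter_upwards [hcont.eventually_lt_const (half_pos hρ), Metric.ball_mem_nhds x (half_pos hρ)]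
    with b hb hbx
  have hKb : 0 ≤ K * ‖H b‖ := by positivity
  have hsub : Metric.closedBall b (K * ‖H b‖) ⊆ s := by
    intro z hz
    apply hρs
    rw [Metric.mem_closedBall] at hz
    rw [Metric.mem_ball] at hbx ⊢
    linarith [dist_triangle z b x]
  obtain ⟨z, hz, hz0⟩ := happ.surjOn_closedBall_of_nonlinearRightInverse N hKb hsub
    (show (0 : V) ∈ Metric.closedBall (H b) _ by
      rw [← mul_assoc, hKc, one_mul, Metric.mem_closedBall, dist_zero_left])
  exact ⟨z, hz0, by simpa [dist_eq_norm] using hz⟩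

/-- Second-order expansion along the parabola `t ↦ x + t d + (t² / 2) w`. -/
theorem ContDiffAt.taylor_parabola {E V : Type*} [NormedAddCommGroup E] [NormedSpace ℝ E]
    [NormedAddCommGroup V] [NormedSpace ℝ V] {φ : E → V} {x : E} (hφ : ContDiffAt ℝ 2 φ x)
    (d w : E) :
    (fun t : ℝ => φ (x + t • d + (t ^ 2 / 2) • w)
      - (φ x + t • fderiv ℝ φ x d
        + (t ^ 2 / 2) • (fderiv ℝ φ x w + fderiv ℝ (fderiv ℝ φ) x d d)))
      =o[𝓝 0] fun t => t ^ 2 := by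
  set c : ℝ → E := fun t => x + t • d + (t ^ 2 / 2) • w with hc
  have hc0 : c 0 = x := by simp [hc]
  have hcd : ∀ t, HasDerivAt c (d + t • w) t := by
    intro t
    have h1 : HasDerivAt (fun t : ℝ => x + t • d) ((1 : ℝ) • d) t :=
      ((hasDerivAt_id t).smul_const d).const_add x
    have h2 : HasDerivAt (fun t : ℝ => (t ^ 2 / 2) • w) (t • w) t := by
      have : HasDerivAt (fun t : ℝ => t ^ 2 / 2) t t := by
        simpa using (hasDerivAt_pow 2 t).div_const 2
      exact this.smul_const w
    convert! h1.add h2 using 1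
    simp
  have hdiff : ∀ᶠ z in 𝓝 x, DifferentiableAt ℝ φ z := by
    filter_upwards [hφ.eventually (by simp)] with z hz using hz.differentiableAt (by simp)
  have hcc : ContinuousAt c 0 := (hcd 0).continuousAt
  have hev : ∀ᶠ t in 𝓝 (0 : ℝ), DifferentiableAt ℝ φ (c t) :=
    (hc0 ▸ hcc.tendsto : Tendsto c (𝓝 0) (𝓝 x)).eventually hdiff
  obtain ⟨ρ, hρ, hball⟩ := Metric.eventually_nhds_iff_ball.1 hev
  have hD2 : HasFDerivAt (fderiv ℝ φ) (fderiv ℝ (fderiv ℝ φ) x) (c 0) := by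
    rw [hc0]
    exact ((hφ.fderiv_right (m := 1) (by norm_num)).differentiableAt (by simp)).hasFDerivAt
  have hder : HasDerivAt (fun t => fderiv ℝ φ (c t) (d + t • w))
      (fderiv ℝ (fderiv ℝ φ) x d d + fderiv ℝ φ x w) 0 := by
    have h1 := hD2.comp_hasDerivAt (0 : ℝ) (hcd 0)
    have h2 : HasDerivAt (fun t : ℝ => d + t • w) w 0 := by
      simpa using ((hasDerivAt_id (0 : ℝ)).smul_const w).const_add d
    have := h1.clm_apply h2
    simpa [hc0] using this
  have hlo := hder.isLittleO
  have key := (convex_ball (0 : ℝ) ρ).isLittleO_pow_succ_real (Metric.mem_ball_self hρ) (n := 1)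
    (f := fun t => φ (c t) - (t • fderiv ℝ φ x d
        + (t ^ 2 / 2) • (fderiv ℝ φ x w + fderiv ℝ (fderiv ℝ φ) x d d)))
    (f' := fun t => fderiv ℝ φ (c t) (d + t • w) - (fderiv ℝ φ x d
        + t • (fderiv ℝ φ x w + fderiv ℝ (fderiv ℝ φ) x d d))) ?_ ?_
  · rw [nhdsWithin_eq_nhds.2 (Metric.ball_mem_nhds _ hρ)] at key
    simpa [hc0, hc, sub_sub, add_comm, add_left_comm, add_assoc] using key
  · intro t ht
    refine HasDerivAt.hasDerivWithinAt ?_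
    have h1 := (hball t ht).hasFDerivAt.comp_hasDerivAt t (hcd t)
    have h2 : HasDerivAt (fun t : ℝ => t ^ 2 / 2) t t := by
      simpa using (hasDerivAt_pow 2 t).div_const 2
    have h3 := ((hasDerivAt_id t).smul_const (fderiv ℝ φ x d)).add
      (h2.smul_const (fderiv ℝ φ x w + fderiv ℝ (fderiv ℝ φ) x d d))
    convert! h1.sub h3 using 1
    simp
  · rw [nhdsWithin_eq_nhds.2 (Metric.ball_mem_nhds _ hρ)]
    simpa [hc0, sub_sub, add_comm, add_left_comm, add_assoc] using hlo

/-- A curve in the zero set of `H` which agrees to second order with a parabola satisfying the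
first- and second-order linearised equations. -/
theorem exists_curve_in_zero_set {E V : Type*} [NormedAddCommGroup E] [NormedSpace ℝ E]
    [CompleteSpace E] [NormedAddCommGroup V] [NormedSpace ℝ V] [CompleteSpace V]
    {H : E → V} {x : E} (hH : ContDiffAt ℝ 2 H x)
    (hsurj : Function.Surjective (fderiv ℝ H x)) (h0 : H x = 0) {d w : E}
    (hd : fderiv ℝ H x d = 0) (hw : fderiv ℝ H x w + fderiv ℝ (fderiv ℝ H) x d d = 0) :
    ∃ z : ℝ → E, (∀ᶠ t in 𝓝 0, H (z t) = 0) ∧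
      (fun t => z t - (x + t • d + (t ^ 2 / 2) • w)) =o[𝓝 0] fun t => t ^ 2 := by
  obtain ⟨K, hK⟩ := (hH.hasStrictFDerivAt (by simp)).exists_zero_near hsurj h0
  have hcont : Tendsto (fun t : ℝ => x + t • d + (t ^ 2 / 2) • w) (𝓝 0) (𝓝 x) := by
    have : Continuous (fun t : ℝ => x + t • d + (t ^ 2 / 2) • w) := by fun_prop
    simpa using this.tendsto 0
  have hev := hcont.eventually hK
  choose! z hz using fun (t : ℝ) (ht : ∃ z, H z = 0 ∧
    ‖z - (x + t • d + (t ^ 2 / 2) • w)‖ ≤ K * ‖H (x + t • d + (t ^ 2 / 2) • w)‖) => ht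
  refine ⟨z, hev.mono fun t ht => (hz t ht).1, ?_⟩
  have hT := hH.taylor_parabola d w
  simp only [h0, hd, hw, smul_zero, add_zero, sub_zero] at hT
  refine Asymptotics.IsBigO.trans_isLittleO ?_ hT
  exact Asymptotics.IsBigO.of_bound K (hev.mono fun t ht => (hz t ht).2)

/-- The second-order expansion persists under perturbations of order `o(t²)`. -/
theorem ContDiffAt.taylor_curve {E V : Type*} [NormedAddCommGroup E] [NormedSpace ℝ E]
    [NormedAddCommGroup V] [NormedSpace ℝ V] {φ : E → V} {x : E} (hφ : ContDiffAt ℝ 2 φ x)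
    {d w : E} {z : ℝ → E}
    (hz : (fun t => z t - (x + t • d + (t ^ 2 / 2) • w)) =o[𝓝 0] fun t => t ^ 2) :
    Tendsto z (𝓝 0) (𝓝 x) ∧ (fun t : ℝ => φ (z t)
      - (φ x + t • fderiv ℝ φ x d
        + (t ^ 2 / 2) • (fderiv ℝ φ x w + fderiv ℝ (fderiv ℝ φ) x d d)))
      =o[𝓝 0] fun t => t ^ 2 := by
  have hcont : Tendsto (fun t : ℝ => x + t • d + (t ^ 2 / 2) • w) (𝓝 0) (𝓝 x) := by
    have : Continuous (fun t : ℝ => x + t • d + (t ^ 2 / 2) • w) := by fun_prop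
    simpa using this.tendsto 0
  have hzx : Tendsto z (𝓝 0) (𝓝 x) := by
    have h2 : Tendsto (fun t : ℝ => t ^ 2) (𝓝 0) (𝓝 0) := by
      simpa using (continuous_pow 2).tendsto (0 : ℝ)
    simpa using (hz.trans_tendsto h2).add hcont
  refine ⟨hzx, ?_⟩
  have hbig := (hφ.hasStrictFDerivAt (by simp)).isBigO_sub.comp_tendsto (hzx.prodMk_nhds hcont)
  have hlo := Asymptotics.IsBigO.trans_isLittleO hbig hz
  refine (hlo.add (hφ.taylor_parabola d w)).congr_left fun t => ?_
  simp

/-- A function with nonpositive first-order term, and negative second-order term where the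
first-order term vanishes, decreases along the curve. -/
theorem ContDiffAt.eventually_lt_along_curve {E : Type*} [NormedAddCommGroup E] [NormedSpace ℝ E]
    {φ : E → ℝ} {x : E} (hφ : ContDiffAt ℝ 2 φ x) {d w : E} {z : ℝ → E}
    (hz : (fun t => z t - (x + t • d + (t ^ 2 / 2) • w)) =o[𝓝 0] fun t => t ^ 2)
    (h1 : fderiv ℝ φ x d ≤ 0)
    (h2 : fderiv ℝ φ x d = 0 → fderiv ℝ φ x w + fderiv ℝ (fderiv ℝ φ) x d d < 0) :
    ∀ᶠ t in 𝓝[>] 0, φ (z t) < φ x := by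
  have hT := (hφ.taylor_curve hz).2
  set a := fderiv ℝ φ x d
  set b := fderiv ℝ φ x w + fderiv ℝ (fderiv ℝ φ) x d d
  rcases h1.lt_or_eq with ha | ha
  · have hsm : ∀ᶠ t : ℝ in 𝓝 0, t * (|b| / 2 + 1) < -a := by
      have : Tendsto (fun t : ℝ => t * (|b| / 2 + 1)) (𝓝 0) (𝓝 0) := by
        have h : Continuous fun t : ℝ => t * (|b| / 2 + 1) := by fun_prop
        simpa using h.tendsto 0
      exact this.eventually_lt_const (by linarith)
    filter_upwards [nhdsWithin_le_nhds (hT.def one_pos), nhdsWithin_le_nhds hsm,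
      self_mem_nhdsWithin] with t ht hs (hpos : 0 < t)
    simp only [Real.norm_eq_abs, smul_eq_mul, one_mul, abs_of_nonneg (sq_nonneg t)] at ht
    have h3 := (abs_le.1 ht).2
    have h4 : t * (t * (|b| / 2 + 1)) < t * (-a) := mul_lt_mul_of_pos_left hs hpos
    have h5 : t ^ 2 * b ≤ t ^ 2 * |b| := mul_le_mul_of_nonneg_left (le_abs_self b) (sq_nonneg t)
    nlinarith
  · have hb := h2 ha
    have hpos4 : 0 < -b / 4 := by linarith
    filter_upwards [nhdsWithin_le_nhds (hT.def hpos4), self_mem_nhdsWithin]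
      with t ht (hpos : 0 < t)
    simp only [Real.norm_eq_abs, smul_eq_mul, abs_of_nonneg (sq_nonneg t), ha, mul_zero,
      add_zero] at ht
    have h3 := (abs_le.1 ht).2
    have h5 : t ^ 2 * b < 0 := mul_neg_of_pos_of_neg (by positivity) hb
    linarith

/-- A theorem of the alternative: if the affine system `B w = β`, `a i w + α i < 0` (`i ∈ P`) has
no solution, then there are nonnegative multipliers supported on `P`, not all zero, whose
combination of the `a i` factors through `B` and has nonnegative constant term. -/
theorem exists_multipliers_of_infeasible {E V ι : Type*} [AddCommGroup E] [Module ℝ E]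
    [AddCommGroup V] [Module ℝ V] [Fintype ι] (a : ι → E →ₗ[ℝ] ℝ) (α : ι → ℝ) (P : ι → Prop)
    (B : E →ₗ[ℝ] V) (hB : Function.Surjective B) (β : V)
    (hno : ¬ ∃ w, B w = β ∧ ∀ i, P i → a i w + α i < 0) :
    ∃ (c : ι → ℝ) (ν : V →ₗ[ℝ] ℝ), (∀ i, 0 ≤ c i) ∧ (∀ i, ¬ P i → c i = 0) ∧ c ≠ 0 ∧
      (∀ w, ∑ i, c i * a i w = ν (B w)) ∧ 0 ≤ ∑ i, c i * α i + ν β := by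
  classical
  -- `S` collects the right-hand sides for which the system is solvable; it is open, convex and
  -- misses `0`, and `-c` is the functional separating it from `0`.
  set S : Set (ι → ℝ) := {v | ∃ w, B w = β ∧ ∀ i, P i → a i w + α i < v i} with hS
  have hSopen : IsOpen S := by
    have : S = ⋃ w ∈ {w | B w = β}, {v : ι → ℝ | ∀ i, P i → a i w + α i < v i} := by
      ext v; simp [hS]
    rw [this]
    refine isOpen_biUnion fun w _ => ?_
    simp only [ofPred_forall]
    refine isOpen_iInter_of_finite fun i => isOpen_iInter_of_finite fun _ => ?_
    exact isOpen_lt continuous_const (continuous_apply i)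
  have hSconv : Convex ℝ S := by
    rintro v ⟨w, hw, hv⟩ v' ⟨w', hw', hv'⟩ s t hs ht hst
    refine ⟨s • w + t • w', ?_, fun i hi => ?_⟩
    · rw [map_add, map_smul, map_smul, hw, hw', ← add_smul, hst, one_smul]
    · have h1 := hv i hi
      have h2 := hv' i hi
      simp only [map_add, map_smul, smul_eq_mul, Pi.add_apply, Pi.smul_apply]
      have e : α i = s * α i + t * α i := by rw [← add_mul, hst, one_mul]
      rw [e]
      rcases hs.eq_or_lt with rfl | hs'
      · have : t = 1 := by linarith
        subst this; simpa using h2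
      · nlinarith [mul_lt_mul_of_pos_left h1 hs', mul_le_mul_of_nonneg_left h2.le ht]
  have h0S : (0 : ι → ℝ) ∉ S := by
    rintro ⟨w, hw, hv⟩
    exact hno ⟨w, hw, hv⟩
  obtain ⟨g, hg⟩ := geometric_hahn_banach_open_point hSconv hSopen h0S
  simp only [map_zero] at hg
  set c : ι → ℝ := fun i => - g (Pi.single i 1) with hc
  have hgc : ∀ v, g v = -∑ i, c i * v i := by
    intro v
    conv_lhs => rw [pi_eq_sum_univ' v]
    simp [hc, map_sum, mul_comm]
  obtain ⟨w₀, hw₀⟩ := hB β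
  have hv₀ : (fun i => a i w₀ + α i + 1) ∈ S := ⟨w₀, hw₀, fun i _ => by simp⟩
  set v₀ : ι → ℝ := fun i => a i w₀ + α i + 1
  -- An affine function bounded above on a half line has nonpositive slope.
  have hlin : ∀ A b : ℝ, (∀ t : ℝ, 0 ≤ t → A + t * b < 0) → b ≤ 0 := by
    intro A b h
    by_contra! hb
    have := h (|A| / b) (by positivity)
    rw [div_mul_cancel₀ _ hb.ne'] at this
    linarith [neg_abs_le A]
  have hcnn : ∀ i, 0 ≤ c i := by
    intro i
    have := hlin (g v₀) (g (Pi.single i 1)) fun t ht => by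
      have hm : v₀ + t • Pi.single i 1 ∈ S := by
        refine ⟨w₀, hw₀, fun j _ => ?_⟩
        have : 0 ≤ t * (Pi.single i (1 : ℝ) : ι → ℝ) j := by
          refine mul_nonneg ht ?_
          by_cases hij : j = i
          · subst hij; simp
          · simp [hij]
        simp only [v₀, Pi.add_apply, Pi.smul_apply, smul_eq_mul]
        linarith
      simpa using hg _ hm
    simp only [hc]; linarith
  have hcP : ∀ i, ¬ P i → c i = 0 := by
    intro i hi
    have := hlin (g v₀) (-g (Pi.single i 1)) fun t _ => by
      have hm : v₀ - t • Pi.single i 1 ∈ S := by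
        refine ⟨w₀, hw₀, fun j hj => ?_⟩
        have hij : j ≠ i := by rintro rfl; exact hi hj
        simp [v₀, hij]
      simpa [sub_eq_add_neg] using hg _ hm
    exact le_antisymm this (hcnn i)
  -- The vector with entries `a i w + α i` is a limit of points of `S`.
  have hge : ∀ w, B w = β → 0 ≤ ∑ i, c i * a i w + ∑ i, c i * α i := by
    intro w hw
    have : ∀ ε : ℝ, 0 < ε → 0 ≤ (∑ i, c i * a i w + ∑ i, c i * α i) + ε * ∑ i, c i := by
      intro ε hε
      have h1 := hg _ (show (fun i => a i w + α i + ε) ∈ S from ⟨w, hw, fun i _ => by simp [hε]⟩)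
      rw [hgc] at h1
      have h2 : ∑ i, c i * (a i w + α i + ε)
          = (∑ i, c i * a i w + ∑ i, c i * α i) + ε * ∑ i, c i := by
        rw [Finset.mul_sum, ← Finset.sum_add_distrib, ← Finset.sum_add_distrib]
        exact Finset.sum_congr rfl fun i _ => by ring
      rw [h2] at h1
      linarith
    have hlim : Tendsto (fun ε : ℝ => (∑ i, c i * a i w + ∑ i, c i * α i) + ε * ∑ i, c i)
        (𝓝[>] 0) (𝓝 ((∑ i, c i * a i w + ∑ i, c i * α i) + 0 * ∑ i, c i)) := by
      apply Tendsto.mono_left _ nhdsWithin_le_nhds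
      exact Continuous.tendsto (by fun_prop) 0
    have := ge_of_tendsto hlim (eventually_mem_nhdsWithin.mono fun ε hε => this ε hε)
    simpa using this
  set Lc : E →ₗ[ℝ] ℝ := ∑ i, c i • a i with hLc
  have hLcapp : ∀ w, Lc w = ∑ i, c i * a i w := by
    intro w; simp [hLc, LinearMap.sum_apply]
  have hker : ∀ k, B k = 0 → Lc k = 0 := by
    intro k hk
    have h1 : ∀ t : ℝ, 0 ≤ (Lc w₀ + ∑ i, c i * α i) + t * Lc k := by
      intro t
      have := hge (w₀ + t • k) (by simp [hw₀, hk])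
      rw [← hLcapp] at this
      simp only [map_add, map_smul, smul_eq_mul] at this
      linarith
    have h2 := hlin (-(Lc w₀ + ∑ i, c i * α i) - 1) (-Lc k) fun t _ => by linarith [h1 t]
    have h3 := hlin (-(Lc w₀ + ∑ i, c i * α i) - 1) (Lc k) fun t _ => by linarith [h1 (-t)]
    linarith
  -- The combination is bounded below on the affine space `B w = β`, so it vanishes on `ker B`.
  obtain ⟨R, hR⟩ := B.exists_rightInverse_of_surjective (LinearMap.range_eq_top.2 hB)
  have hRapp : ∀ v, B (R v) = v := fun v => by
    simpa using LinearMap.congr_fun hR v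
  have hν : ∀ w, Lc w = (Lc.comp R) (B w) := by
    intro w
    have := hker (w - R (B w)) (by rw [map_sub, hRapp, sub_self])
    rw [map_sub, sub_eq_zero] at this
    simpa using this
  refine ⟨c, Lc.comp R, hcnn, hcP, ?_, fun w => by rw [← hLcapp, hν], ?_⟩
  · intro h0
    have := hg _ hv₀
    rw [hgc, h0] at this
    simp at this
  · have := hge w₀ hw₀
    rw [← hLcapp, hν, hw₀] at this
    linarith

/-- The Lagrangian of: minimise `F` subject to `H = 0`, `G ≤ 0`. -/
def nlpLagrangian {E : Type*} {p q : ℕ} (F : E → ℝ) (H : E → Vec p) (G : E → Vec q)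
    (l : Vec p × Vec q) (x : E) : ℝ :=
  F x + inner ℝ l.1 (H x) + inner ℝ l.2 (G x)

/-- The set of Lagrange multipliers at `x` of: minimise `F` subject to `H = 0`, `G ≤ 0`. -/
def nlpMultipliers {E : Type*} [NormedAddCommGroup E] [NormedSpace ℝ E] {p q : ℕ}
    (F : E → ℝ) (H : E → Vec p) (G : E → Vec q) (x : E) : Set (Vec p × Vec q) :=
  {l | fderiv ℝ (nlpLagrangian F H G l) x = 0 ∧ H x = 0 ∧
    (∀ i, 0 ≤ l.2 i) ∧ (∀ i, G x i ≤ 0) ∧ inner ℝ l.2 (G x) = 0}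

theorem EuclideanSpace.inner_eq_sum {k : ℕ} (a b : Vec k) : inner ℝ a b = ∑ i, a i * b i := by
  simp [PiLp.inner_apply, mul_comm]

/-- Complementarity of two vectors of opposite sign holds in every coordinate. -/
theorem mul_eq_zero_of_inner_eq_zero {k : ℕ} {a b : Vec k} (ha : ∀ i, 0 ≤ a i) (hb : ∀ i, b i ≤ 0)
    (hab : inner ℝ a b = 0) (i : Fin k) : a i * b i = 0 := by
  rw [EuclideanSpace.inner_eq_sum] at hab
  exact (Finset.sum_eq_zero_iff_of_nonpos fun i _ =>
    mul_nonpos_of_nonneg_of_nonpos (ha i) (hb i)).1 hab i (Finset.mem_univ i)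

theorem fderiv_euclidean_apply {E : Type*} [NormedAddCommGroup E] [NormedSpace ℝ E] {k : ℕ}
    {φ : E → Vec k} {x : E} (hφ : DifferentiableAt ℝ φ x) (i : Fin k) :
    fderiv ℝ (fun z => φ z i) x = (EuclideanSpace.proj i : Vec k →L[ℝ] ℝ).comp (fderiv ℝ φ x) :=
  ((EuclideanSpace.proj i : Vec k →L[ℝ] ℝ).hasFDerivAt.comp x hφ.hasFDerivAt).fderiv

theorem ContDiffAt.euclidean_apply {E : Type*} [NormedAddCommGroup E] [NormedSpace ℝ E] {k : ℕ}
    {N : WithTop ℕ∞} {φ : E → Vec k} {x : E} (hφ : ContDiffAt ℝ N φ x) (i : Fin k) :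
    ContDiffAt ℝ N (fun z => φ z i) x :=
  (EuclideanSpace.proj i : Vec k →L[ℝ] ℝ).contDiff.contDiffAt.comp x hφ

/-- MFCQ in terms of the derivatives of the vector-valued constraint maps. -/
theorem mfcq_iff {E : Type*} [NormedAddCommGroup E] [NormedSpace ℝ E] {p q : ℕ}
    {H : E → Vec p} {G : E → Vec q} {x : E} (hH : DifferentiableAt ℝ H x)
    (hG : DifferentiableAt ℝ G x) :
    MFCQ (fun (j : Fin p) z => H z j) (fun (i : Fin q) z => G z i) x ↔
      (∀ c : Vec p, (∀ w, inner ℝ c (fderiv ℝ H x w) = 0) → c = 0) ∧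
        ∃ d, fderiv ℝ H x d = 0 ∧ ∀ i, G x i = 0 → fderiv ℝ G x d i < 0 := by
  unfold MFCQ
  refine and_congr ?_ (exists_congr fun d => and_congr ?_ (forall_congr' fun i => ?_))
  · rw [Fintype.linearIndependent_iff]
    constructor
    · intro h c hc
      ext j
      refine h c ?_ j
      ext w
      simpa [fderiv_euclidean_apply hH, EuclideanSpace.inner_eq_sum] using hc w
    · intro h c hc j
      have := h (WithLp.toLp 2 c) fun w => by
        simpa [fderiv_euclidean_apply hH, EuclideanSpace.inner_eq_sum] using
          DFunLike.congr_fun hc w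
      simpa using congrArg (fun v : Vec p => v j) this
  · simp only [fderiv_euclidean_apply hH]
    constructor
    · intro h; ext j; simpa using h j
    · intro h j; simp [h]
  · simp [fderiv_euclidean_apply hG]

theorem surjective_of_inner_eq_zero {E : Type*} [NormedAddCommGroup E] [NormedSpace ℝ E] {p : ℕ}
    {B : E →L[ℝ] Vec p} (h : ∀ c : Vec p, (∀ w, inner ℝ c (B w) = 0) → c = 0) :
    Function.Surjective B := by
  have : (LinearMap.range (B : E →ₗ[ℝ] Vec p))ᗮ = ⊥ := by
    rw [Submodule.eq_bot_iff]
    intro c hc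
    refine h c fun w => ?_
    rw [real_inner_comm]
    exact (Submodule.mem_orthogonal _ _).1 hc (B w) ⟨w, rfl⟩
  exact LinearMap.range_eq_top.1 ((Submodule.orthogonal_eq_bot_iff).1 this)

theorem hasFDerivAt_nlpLagrangian {E : Type*} [NormedAddCommGroup E] [NormedSpace ℝ E] {p q : ℕ}
    {F : E → ℝ} {H : E → Vec p} {G : E → Vec q} {x : E} (hF : DifferentiableAt ℝ F x)
    (hH : DifferentiableAt ℝ H x) (hG : DifferentiableAt ℝ G x) (l : Vec p × Vec q) :
    HasFDerivAt (nlpLagrangian F H G l)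
      (fderiv ℝ F x + (innerSL ℝ l.1).comp (fderiv ℝ H x)
        + (innerSL ℝ l.2).comp (fderiv ℝ G x)) x :=
  (hF.hasFDerivAt.add ((innerSL ℝ l.1).hasFDerivAt.comp x hH.hasFDerivAt)).add
    ((innerSL ℝ l.2).hasFDerivAt.comp x hG.hasFDerivAt)

theorem fderiv_nlpLagrangian_apply {E : Type*} [NormedAddCommGroup E] [NormedSpace ℝ E] {p q : ℕ}
    {F : E → ℝ} {H : E → Vec p} {G : E → Vec q} {x : E} (hF : DifferentiableAt ℝ F x)
    (hH : DifferentiableAt ℝ H x) (hG : DifferentiableAt ℝ G x) (l : Vec p × Vec q) (w : E) :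
    fderiv ℝ (nlpLagrangian F H G l) x w
      = fderiv ℝ F x w + inner ℝ l.1 (fderiv ℝ H x w) + inner ℝ l.2 (fderiv ℝ G x w) := by
  rw [(hasFDerivAt_nlpLagrangian hF hH hG l).fderiv]
  simp

theorem hessQuad_nlpLagrangian {E : Type*} [NormedAddCommGroup E] [NormedSpace ℝ E] {p q : ℕ}
    {F : E → ℝ} {H : E → Vec p} {G : E → Vec q} {x : E} (hF : ContDiffAt ℝ 2 F x)
    (hH : ContDiffAt ℝ 2 H x) (hG : ContDiffAt ℝ 2 G x) (l : Vec p × Vec q) (d : E) :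
    hessQuad (nlpLagrangian F H G l) x d
      = fderiv ℝ (fderiv ℝ F) x d d + inner ℝ l.1 (fderiv ℝ (fderiv ℝ H) x d d)
        + inner ℝ l.2 (fderiv ℝ (fderiv ℝ G) x d d) := by
  have hev : fderiv ℝ (nlpLagrangian F H G l) =ᶠ[𝓝 x] fun z =>
      fderiv ℝ F z + (innerSL ℝ l.1).comp (fderiv ℝ H z)
        + (innerSL ℝ l.2).comp (fderiv ℝ G z) := by
    filter_upwards [hF.eventually (by simp), hH.eventually (by simp), hG.eventually (by simp)]
      with z h1 h2 h3
    exact (hasFDerivAt_nlpLagrangian (h1.differentiableAt (by simp))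
      (h2.differentiableAt (by simp)) (h3.differentiableAt (by simp)) l).fderiv
  have d1 {V : Type} [NormedAddCommGroup V] [NormedSpace ℝ V] {φ : E → V}
      (h : ContDiffAt ℝ 2 φ x) : HasFDerivAt (fderiv ℝ φ) (fderiv ℝ (fderiv ℝ φ) x) x :=
    ((h.fderiv_right (m := 1) (by norm_num)).differentiableAt (by simp)).hasFDerivAt
  have h2 : HasFDerivAt (fun z => (innerSL ℝ l.1).comp (fderiv ℝ H z)) _ x :=
    (ContinuousLinearMap.compL ℝ E (Vec p) ℝ (innerSL ℝ l.1)).hasFDerivAt.comp x (d1 hH)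
  have h3 : HasFDerivAt (fun z => (innerSL ℝ l.2).comp (fderiv ℝ G z)) _ x :=
    (ContinuousLinearMap.compL ℝ E (Vec q) ℝ (innerSL ℝ l.2)).hasFDerivAt.comp x (d1 hG)
  unfold hessQuad
  rw [hev.fderiv_eq.trans (((d1 hF).add h2).add h3).fderiv]
  simp

/-- Second-order necessary condition in a direction annihilated by the objective: otherwise the
second-order linearised system is solvable, and a feasible curve of descent exists. MFCQ rules out
a vanishing multiplier of the objective. -/
theorem exists_multiplier_hessQuad_nonneg {E : Type*} [NormedAddCommGroup E] [NormedSpace ℝ E]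
    [CompleteSpace E] {p q : ℕ} {F : E → ℝ} {H : E → Vec p} {G : E → Vec q} {x : E}
    (hF : ContDiffAt ℝ 2 F x) (hH : ContDiffAt ℝ 2 H x) (hG : ContDiffAt ℝ 2 G x)
    (hHx : H x = 0) (hGx : ∀ i, G x i ≤ 0)
    (hmin : IsLocalMinOn F {z | H z = 0 ∧ ∀ i, G z i ≤ 0} x)
    (hcq : MFCQ (fun (j : Fin p) z => H z j) (fun (i : Fin q) z => G z i) x) {d : E}
    (hHd : fderiv ℝ H x d = 0) (hGd : ∀ i, G x i = 0 → fderiv ℝ G x d i ≤ 0)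
    (hFd : fderiv ℝ F x d = 0) :
    ∃ l ∈ nlpMultipliers F H G x, 0 ≤ hessQuad (nlpLagrangian F H G l) x d := by
  have dF := hF.differentiableAt (by simp)
  have dH := hH.differentiableAt (by simp)
  have dG := hG.differentiableAt (by simp)
  obtain ⟨hli, d₀, hHd₀, hGd₀⟩ := (mfcq_iff dH dG).1 hcq
  have hsurj := surjective_of_inner_eq_zero hli
  -- The index `none` stands for the objective, `some i` for the `i`-th inequality.
  let a : Option (Fin q) → E →ₗ[ℝ] ℝ := fun o => o.elim (fderiv ℝ F x : E →ₗ[ℝ] ℝ)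
    fun i => ((EuclideanSpace.proj i : Vec q →L[ℝ] ℝ).comp (fderiv ℝ G x) : E →L[ℝ] ℝ)
  let α : Option (Fin q) → ℝ := fun o => o.elim (fderiv ℝ (fderiv ℝ F) x d d)
    fun i => fderiv ℝ (fderiv ℝ G) x d d i
  let P : Option (Fin q) → Prop := fun o => o.elim True
    fun i => G x i = 0 ∧ fderiv ℝ G x d i = 0
  have hno : ¬ ∃ w, (fderiv ℝ H x : E →ₗ[ℝ] Vec p) w = - fderiv ℝ (fderiv ℝ H) x d d ∧
      ∀ o, P o → a o w + α o < 0 := by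
    rintro ⟨w, hw, hlt⟩
    obtain ⟨z, hzH, hz⟩ := exists_curve_in_zero_set hH hsurj hHx hHd
      (w := w) (by
        have : fderiv ℝ H x w = - fderiv ℝ (fderiv ℝ H) x d d := hw
        rw [this, neg_add_cancel])
    have hzx := (hF.taylor_curve hz).1
    have hFlt := hF.eventually_lt_along_curve hz hFd.le fun _ => hlt none trivial
    have hGle : ∀ᶠ t in 𝓝[>] (0 : ℝ), ∀ i, G (z t) i ≤ 0 := by
      refine eventually_all.2 fun i => ?_
      rcases (hGx i).lt_or_eq with hi | hi
      · have hc : Tendsto (fun t => G (z t) i) (𝓝 0) (𝓝 (G x i)) :=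
          ((hG.euclidean_apply i).continuousAt.tendsto).comp hzx
        exact nhdsWithin_le_nhds ((hc.eventually_lt_const hi).mono fun t ht => ht.le)
      · have hC := hG.euclidean_apply i
        have e1 : ∀ v, fderiv ℝ (fun z => G z i) x v = fderiv ℝ G x v i := fun v => by
          rw [fderiv_euclidean_apply dG]; rfl
        have e2 : fderiv ℝ (fderiv ℝ (fun z => G z i)) x d d
            = fderiv ℝ (fderiv ℝ G) x d d i := by
          have hev : fderiv ℝ (fun z => G z i) =ᶠ[𝓝 x] fun z =>
              (EuclideanSpace.proj i : Vec q →L[ℝ] ℝ).comp (fderiv ℝ G z) := by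
            filter_upwards [hG.eventually (by simp)] with z hz
            exact fderiv_euclidean_apply (hz.differentiableAt (by simp)) i
          have hd2 := ((hG.fderiv_right (m := 1) (by norm_num)).differentiableAt
            (by simp)).hasFDerivAt
          have h2 : HasFDerivAt (fun z =>
              (EuclideanSpace.proj i : Vec q →L[ℝ] ℝ).comp (fderiv ℝ G z)) _ x :=
            (ContinuousLinearMap.compL ℝ E (Vec q) ℝ
              (EuclideanSpace.proj i)).hasFDerivAt.comp x hd2
          rw [hev.fderiv_eq, h2.fderiv]
          rfl
        have := hC.eventually_lt_along_curve hz (by rw [e1]; exact hGd i hi) fun h0 => by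
          rw [e1] at h0
          rw [e1, e2]
          exact hlt (some i) ⟨hi, h0⟩
        filter_upwards [this] with t ht
        exact (ht.trans_eq hi).le
    have hmin' : ∀ᶠ t in 𝓝[>] (0 : ℝ), H (z t) = 0 ∧ (∀ i, G (z t) i ≤ 0) → F x ≤ F (z t) := by
      have := hzx.eventually (eventually_nhdsWithin_iff.1 hmin)
      exact nhdsWithin_le_nhds this
    obtain ⟨t, h1, h2, h3, h4⟩ :=
      (hFlt.and (hGle.and (hmin'.and (nhdsWithin_le_nhds hzH)))).exists
    exact absurd h1 (not_lt.2 (h3 ⟨h4, h2⟩))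
  obtain ⟨c, ν, hc0, hcP, hcne, hcν, hcα⟩ := exists_multipliers_of_infeasible a α P
    (fderiv ℝ H x : E →ₗ[ℝ] Vec p) hsurj _ hno
  set lH : Vec p := -(InnerProductSpace.toDual ℝ (Vec p)).symm ν.toContinuousLinearMap with hlH
  have hlHapp : ∀ v, inner ℝ lH v = -ν v := by
    intro v
    rw [hlH, inner_neg_left, InnerProductSpace.toDual_symm_apply]
    rfl
  set lG : Vec q := WithLp.toLp 2 (fun i => c (some i)) with hlG
  have hsum : ∀ w, c none * fderiv ℝ F x w + inner ℝ lG (fderiv ℝ G x w)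
      + inner ℝ lH (fderiv ℝ H x w) = 0 := by
    intro w
    have := hcν w
    rw [Fintype.sum_option] at this
    rw [hlHapp, EuclideanSpace.inner_eq_sum]
    have e : ν (fderiv ℝ H x w) = ν ((fderiv ℝ H x : E →ₗ[ℝ] Vec p) w) := rfl
    rw [e, ← this]
    exact add_neg_cancel _
  have hsum2 : 0 ≤ c none * fderiv ℝ (fderiv ℝ F) x d d
      + inner ℝ lG (fderiv ℝ (fderiv ℝ G) x d d)
      + inner ℝ lH (fderiv ℝ (fderiv ℝ H) x d d) := by
    rw [Fintype.sum_option, map_neg] at hcα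
    rw [hlHapp, EuclideanSpace.inner_eq_sum]
    exact hcα
  have hlGP : ∀ i, ¬ (G x i = 0) → lG i = 0 := fun i hi => hcP (some i) fun h => hi h.1
  -- If the objective had multiplier zero, the strictly feasible direction `d₀` of MFCQ would force
  -- all multipliers to vanish.
  have hc_pos : 0 < c none := by
    refine (hc0 none).lt_of_ne fun h0 => hcne ?_
    have h1 := hsum d₀
    rw [← h0, hHd₀, inner_zero_right, zero_mul, zero_add, add_zero,
      EuclideanSpace.inner_eq_sum] at h1
    have hterm : ∀ i ∈ Finset.univ, lG i * fderiv ℝ G x d₀ i ≤ 0 := by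
      intro i _
      by_cases hi : G x i = 0
      · exact mul_nonpos_of_nonneg_of_nonpos (hc0 (some i)) (hGd₀ i hi).le
      · rw [hlGP i hi, zero_mul]
    have h2 := (Finset.sum_eq_zero_iff_of_nonpos hterm).1 h1
    funext o
    cases o with
    | none => exact h0.symm
    | some i =>
      by_cases hi : G x i = 0
      · exact (mul_eq_zero.1 (h2 i (Finset.mem_univ i))).resolve_right (hGd₀ i hi).ne
      · exact hlGP i hi
  refine ⟨((c none)⁻¹ • lH, (c none)⁻¹ • lG), ⟨?_, hHx, ?_, hGx, ?_⟩, ?_⟩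
  · ext w
    rw [fderiv_nlpLagrangian_apply dF dH dG]
    simp only [inner_smul_left, conj_trivial, zero_apply]
    have := hsum w
    field_simp
    linarith
  · intro i
    exact mul_nonneg (inv_nonneg.2 hc_pos.le) (hc0 (some i))
  · rw [inner_smul_left, EuclideanSpace.inner_eq_sum, Finset.sum_eq_zero, mul_zero]
    intro i _
    by_cases hi : G x i = 0
    · rw [hi, mul_zero]
    · rw [hlGP i hi, zero_mul]
  · rw [hessQuad_nlpLagrangian hF hH hG]
    simp only [inner_smul_left, conj_trivial]
    have : fderiv ℝ (fderiv ℝ F) x d d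
        + (c none)⁻¹ * inner ℝ lH (fderiv ℝ (fderiv ℝ H) x d d)
        + (c none)⁻¹ * inner ℝ lG (fderiv ℝ (fderiv ℝ G) x d d)
        = (c none)⁻¹ * (c none * fderiv ℝ (fderiv ℝ F) x d d
          + inner ℝ lG (fderiv ℝ (fderiv ℝ G) x d d)
          + inner ℝ lH (fderiv ℝ (fderiv ℝ H) x d d)) := by
      field_simp; ring
    rw [this]
    exact mul_nonneg (inv_nonneg.2 hc_pos.le) hsum2

theorem isClosed_nlpMultipliers {E : Type*} [NormedAddCommGroup E] [NormedSpace ℝ E] {p q : ℕ}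
    {F : E → ℝ} {H : E → Vec p} {G : E → Vec q} {x : E} (hF : DifferentiableAt ℝ F x)
    (hH : DifferentiableAt ℝ H x) (hG : DifferentiableAt ℝ G x) :
    IsClosed (nlpMultipliers F H G x) := by
  have : nlpMultipliers F H G x = {l : Vec p × Vec q |
      (∀ w, fderiv ℝ F x w + inner ℝ l.1 (fderiv ℝ H x w) + inner ℝ l.2 (fderiv ℝ G x w) = 0) ∧
      H x = 0 ∧ (∀ i, 0 ≤ l.2 i) ∧ (∀ i, G x i ≤ 0) ∧ inner ℝ l.2 (G x) = 0} := by
    ext l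
    simp only [nlpMultipliers, mem_ofPred_eq, ContinuousLinearMap.ext_iff,
      fderiv_nlpLagrangian_apply hF hH hG, zero_apply]
  rw [this]
  simp only [ofPred_and, ofPred_forall]
  refine IsClosed.inter (isClosed_iInter fun w => ?_) (IsClosed.inter isClosed_const
    (IsClosed.inter (isClosed_iInter fun i => ?_) (IsClosed.inter
      (isClosed_iInter fun i => isClosed_const) ?_)))
  · exact isClosed_eq (by fun_prop) continuous_const
  · exact isClosed_le continuous_const (by fun_prop)
  · exact isClosed_eq (by fun_prop) continuous_const

theorem convex_nlpMultipliers {E : Type*} [NormedAddCommGroup E] [NormedSpace ℝ E] {p q : ℕ}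
    {F : E → ℝ} {H : E → Vec p} {G : E → Vec q} {x : E} (hF : DifferentiableAt ℝ F x)
    (hH : DifferentiableAt ℝ H x) (hG : DifferentiableAt ℝ G x) :
    Convex ℝ (nlpMultipliers F H G x) := by
  rintro l ⟨h1, h2, h3, h4, h5⟩ l' ⟨h1', -, h3', -, h5'⟩ s t hs ht hst
  refine ⟨?_, h2, fun i => ?_, h4, ?_⟩
  · ext w
    have e1 := DFunLike.congr_fun h1 w
    have e2 := DFunLike.congr_fun h1' w
    rw [fderiv_nlpLagrangian_apply hF hH hG, zero_apply] at e1 e2 ⊢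
    simp only [Prod.fst_add, Prod.snd_add, Prod.smul_fst, Prod.smul_snd, inner_add_left,
      inner_smul_left, conj_trivial]
    linear_combination s * e1 + t * e2 - fderiv ℝ F x w * hst
  · exact add_nonneg (mul_nonneg hs (h3 i)) (mul_nonneg ht (h3' i))
  · simp only [Prod.snd_add, Prod.smul_snd, inner_add_left, inner_smul_left, h5, h5', mul_zero,
      add_zero]

/-- Under MFCQ the multipliers are bounded: the MFCQ direction bounds the inequality multipliers,
and these determine the equality multipliers. -/
theorem isCompact_nlpMultipliers {E : Type*} [NormedAddCommGroup E] [NormedSpace ℝ E] {p q : ℕ}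
    {F : E → ℝ} {H : E → Vec p} {G : E → Vec q} {x : E} (hF : DifferentiableAt ℝ F x)
    (hH : DifferentiableAt ℝ H x) (hG : DifferentiableAt ℝ G x)
    (hcq : MFCQ (fun (j : Fin p) z => H z j) (fun (i : Fin q) z => G z i) x) :
    IsCompact (nlpMultipliers F H G x) := by
  obtain ⟨hli, d₀, hHd₀, hGd₀⟩ := (mfcq_iff hH hG).1 hcq
  -- `Φ` recovers the equality multipliers by testing stationarity with preimages of the unit
  -- vectors under the derivative of `H`.
  choose w hw using fun j => surjective_of_inner_eq_zero hli (EuclideanSpace.single j (1 : ℝ))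
  set Φ : Vec q → Vec p × Vec q := fun c =>
    (WithLp.toLp 2 fun j => -fderiv ℝ F x (w j) - inner ℝ c (fderiv ℝ G x (w j)), c) with hΦ
  have hΦc : Continuous Φ := by
    refine Continuous.prodMk ?_ continuous_id
    refine (PiLp.continuous_toLp 2 _).comp (continuous_pi fun j => ?_)
    fun_prop
  -- Only active indices are bounded by the box; the others vanish.
  set N : Set (Vec q) := WithLp.toLp 2 '' (Set.univ.pi fun i : Fin q =>
    if G x i = 0 then Icc (0 : ℝ) (-fderiv ℝ F x d₀ / fderiv ℝ G x d₀ i) else {0})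
  have hNc : IsCompact N := by
    refine (isCompact_univ_pi fun i => ?_).image (PiLp.continuous_toLp 2 _)
    split_ifs
    exacts [isCompact_Icc, isCompact_singleton]
  refine (hNc.image hΦc).of_isClosed_subset (isClosed_nlpMultipliers hF hH hG) ?_
  rintro l ⟨h1, h2, h3, h4, h5⟩
  have hstat : ∀ v, fderiv ℝ F x v + inner ℝ l.1 (fderiv ℝ H x v)
      + inner ℝ l.2 (fderiv ℝ G x v) = 0 := fun v => by
    rw [← fderiv_nlpLagrangian_apply hF hH hG, h1, zero_apply]
  have hcomp := mul_eq_zero_of_inner_eq_zero h3 h4 h5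
  have hl0 : ∀ i, G x i ≠ 0 → l.2 i = 0 := fun i hi => (mul_eq_zero.1 (hcomp i)).resolve_right hi
  refine ⟨l.2, ⟨fun i => l.2 i, fun i _ => ?_, rfl⟩, ?_⟩
  · dsimp only
    split_ifs with hi
    · refine ⟨h3 i, ?_⟩
      have e := hstat d₀
      rw [hHd₀, inner_zero_right, add_zero, EuclideanSpace.inner_eq_sum] at e
      have hle : ∑ j, l.2 j * fderiv ℝ G x d₀ j ≤ l.2 i * fderiv ℝ G x d₀ i := by
        rw [← Finset.add_sum_erase _ _ (Finset.mem_univ i)]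
        have : ∑ j ∈ Finset.univ.erase i, l.2 j * fderiv ℝ G x d₀ j ≤ 0 := by
          refine Finset.sum_nonpos fun j _ => ?_
          by_cases hj : G x j = 0
          · exact mul_nonpos_of_nonneg_of_nonpos (h3 j) (hGd₀ j hj).le
          · rw [hl0 j hj, zero_mul]
        linarith
      rw [le_div_iff_of_neg (hGd₀ i hi)]
      linarith
    · exact hl0 i hi
  · refine Prod.ext ?_ rfl
    ext j
    have e := hstat (w j)
    rw [hw, EuclideanSpace.inner_single_right] at e
    simp only [hΦ, one_mul, conj_trivial] at e ⊢
    linarith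

/-- Second-order necessary conditions under MFCQ. The critical directions are given by inequalities;
the existence of a multiplier makes the objective stationary along them. -/
theorem nlp_second_order_necessary {E : Type*} [NormedAddCommGroup E] [NormedSpace ℝ E]
    [CompleteSpace E] {p q : ℕ} {F : E → ℝ} {H : E → Vec p} {G : E → Vec q} {x : E}
    (hF : ContDiffAt ℝ 2 F x) (hH : ContDiffAt ℝ 2 H x) (hG : ContDiffAt ℝ 2 G x)
    (hHx : H x = 0) (hGx : ∀ i, G x i ≤ 0)
    (hmin : IsLocalMinOn F {z | H z = 0 ∧ ∀ i, G z i ≤ 0} x)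
    (hcq : MFCQ (fun (j : Fin p) z => H z j) (fun (i : Fin q) z => G z i) x) :
    (nlpMultipliers F H G x).Nonempty ∧ IsCompact (nlpMultipliers F H G x) ∧
      Convex ℝ (nlpMultipliers F H G x) ∧
      ∀ d, fderiv ℝ H x d = 0 → (∀ i, G x i = 0 → fderiv ℝ G x d i ≤ 0) → fderiv ℝ F x d ≤ 0 →
        ∃ v, IsGreatest ((fun l => hessQuad (nlpLagrangian F H G l) x d) ''
          nlpMultipliers F H G x) v ∧ 0 ≤ v := by
  have dF := hF.differentiableAt (by simp)
  have dH := hH.differentiableAt (by simp)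
  have dG := hG.differentiableAt (by simp)
  have hcpt := isCompact_nlpMultipliers dF dH dG hcq
  have hne : (nlpMultipliers F H G x).Nonempty := by
    obtain ⟨l, hl, -⟩ := exists_multiplier_hessQuad_nonneg hF hH hG hHx hGx hmin hcq (d := 0)
      (map_zero _) (fun i _ => by simp) (map_zero _)
    exact ⟨l, hl⟩
  refine ⟨hne, hcpt, convex_nlpMultipliers dF dH dG, fun d hHd hGd hFd => ?_⟩
  have hFd0 : fderiv ℝ F x d = 0 := by
    refine le_antisymm hFd ?_
    obtain ⟨l, h1, h2, h3, h4, h5⟩ := hne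
    have e := fderiv_nlpLagrangian_apply dF dH dG l d
    rw [h1, zero_apply, hHd, inner_zero_right, add_zero, EuclideanSpace.inner_eq_sum] at e
    have : ∑ i, l.2 i * fderiv ℝ G x d i ≤ 0 := by
      refine Finset.sum_nonpos fun i _ => ?_
      by_cases hi : G x i = 0
      · exact mul_nonpos_of_nonneg_of_nonpos (h3 i) (hGd i hi)
      · rw [(mul_eq_zero.1 (mul_eq_zero_of_inner_eq_zero h3 h4 h5 i)).resolve_right hi, zero_mul]
    linarith
  have hcont : Continuous fun l => hessQuad (nlpLagrangian F H G l) x d := by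
    simp only [hessQuad_nlpLagrangian hF hH hG]
    fun_prop
  obtain ⟨v, hv⟩ := (hcpt.image hcont).exists_isGreatest (hne.image _)
  obtain ⟨l, hl, hl0⟩ := exists_multiplier_hessQuad_nonneg hF hH hG hHx hGx hmin hcq hHd hGd hFd0
  exact ⟨v, hv, hl0.trans (hv.2 ⟨l, hl, rfl⟩)⟩

/-! ### Partial derivatives and the gradient of the lower level Lagrangian -/

theorem partialX_apply {n m : ℕ} {V : Type*} [NormedAddCommGroup V] [NormedSpace ℝ V]
    {θ : Vec n × Vec m → V} {x : Vec n} {y : Vec m} (h : DifferentiableAt ℝ θ (x, y))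
    (d : Vec n) : partialX θ x y d = fderiv ℝ θ (x, y) (d, 0) := by
  have := (HasFDerivAt.comp (g := θ) (f := fun x' => (x', y)) x h.hasFDerivAt
    (hasFDerivAt_prodMk_left x y)).fderiv
  exact DFunLike.congr_fun this d

theorem hasFDerivAt_partialY {n m : ℕ} {V : Type*} [NormedAddCommGroup V] [NormedSpace ℝ V]
    {θ : Vec n × Vec m → V} {x : Vec n} {y : Vec m} (h : DifferentiableAt ℝ θ (x, y)) :
    HasFDerivAt (fun y' => θ (x, y')) (partialY θ x y) y :=
  (h.hasFDerivAt.comp y (hasFDerivAt_prodMk_right x y)).differentiableAt.hasFDerivAt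

theorem partialY_apply {n m : ℕ} {V : Type*} [NormedAddCommGroup V] [NormedSpace ℝ V]
    {θ : Vec n × Vec m → V} {x : Vec n} {y : Vec m} (h : DifferentiableAt ℝ θ (x, y))
    (d : Vec m) : partialY θ x y d = fderiv ℝ θ (x, y) (0, d) := by
  have := (h.hasFDerivAt.comp y (hasFDerivAt_prodMk_right x y)).fderiv
  exact DFunLike.congr_fun this d

theorem partialX_add_partialY {n m : ℕ} {V : Type*} [NormedAddCommGroup V] [NormedSpace ℝ V]
    {θ : Vec n × Vec m → V} {x : Vec n} {y : Vec m} (h : DifferentiableAt ℝ θ (x, y))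
    (dx : Vec n) (dy : Vec m) :
    partialX θ x y dx + partialY θ x y dy = fderiv ℝ θ (x, y) (dx, dy) := by
  rw [partialX_apply h, partialY_apply h, ← map_add]
  simp

theorem inner_gradient_coord {m k : ℕ} {θ : Vec m → Vec k} {y : Vec m}
    (h : DifferentiableAt ℝ θ y) (j : Fin k) (v : Vec m) :
    inner ℝ (gradient (fun y' => θ y' j) y) v = fderiv ℝ θ y v j := by
  rw [inner_gradient_left, fderiv_euclidean_apply h]
  rfl

theorem ContDiffAt.partialY {n m : ℕ} {V : Type*} [NormedAddCommGroup V] [NormedSpace ℝ V]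
    {θ : Vec n × Vec m → V} {z : Vec n × Vec m} (h : ContDiffAt ℝ 2 θ z) :
    ContDiffAt ℝ 1 (fun z : Vec n × Vec m => partialY θ z.1 z.2) z := by
  have hev : (fun z : Vec n × Vec m => _root_.partialY θ z.1 z.2) =ᶠ[𝓝 z]
      fun z => (fderiv ℝ θ z).comp (ContinuousLinearMap.inr ℝ (Vec n) (Vec m)) := by
    filter_upwards [h.eventually (by simp)] with w hw
    ext1 d
    exact partialY_apply (hw.differentiableAt (by simp)) d
  exact ((h.fderiv_right (m := 1) (by norm_num)).clm_comp contDiffAt_const).congr_of_eventuallyEq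
    hev

namespace BilevelProgram

variable {n m p q r s : ℕ} (D : BilevelProgram n m p q r s)

/-- The gradient `∇_y ℒ` as a function of `u = (x, y, μ, ξ)`. -/
def lowerGradient (u : Vec n × Vec m × Vec r × Vec s) : Vec m :=
  D.gradLowerLagrangian u.1 u.2.1 u.2.2.1 u.2.2.2

/-- The lower level data and `∇_y ℒ` are twice continuously differentiable around
`u = (x, y, μ, ξ)`. -/
structure SmoothAt (u : Vec n × Vec m × Vec r × Vec s) : Prop where
  f : ContDiffAt ℝ 2 D.f (u.1, u.2.1)
  h : ContDiffAt ℝ 2 D.h (u.1, u.2.1)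
  g : ContDiffAt ℝ 2 D.g (u.1, u.2.1)
  lowerGradient : ContDiffAt ℝ 2 D.lowerGradient u

variable {D}

theorem hasFDerivAt_lowerLagrangian {x : Vec n} {y : Vec m}
    (hf : DifferentiableAt ℝ D.f (x, y)) (hh : DifferentiableAt ℝ D.h (x, y))
    (hg : DifferentiableAt ℝ D.g (x, y)) (μ : Vec r) (ξ : Vec s) :
    HasFDerivAt (fun y' => D.lowerLagrangian x y' μ ξ)
      (partialY D.f x y + (innerSL ℝ μ).comp (partialY D.h x y)
        + (innerSL ℝ ξ).comp (partialY D.g x y)) y :=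
  ((hasFDerivAt_partialY hf).add
    ((innerSL ℝ μ).hasFDerivAt.comp y (hasFDerivAt_partialY hh))).add
    ((innerSL ℝ ξ).hasFDerivAt.comp y (hasFDerivAt_partialY hg))

theorem inner_gradLowerLagrangian {x : Vec n} {y : Vec m}
    (hf : DifferentiableAt ℝ D.f (x, y)) (hh : DifferentiableAt ℝ D.h (x, y))
    (hg : DifferentiableAt ℝ D.g (x, y)) (μ : Vec r) (ξ : Vec s) (v : Vec m) :
    inner ℝ (D.gradLowerLagrangian x y μ ξ) v
      = partialY D.f x y v + inner ℝ μ (partialY D.h x y v) + inner ℝ ξ (partialY D.g x y v) := by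
  unfold gradLowerLagrangian
  rw [inner_gradient_left, (hasFDerivAt_lowerLagrangian hf hh hg μ ξ).fderiv]
  simp

/-- Coordinates of `∇_y ℒ` are combinations of the partial derivatives of the data, whose
coefficients are coordinates of the multipliers. -/
theorem SmoothAt.of_isC2WithC3InY {x : Vec n} {y : Vec m} (hf : IsC2WithC3InY D.f x y)
    (hh : IsC2WithC3InY D.h x y) (hg : IsC2WithC3InY D.g x y) (μ : Vec r) (ξ : Vec s) :
    D.SmoothAt (x, y, μ, ξ) := by
  refine ⟨hf.1, hh.1, hg.1, ?_⟩
  have hproj : ContDiffAt ℝ 2 (fun u : Vec n × Vec m × Vec r × Vec s => (u.1, u.2.1))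
    (x, y, μ, ξ) := by fun_prop
  have hproj' := hproj.continuousAt.tendsto
  rw [contDiffAt_euclidean]
  intro j
  set e : Vec m := EuclideanSpace.single j 1
  have hev : (fun u => D.lowerGradient u j) =ᶠ[𝓝 (x, y, μ, ξ)] fun u =>
      partialY D.f u.1 u.2.1 e + inner ℝ u.2.2.1 (partialY D.h u.1 u.2.1 e)
        + inner ℝ u.2.2.2 (partialY D.g u.1 u.2.1 e) := by
    filter_upwards [hproj'.eventually (hf.1.eventually (by simp)),
      hproj'.eventually (hh.1.eventually (by simp)),
      hproj'.eventually (hg.1.eventually (by simp))] with u h1 h2 h3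
    rw [← inner_gradLowerLagrangian (h1.differentiableAt (by simp))
      (h2.differentiableAt (by simp)) (h3.differentiableAt (by simp)),
      EuclideanSpace.inner_single_right]
    simp only [one_mul, conj_trivial]
    rfl
  refine ContDiffAt.congr_of_eventuallyEq ?_ hev
  have c1 : ContDiffAt ℝ 2 (fun u : Vec n × Vec m × Vec r × Vec s =>
      partialY D.f u.1 u.2.1) (x, y, μ, ξ) := ContDiffAt.comp
    (g := fun z : Vec n × Vec m => partialY D.f z.1 z.2) (x, y, μ, ξ) hf.2 hproj
  have c2 : ContDiffAt ℝ 2 (fun u : Vec n × Vec m × Vec r × Vec s =>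
      partialY D.h u.1 u.2.1) (x, y, μ, ξ) := ContDiffAt.comp
    (g := fun z : Vec n × Vec m => partialY D.h z.1 z.2) (x, y, μ, ξ) hh.2 hproj
  have c3 : ContDiffAt ℝ 2 (fun u : Vec n × Vec m × Vec r × Vec s =>
      partialY D.g u.1 u.2.1) (x, y, μ, ξ) := ContDiffAt.comp
    (g := fun z : Vec n × Vec m => partialY D.g z.1 z.2) (x, y, μ, ξ) hg.2 hproj
  have d1 : ContDiffAt ℝ 2 (fun u : Vec n × Vec m × Vec r × Vec s => u.2.2.1) (x, y, μ, ξ) := by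
    fun_prop
  have d2 : ContDiffAt ℝ 2 (fun u : Vec n × Vec m × Vec r × Vec s => u.2.2.2) (x, y, μ, ξ) := by
    fun_prop
  exact ((c1.clm_apply contDiffAt_const).add (d1.inner ℝ (c2.clm_apply contDiffAt_const))).add
    (d2.inner ℝ (c3.clm_apply contDiffAt_const))

theorem SmoothAt.eventually {u : Vec n × Vec m × Vec r × Vec s} (hu : D.SmoothAt u) :
    ∀ᶠ w in 𝓝 u, D.SmoothAt w := by
  have hproj : Tendsto (fun u : Vec n × Vec m × Vec r × Vec s => (u.1, u.2.1)) (𝓝 u)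
    (𝓝 (u.1, u.2.1)) := Continuous.tendsto (by fun_prop) u
  filter_upwards [hproj.eventually (hu.f.eventually (by simp)),
    hproj.eventually (hu.h.eventually (by simp)), hproj.eventually (hu.g.eventually (by simp)),
    hu.lowerGradient.eventually (by simp)] with w h1 h2 h3 h4
  exact ⟨h1, h2, h3, h4⟩

section

variable {u : Vec n × Vec m × Vec r × Vec s}

theorem SmoothAt.hasFDerivAt_f (hu : D.SmoothAt u) :
    HasFDerivAt D.f (fderiv ℝ D.f (u.1, u.2.1)) (u.1, u.2.1) :=
  (hu.f.differentiableAt (by simp)).hasFDerivAt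

theorem SmoothAt.hasFDerivAt_h (hu : D.SmoothAt u) :
    HasFDerivAt D.h (fderiv ℝ D.h (u.1, u.2.1)) (u.1, u.2.1) :=
  (hu.h.differentiableAt (by simp)).hasFDerivAt

theorem SmoothAt.hasFDerivAt_g (hu : D.SmoothAt u) :
    HasFDerivAt D.g (fderiv ℝ D.g (u.1, u.2.1)) (u.1, u.2.1) :=
  (hu.g.differentiableAt (by simp)).hasFDerivAt

theorem SmoothAt.hasFDerivAt_lowerGradient (hu : D.SmoothAt u) :
    HasFDerivAt D.lowerGradient (fderiv ℝ D.lowerGradient u) u :=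
  (hu.lowerGradient.differentiableAt (by simp)).hasFDerivAt

/-- `∇_y ℒ` is affine in the multipliers, with linear part `(𝒥_y h)ᵀ dμ + (𝒥_y g)ᵀ dξ`. -/
theorem SmoothAt.inner_fderiv_lowerGradient_multiplier (hu : D.SmoothAt u) (dμ : Vec r)
    (dξ : Vec s) (v : Vec m) :
    inner ℝ (fderiv ℝ D.lowerGradient u (0, 0, dμ, dξ)) v
      = inner ℝ dμ (partialY D.h u.1 u.2.1 v) + inner ℝ dξ (partialY D.g u.1 u.2.1 v) := by
  obtain ⟨x, y, μ, ξ⟩ := u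
  have h1 : HasFDerivAt (fun w : Vec r × Vec s => inner ℝ v (D.lowerGradient (x, y, w))) _ (μ, ξ) :=
    (innerSL ℝ v).hasFDerivAt.comp (μ, ξ) (HasFDerivAt.comp (g := D.lowerGradient)
      (f := fun w : Vec r × Vec s => (x, y, w)) (μ, ξ) hu.hasFDerivAt_lowerGradient
      (HasFDerivAt.comp (g := Prod.mk x) (f := Prod.mk y) (μ, ξ)
        (hasFDerivAt_prodMk_right x (y, μ, ξ)) (hasFDerivAt_prodMk_right y (μ, ξ))))
  have h2 : HasFDerivAt (fun w : Vec r × Vec s => partialY D.f x y v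
      + inner ℝ (partialY D.h x y v) w.1 + inner ℝ (partialY D.g x y v) w.2)
      ((innerSL ℝ (partialY D.h x y v)).comp (ContinuousLinearMap.fst ℝ (Vec r) (Vec s))
        + (innerSL ℝ (partialY D.g x y v)).comp (ContinuousLinearMap.snd ℝ (Vec r) (Vec s)))
      (μ, ξ) :=
    (((innerSL ℝ (partialY D.h x y v)).hasFDerivAt.comp (μ, ξ) hasFDerivAt_fst).const_add _).add
      ((innerSL ℝ (partialY D.g x y v)).hasFDerivAt.comp (μ, ξ) hasFDerivAt_snd)
  have heq : (fun w : Vec r × Vec s => inner ℝ v (D.lowerGradient (x, y, w)))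
      = fun w : Vec r × Vec s => partialY D.f x y v
      + inner ℝ (partialY D.h x y v) w.1 + inner ℝ (partialY D.g x y v) w.2 := by
    funext w
    rw [real_inner_comm]
    refine (inner_gradLowerLagrangian hu.hasFDerivAt_f.differentiableAt
      hu.hasFDerivAt_h.differentiableAt hu.hasFDerivAt_g.differentiableAt w.1 w.2 v).trans ?_
    rw [real_inner_comm w.1, real_inner_comm w.2]
  rw [heq] at h1
  have := DFunLike.congr_fun (h1.unique h2) (dμ, dξ)
  rw [real_inner_comm, real_inner_comm _ dμ, real_inner_comm _ dξ]
  simpa using this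

/-- The Hessian of the lower level Lagrangian is the partial derivative of `∇_y ℒ`. -/
theorem SmoothAt.hessQuad_lowerLagrangian (hu : D.SmoothAt u) (d : Vec m) :
    hessQuad (fun y' => D.lowerLagrangian u.1 y' u.2.2.1 u.2.2.2) u.2.1 d
      = inner ℝ (fderiv ℝ D.lowerGradient u (0, d, 0, 0)) d := by
  obtain ⟨x, y, μ, ξ⟩ := u
  have h1 : HasFDerivAt (fun y' => D.lowerGradient (x, y', μ, ξ)) _ y :=
    HasFDerivAt.comp (g := D.lowerGradient) (f := fun y' => (x, y', μ, ξ)) y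
      hu.hasFDerivAt_lowerGradient
      (HasFDerivAt.comp (g := Prod.mk x) (f := fun y' => (y', μ, ξ)) y
        (hasFDerivAt_prodMk_right x (y, μ, ξ)) (hasFDerivAt_prodMk_left y (μ, ξ)))
  have h2 : fderiv ℝ (fun y' => D.lowerLagrangian x y' μ ξ)
      = fun y' => innerSL ℝ (D.lowerGradient (x, y', μ, ξ)) := by
    funext y'
    ext v
    exact (inner_gradient_left (f := fun y' => D.lowerLagrangian x y' μ ξ)).symm
  unfold hessQuad
  have h3 : HasFDerivAt (fun y' => innerSL ℝ (D.lowerGradient (x, y', μ, ξ))) _ y :=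
    (innerSL ℝ : Vec m →L[ℝ] Vec m →L[ℝ] ℝ).hasFDerivAt.comp y h1
  dsimp only at h2 ⊢
  rw [h2, h3.fderiv]
  rfl

end

end BilevelProgram

/-! ### The residual of the lower level KKT system -/

open Classical in
/-- The coordinate projection of `ℝˢ` onto the coordinates in `I`. -/
def coordMask {s : ℕ} (I : Set (Fin s)) : Vec s →L[ℝ] Vec s :=
  LinearMap.toContinuousLinearMap
    { toFun := fun v => WithLp.toLp 2 fun i => if i ∈ I then v i else 0
      map_add' := fun v w => by
        ext i
        by_cases hi : i ∈ I <;> simp [hi]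
      map_smul' := fun c v => by
        ext i
        by_cases hi : i ∈ I <;> simp [hi] }

theorem coordMask_apply_mem {s : ℕ} {I : Set (Fin s)} {i : Fin s} (hi : i ∈ I) (v : Vec s) :
    coordMask I v i = v i := by
  simp [coordMask, hi]

theorem coordMask_apply_notMem {s : ℕ} {I : Set (Fin s)} {i : Fin s} (hi : i ∉ I) (v : Vec s) :
    coordMask I v i = 0 := by
  simp [coordMask, hi]

theorem coordMask_eq_zero {s : ℕ} {I : Set (Fin s)} {v : Vec s} :
    coordMask I v = 0 ↔ ∀ i ∈ I, v i = 0 := by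
  constructor
  · intro h i hi
    rw [← coordMask_apply_mem hi v, h]; rfl
  · intro h
    ext i
    by_cases hi : i ∈ I
    · rw [coordMask_apply_mem hi, h i hi]; rfl
    · rw [coordMask_apply_notMem hi]; rfl

theorem coordMask_sub_eq_zero {s : ℕ} {I : Set (Fin s)} {v w : Vec s} :
    coordMask I v - (w - coordMask I w) = 0 ↔ (∀ i ∈ I, v i = 0) ∧ ∀ i, i ∉ I → w i = 0 := by
  constructor
  · intro h
    have h' : ∀ i, coordMask I v i - (w i - coordMask I w i) = 0 := fun i =>
      congrArg (fun z : Vec s => z i) h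
    refine ⟨fun i hi => ?_, fun i hi => ?_⟩
    · have := h' i
      rw [coordMask_apply_mem hi, coordMask_apply_mem hi] at this
      linarith
    · have := h' i
      rw [coordMask_apply_notMem hi, coordMask_apply_notMem hi] at this
      linarith
  · rintro ⟨h1, h2⟩
    ext i
    change coordMask I v i - (w i - coordMask I w i) = 0
    by_cases hi : i ∈ I
    · rw [coordMask_apply_mem hi, coordMask_apply_mem hi, h1 i hi]; ring
    · rw [coordMask_apply_notMem hi, coordMask_apply_notMem hi, h2 i hi]; ring

theorem inner_coordMask {s : ℕ} {I : Set (Fin s)} {v w : Vec s} (h : ∀ i, i ∉ I → w i = 0) :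
    inner ℝ w (coordMask I v) = inner ℝ w v := by
  rw [EuclideanSpace.inner_eq_sum, EuclideanSpace.inner_eq_sum]
  refine Finset.sum_congr rfl fun i _ => ?_
  by_cases hi : i ∈ I
  · rw [coordMask_apply_mem hi]
  · rw [h i hi]; ring

/-- At a point with no zero coordinate, the projection onto the nonpositive orthant is locally the
linear projection onto the negative coordinates. -/
theorem projNeg_eventuallyEq {s : ℕ} {I : Set (Fin s)} {v : Vec s} (hI : ∀ i ∈ I, 0 < v i)
    (hI' : ∀ i, i ∉ I → v i < 0) :
    projNeg =ᶠ[𝓝 v] fun w => w - coordMask I w := by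
  have hc : ∀ i, ContinuousAt (fun w : Vec s => w i) v := fun i =>
    Continuous.continuousAt (by fun_prop)
  have : ∀ i, ∀ᶠ w : Vec s in 𝓝 v, min (w i) 0 = w i - coordMask I w i := by
    intro i
    by_cases hi : i ∈ I
    · filter_upwards [(hc i).eventually_const_lt (hI i hi)] with w hw
      rw [coordMask_apply_mem hi, min_eq_right hw.le, sub_self]
    · filter_upwards [(hc i).eventually_lt_const (hI' i hi)] with w hw
      rw [coordMask_apply_notMem hi, min_eq_left hw.le, sub_zero]
  filter_upwards [eventually_all.2 this] with w hw
  ext i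
  exact hw i

namespace BilevelProgram

variable {n m p q r s : ℕ} {D : BilevelProgram n m p q r s}

/-- The lower level KKT system with active set `I`: the components are `∇_y ℒ`, `h`, and the
vector with entries `g i` for `i ∈ I` and `-ξ i` for `i ∉ I`. -/
def lowerResidual (D : BilevelProgram n m p q r s) (I : Set (Fin s))
    (u : Vec n × Vec m × Vec r × Vec s) : Vec m × Vec r × Vec s :=
  (D.lowerGradient u, D.h (u.1, u.2.1),
    coordMask I (D.g (u.1, u.2.1)) - (u.2.2.2 - coordMask I u.2.2.2))

theorem lowerResidual_eq_zero {I : Set (Fin s)} {u : Vec n × Vec m × Vec r × Vec s} :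
    D.lowerResidual I u = 0 ↔ D.gradLowerLagrangian u.1 u.2.1 u.2.2.1 u.2.2.2 = 0 ∧
      D.h (u.1, u.2.1) = 0 ∧ (∀ i ∈ I, D.g (u.1, u.2.1) i = 0) ∧ ∀ i, i ∉ I → u.2.2.2 i = 0 := by
  simp only [lowerResidual, Prod.mk_eq_zero, coordMask_sub_eq_zero]
  rfl

theorem SmoothAt.contDiffAt_lowerResidual {u : Vec n × Vec m × Vec r × Vec s}
    (hu : D.SmoothAt u) (I : Set (Fin s)) : ContDiffAt ℝ 2 (D.lowerResidual I) u := by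
  have hproj : ContDiffAt ℝ 2 (fun u : Vec n × Vec m × Vec r × Vec s => (u.1, u.2.1)) u := by
    fun_prop
  have hξ : ContDiffAt ℝ 2 (fun u : Vec n × Vec m × Vec r × Vec s => u.2.2.2) u := by
    fun_prop
  exact hu.lowerGradient.prodMk ((hu.h.comp u hproj).prodMk
    (((coordMask I).contDiff.contDiffAt.comp u (hu.g.comp u hproj)).sub
      (hξ.sub ((coordMask I).contDiff.contDiffAt.comp u hξ))))

set_option synthInstance.maxHeartbeats 200000 in
theorem SmoothAt.fderiv_lowerResidual {u : Vec n × Vec m × Vec r × Vec s}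
    (hu : D.SmoothAt u) (I : Set (Fin s)) (d : Vec n × Vec m × Vec r × Vec s) :
    fderiv ℝ (D.lowerResidual I) u d
      = (fderiv ℝ D.lowerGradient u d, fderiv ℝ D.h (u.1, u.2.1) (d.1, d.2.1),
        coordMask I (fderiv ℝ D.g (u.1, u.2.1) (d.1, d.2.1))
          - (d.2.2.2 - coordMask I d.2.2.2)) := by
  let π : (Vec n × Vec m × Vec r × Vec s) →L[ℝ] Vec n × Vec m :=
    (ContinuousLinearMap.fst ℝ _ _).prod
      ((ContinuousLinearMap.fst ℝ _ _).comp (ContinuousLinearMap.snd ℝ _ _))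
  let σ : (Vec n × Vec m × Vec r × Vec s) →L[ℝ] Vec s :=
    (ContinuousLinearMap.snd ℝ _ _).comp
      ((ContinuousLinearMap.snd ℝ _ _).comp (ContinuousLinearMap.snd ℝ _ _))
  have h1 := hu.hasFDerivAt_h.comp u (π.hasFDerivAt (x := u))
  have h2 := (coordMask I).hasFDerivAt.comp u (hu.hasFDerivAt_g.comp u (π.hasFDerivAt (x := u)))
  have h3 := (σ.hasFDerivAt (x := u)).sub
    ((coordMask I).hasFDerivAt.comp u (σ.hasFDerivAt (x := u)))
  have h4 : HasFDerivAt (D.lowerResidual I) _ u :=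
    hu.hasFDerivAt_lowerGradient.prodMk (h1.prodMk (h2.sub h3))
  rw [h4.fderiv]
  rfl

end BilevelProgram

/-! ### Strict KKT points and the derivative of the residual -/

namespace BilevelProgram

variable {n m p q r s : ℕ} {D : BilevelProgram n m p q r s}

/-- The KKT conditions of the lower level problem at `u = (x, y, μ, ξ)` with active set `I` and
strict complementarity. -/
structure IsStrictKKT (D : BilevelProgram n m p q r s) (I : Set (Fin s))
    (u : Vec n × Vec m × Vec r × Vec s) : Prop where
  grad : D.gradLowerLagrangian u.1 u.2.1 u.2.2.1 u.2.2.2 = 0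
  h : D.h (u.1, u.2.1) = 0
  active : ∀ i ∈ I, D.g (u.1, u.2.1) i = 0 ∧ 0 < u.2.2.2 i
  inactive : ∀ i, i ∉ I → D.g (u.1, u.2.1) i < 0 ∧ u.2.2.2 i = 0

theorem JacobianUniqueness.isStrictKKT {x : Vec n} {y : Vec m} {μ : Vec r} {ξ : Vec s}
    (hJ : D.JacobianUniqueness x y μ ξ) :
    D.IsStrictKKT {i | D.g (x, y) i = 0} (x, y, μ, ξ) := by
  obtain ⟨h1, h2, h3, h4, h5⟩ := hJ.kkt
  have hc := mul_eq_zero_of_inner_eq_zero h3 h4 h5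
  refine ⟨h1, h2, fun i hi => ⟨hi, ?_⟩, fun i hi => ⟨(h4 i).lt_of_ne hi, ?_⟩⟩
  · have := hJ.strict i
    rw [show D.g (x, y) i = 0 from hi] at this
    simpa using this
  · exact (mul_eq_zero.1 (hc i)).resolve_right hi

/-- The KKT conditions make the complementarity residual vanish. -/
theorem IsLowerKKT.compResidual_eq_zero {x : Vec n} {y : Vec m} {μ : Vec r} {ξ : Vec s}
    (h : D.IsLowerKKT x y μ ξ) : D.compResidual x y ξ = 0 := by
  obtain ⟨-, -, h3, h4, h5⟩ := h
  have hc := mul_eq_zero_of_inner_eq_zero h3 h4 h5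
  ext i
  change D.g (x, y) i - min (D.g (x, y) i + ξ i) 0 = 0
  rcases mul_eq_zero.1 (hc i) with h0 | h0
  · rw [h0, add_zero, min_eq_left (h4 i), sub_self]
  · rw [h0, zero_add, min_eq_right (h3 i), sub_self]

namespace IsStrictKKT

variable {I : Set (Fin s)} {u : Vec n × Vec m × Vec r × Vec s}

theorem isLowerKKT (h : D.IsStrictKKT I u) : D.IsLowerKKT u.1 u.2.1 u.2.2.1 u.2.2.2 := by
  refine ⟨h.grad, h.h, fun i => ?_, fun i => ?_, ?_⟩
  · by_cases hi : i ∈ I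
    · exact (h.active i hi).2.le
    · exact (h.inactive i hi).2.ge
  · by_cases hi : i ∈ I
    · exact (h.active i hi).1.le
    · exact (h.inactive i hi).1.le
  · rw [EuclideanSpace.inner_eq_sum]
    refine Finset.sum_eq_zero fun i _ => ?_
    by_cases hi : i ∈ I
    · rw [(h.active i hi).1, mul_zero]
    · rw [(h.inactive i hi).2, zero_mul]

theorem strict (h : D.IsStrictKKT I u) (i : Fin s) : 0 < u.2.2.2 i - D.g (u.1, u.2.1) i := by
  by_cases hi : i ∈ I
  · linarith [h.active i hi]
  · linarith [h.inactive i hi]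

theorem mem_iff (h : D.IsStrictKKT I u) (i : Fin s) : D.g (u.1, u.2.1) i = 0 ↔ i ∈ I := by
  constructor
  · intro h0
    by_contra hi
    exact (h.inactive i hi).1.ne h0
  · exact fun hi => (h.active i hi).1

theorem lowerResidual_eq_zero (h : D.IsStrictKKT I u) : D.lowerResidual I u = 0 :=
  BilevelProgram.lowerResidual_eq_zero.2
    ⟨h.grad, h.h, fun i hi => (h.active i hi).1, fun i hi => (h.inactive i hi).2⟩

/-- The projection onto the nonpositive orthant is linear near `g + ξ`. -/
theorem projNeg_eventuallyEq (h : D.IsStrictKKT I u) :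
    projNeg =ᶠ[𝓝 (D.g (u.1, u.2.1) + u.2.2.2)] fun w => w - coordMask I w := by
  refine _root_.projNeg_eventuallyEq (fun i hi => ?_) fun i hi => ?_
  · have := h.active i hi
    change 0 < D.g (u.1, u.2.1) i + u.2.2.2 i
    linarith
  · have := h.inactive i hi
    change D.g (u.1, u.2.1) i + u.2.2.2 i < 0
    linarith

theorem projJacobian_apply (h : D.IsStrictKKT I u) (v : Vec s) :
    D.projJacobian u.1 u.2.1 u.2.2.2 v = v - coordMask I v := by
  unfold projJacobian
  have hd : HasFDerivAt (fun w => w - coordMask I w)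
      (ContinuousLinearMap.id ℝ (Vec s) - coordMask I) (D.g (u.1, u.2.1) + u.2.2.2) :=
    (hasFDerivAt_id _).sub (coordMask I).hasFDerivAt
  rw [h.projNeg_eventuallyEq.fderiv_eq, hd.fderiv]
  rfl

theorem compResidual_eventuallyEq (h : D.IsStrictKKT I u) (hu : D.SmoothAt u) :
    ∀ᶠ w in 𝓝 u, D.compResidual w.1 w.2.1 w.2.2.2 = (D.lowerResidual I w).2.2 := by
  have hc : ContinuousAt (fun w : Vec n × Vec m × Vec r × Vec s =>
      D.g (w.1, w.2.1) + w.2.2.2) u := by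
    refine ContinuousAt.add ?_ (by fun_prop)
    exact ContinuousAt.comp (f := fun w : Vec n × Vec m × Vec r × Vec s => (w.1, w.2.1))
      hu.g.continuousAt (by fun_prop)
  filter_upwards [hc.tendsto.eventually h.projNeg_eventuallyEq] with w hw
  unfold compResidual
  rw [hw, map_add]
  simp only [lowerResidual]
  abel

/-- Near a strict KKT point, the zeros of the residual are strict KKT points. -/
theorem eventually_of_lowerResidual_eq_zero (h : D.IsStrictKKT I u) (hu : D.SmoothAt u) :
    ∀ᶠ w in 𝓝 u, D.lowerResidual I w = 0 → D.IsStrictKKT I w := by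
  have hg : ∀ i, ContinuousAt (fun w : Vec n × Vec m × Vec r × Vec s =>
      D.g (w.1, w.2.1) i) u := fun i =>
    ContinuousAt.comp (f := fun w : Vec n × Vec m × Vec r × Vec s => (w.1, w.2.1))
      (hu.g.euclidean_apply i).continuousAt (by fun_prop)
  have h1 : ∀ᶠ w : Vec n × Vec m × Vec r × Vec s in 𝓝 u, ∀ i, i ∈ I → 0 < w.2.2.2 i := by
    refine eventually_all.2 fun i => ?_
    by_cases hi : i ∈ I
    · have : ContinuousAt (fun w : Vec n × Vec m × Vec r × Vec s => w.2.2.2 i) u := by fun_prop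
      filter_upwards [this.eventually_const_lt (h.active i hi).2] with w hw _ using hw
    · exact Eventually.of_forall fun w hi' => absurd hi' hi
  have h2 : ∀ᶠ w : Vec n × Vec m × Vec r × Vec s in 𝓝 u, ∀ i, i ∉ I →
      D.g (w.1, w.2.1) i < 0 := by
    refine eventually_all.2 fun i => ?_
    by_cases hi : i ∈ I
    · exact Eventually.of_forall fun w hi' => absurd hi hi'
    · filter_upwards [(hg i).eventually_lt_const (h.inactive i hi).1] with w hw _ using hw
  filter_upwards [h1, h2] with w hw1 hw2 h0
  obtain ⟨k1, k2, k3, k4⟩ := BilevelProgram.lowerResidual_eq_zero.1 h0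
  exact ⟨k1, k2, fun i hi => ⟨k3 i hi, hw1 i hi⟩, fun i hi => ⟨hw2 i hi, k4 i hi⟩⟩

/-- At a strict KKT point the critical cone is the tangent space of the active constraints. -/
theorem mem_lowerCriticalCone_iff (h : D.IsStrictKKT I u) (hu : D.SmoothAt u) (d : Vec m) :
    d ∈ D.lowerCriticalCone u.1 u.2.1 ↔
      partialY D.h u.1 u.2.1 d = 0 ∧ ∀ i ∈ I, partialY D.g u.1 u.2.1 d i = 0 := by
  have hfd : inner ℝ (gradient (fun y' => D.f (u.1, y')) u.2.1) d = partialY D.f u.1 u.2.1 d :=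
    inner_gradient_left
  have hgd : ∀ i, inner ℝ (gradient (fun y' => D.g (u.1, y') i) u.2.1) d
      = partialY D.g u.1 u.2.1 d i := fun i =>
    inner_gradient_coord (hasFDerivAt_partialY hu.hasFDerivAt_g.differentiableAt).differentiableAt
      i d
  have hgrad := inner_gradLowerLagrangian hu.hasFDerivAt_f.differentiableAt
    hu.hasFDerivAt_h.differentiableAt hu.hasFDerivAt_g.differentiableAt u.2.2.1 u.2.2.2 d
  rw [h.grad, inner_zero_left, EuclideanSpace.inner_eq_sum u.2.2.2] at hgrad
  simp only [lowerCriticalCone, mem_ofPred_eq, hfd, hgd, h.mem_iff]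
  refine and_congr_right fun hh => ?_
  rw [hh, inner_zero_right, add_zero] at hgrad
  constructor
  · rintro ⟨h1, h2⟩ i hi
    have hterm : ∀ i ∈ Finset.univ, u.2.2.2 i * partialY D.g u.1 u.2.1 d i ≤ 0 := by
      intro i _
      by_cases hi : i ∈ I
      · exact mul_nonpos_of_nonneg_of_nonpos (h.active i hi).2.le (h1 i hi)
      · rw [(h.inactive i hi).2, zero_mul]
    have hle := Finset.sum_nonpos hterm
    have := (Finset.sum_eq_zero_iff_of_nonpos hterm).1 (by linarith) i (Finset.mem_univ i)
    exact (mul_eq_zero.1 this).resolve_left (h.active i hi).2.ne'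
  · intro h1
    refine ⟨fun i hi => (h1 i hi).le, ?_⟩
    have : ∑ i, u.2.2.2 i * partialY D.g u.1 u.2.1 d i = 0 := by
      refine Finset.sum_eq_zero fun i _ => ?_
      by_cases hi : i ∈ I
      · rw [h1 i hi, mul_zero]
      · rw [(h.inactive i hi).2, zero_mul]
    linarith

end IsStrictKKT

/-- LICQ says that a combination of the constraint gradients, with multipliers vanishing on the
inactive constraints, is zero only if all multipliers are. -/
theorem lowerLICQ_iff {x : Vec n} {y : Vec m} (hh : DifferentiableAt ℝ D.h (x, y))
    (hg : DifferentiableAt ℝ D.g (x, y)) :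
    D.LowerLICQ x y ↔ ∀ (μ : Vec r) (ξ : Vec s), (∀ i, D.g (x, y) i ≠ 0 → ξ i = 0) →
      (∀ v, inner ℝ μ (partialY D.h x y v) + inner ℝ ξ (partialY D.g x y v) = 0) →
      μ = 0 ∧ ξ = 0 := by
  classical
  have hh' := hasFDerivAt_partialY hh
  have hg' := hasFDerivAt_partialY hg
  have key : ∀ (μ : Vec r) (ξ : Vec s), (∀ i, D.g (x, y) i ≠ 0 → ξ i = 0) →
      ((∑ j, μ j • gradient (fun y' => D.h (x, y') j) y
        + ∑ i : {i : Fin s // D.g (x, y) i = 0}, ξ i.1 • gradient (fun y' => D.g (x, y') i.1) y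
        = 0) ↔
      ∀ v, inner ℝ μ (partialY D.h x y v) + inner ℝ ξ (partialY D.g x y v) = 0) := by
    intro μ ξ hξ
    rw [ext_iff_inner_right ℝ]
    refine forall_congr' fun v => ?_
    rw [inner_zero_left, inner_add_left, sum_inner, sum_inner,
      EuclideanSpace.inner_eq_sum, EuclideanSpace.inner_eq_sum,
      ← Fintype.sum_subtype_add_sum_subtype (fun i => D.g (x, y) i = 0)
        (fun i => ξ i * (partialY D.g x y v) i)]
    have h0 : ∑ i : {i // ¬ D.g (x, y) i = 0}, ξ i.1 * (partialY D.g x y v) i.1 = 0 :=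
      Finset.sum_eq_zero fun i _ => by rw [hξ i.1 i.2, zero_mul]
    rw [h0, add_zero]
    simp only [inner_smul_left, conj_trivial, inner_gradient_coord hh'.differentiableAt,
      inner_gradient_coord hg'.differentiableAt]
    rfl
  unfold LowerLICQ
  rw [Fintype.linearIndependent_iff]
  constructor
  · intro h μ ξ hξ hv
    have h0 := h (Sum.elim (fun j => μ j) fun i => ξ i.1) (by
      rw [Fintype.sum_sum_type]
      simpa using (key μ ξ hξ).2 hv)
    refine ⟨?_, ?_⟩
    · ext j
      exact h0 (.inl j)
    · ext i
      by_cases hi : D.g (x, y) i = 0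
      · exact h0 (.inr ⟨i, hi⟩)
      · exact hξ i hi
  · intro h c hc
    set μ : Vec r := WithLp.toLp 2 fun j => c (.inl j)
    set ξ : Vec s := WithLp.toLp 2 fun i => if hi : D.g (x, y) i = 0 then c (.inr ⟨i, hi⟩) else 0
      with hξdef
    have hξ : ∀ i, D.g (x, y) i ≠ 0 → ξ i = 0 := fun i hi => by simp [hξdef, hi]
    have hξ' : ∀ i : {i : Fin s // D.g (x, y) i = 0}, ξ i.1 = c (.inr i) := fun i => by
      simp [hξdef, i.2]
    rw [Fintype.sum_sum_type] at hc
    obtain ⟨h1, h2⟩ := h μ ξ hξ ((key μ ξ hξ).1 (by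
      simp only [hξ']
      simpa using hc))
    rintro (j | i)
    · exact congrArg (fun z : Vec r => z j) h1
    · rw [← hξ' i, h2]; rfl

/-- The partial derivative of the residual with respect to `(y, μ, ξ)`. -/
def residualPartial (D : BilevelProgram n m p q r s) (I : Set (Fin s))
    (u : Vec n × Vec m × Vec r × Vec s) :
    (Vec m × Vec r × Vec s) →L[ℝ] Vec m × Vec r × Vec s :=
  (fderiv ℝ (D.lowerResidual I) u).comp
    (ContinuousLinearMap.inr ℝ (Vec n) (Vec m × Vec r × Vec s))

theorem SmoothAt.residualPartial_apply {u : Vec n × Vec m × Vec r × Vec s} (hu : D.SmoothAt u)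
    (I : Set (Fin s)) (d : Vec m × Vec r × Vec s) :
    D.residualPartial I u d
      = (fderiv ℝ D.lowerGradient u (0, d.1, 0, 0) + fderiv ℝ D.lowerGradient u (0, 0, d.2),
        partialY D.h u.1 u.2.1 d.1,
        coordMask I (partialY D.g u.1 u.2.1 d.1) - (d.2.2 - coordMask I d.2.2)) := by
  rw [partialY_apply hu.hasFDerivAt_h.differentiableAt,
    partialY_apply hu.hasFDerivAt_g.differentiableAt, ← map_add]
  have e : ((0 : Vec n), d.1, (0 : Vec r), (0 : Vec s)) + (0, 0, d.2) = (0, d) := by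
    obtain ⟨a, b, c⟩ := d
    simp
  rw [e]
  exact hu.fderiv_lowerResidual I (0, d)

/-- LICQ and the second-order sufficient condition make the partial derivative injective: testing
the first equation with `dy` gives `⟨∇²_yy ℒ dy, dy⟩ = 0` on the critical cone, hence `dy = 0`, and
LICQ then kills the multipliers. -/
theorem JacobianUniqueness.injective_residualPartial {x : Vec n} {y : Vec m} {μ : Vec r}
    {ξ : Vec s} (hJ : D.JacobianUniqueness x y μ ξ) (hu : D.SmoothAt (x, y, μ, ξ)) :
    Function.Injective (D.residualPartial {i | D.g (x, y) i = 0} (x, y, μ, ξ)) := by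
  set I := {i | D.g (x, y) i = 0}
  rw [injective_iff_map_eq_zero]
  rintro ⟨dy, dμ, dξ⟩ h0
  rw [hu.residualPartial_apply] at h0
  simp only [Prod.mk_eq_zero, coordMask_sub_eq_zero] at h0
  obtain ⟨h1, h2, h3, h4⟩ := h0
  have hmul := hu.inner_fderiv_lowerGradient_multiplier dμ dξ
  have hdy : dy = 0 := by
    by_contra hne
    have hcone := (hJ.isStrictKKT.mem_lowerCriticalCone_iff hu dy).2 ⟨h2, h3⟩
    have hpos := hJ.sosc dy ⟨hcone, hne⟩
    rw [hu.hessQuad_lowerLagrangian dy] at hpos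
    have e : inner ℝ (fderiv ℝ D.lowerGradient (x, y, μ, ξ) (0, dy, 0, 0)) dy
        + inner ℝ (fderiv ℝ D.lowerGradient (x, y, μ, ξ) (0, 0, dμ, dξ)) dy = 0 := by
      rw [← inner_add_left, h1, inner_zero_left]
    rw [hmul, h2, inner_zero_right, zero_add, ← inner_coordMask h4,
      coordMask_eq_zero.2 h3, inner_zero_right, add_zero] at e
    exact hpos.ne' e
  subst hdy
  have hzero : fderiv ℝ D.lowerGradient (x, y, μ, ξ) (0, 0, dμ, dξ) = 0 := by
    have e : fderiv ℝ D.lowerGradient (x, y, μ, ξ) (0, 0, 0, 0) = 0 := map_zero _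
    rwa [e, zero_add] at h1
  obtain ⟨k1, k2⟩ := (lowerLICQ_iff hu.hasFDerivAt_h.differentiableAt
    hu.hasFDerivAt_g.differentiableAt).1 hJ.licq dμ dξ (fun i hi => h4 i hi) fun v => by
      rw [← hmul v, hzero, inner_zero_left]
  rw [k1, k2]
  rfl

/-- Conversely, injectivity of the partial derivative gives LICQ. -/
theorem IsStrictKKT.lowerLICQ {I : Set (Fin s)} {u : Vec n × Vec m × Vec r × Vec s}
    (h : D.IsStrictKKT I u) (hu : D.SmoothAt u)
    (hinj : Function.Injective (D.residualPartial I u)) : D.LowerLICQ u.1 u.2.1 := by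
  rw [lowerLICQ_iff hu.hasFDerivAt_h.differentiableAt hu.hasFDerivAt_g.differentiableAt]
  intro μ ξ hξ hv
  have h0 : D.residualPartial I u (0, μ, ξ) = 0 := by
    rw [hu.residualPartial_apply]
    refine Prod.mk_eq_zero.2 ⟨?_, Prod.mk_eq_zero.2 ⟨map_zero _, coordMask_sub_eq_zero.2
      ⟨fun i _ => by simp, fun i hi => hξ i fun h0 => hi ((h.mem_iff i).1 h0)⟩⟩⟩
    have e : fderiv ℝ D.lowerGradient u (0, 0, 0, 0) = 0 := map_zero _
    rw [e, zero_add]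
    refine ext_inner_right ℝ fun v => ?_
    rw [inner_zero_left, hu.inner_fderiv_lowerGradient_multiplier, hv]
  have := hinj (h0.trans (map_zero _).symm)
  simpa using this

end BilevelProgram

/-! ### Stability of the Jacobian uniqueness conditions -/

/-- Finsler's lemma: a quadratic form `φ` which is positive where the nonnegative form `ψ` vanishes
becomes positive definite when a large multiple of `ψ` is added. -/
theorem exists_penalty_pos {E : Type*} [NormedAddCommGroup E] [NormedSpace ℝ E]
    [FiniteDimensional ℝ E] {φ ψ : E → ℝ} (hφ : Continuous φ) (hψ : Continuous ψ)
    (hφ2 : ∀ (t : ℝ) d, φ (t • d) = t ^ 2 * φ d) (hψ2 : ∀ (t : ℝ) d, ψ (t • d) = t ^ 2 * ψ d)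
    (hψ0 : ∀ d, 0 ≤ ψ d) (hpos : ∀ d, d ≠ 0 → ψ d = 0 → 0 < φ d) :
    ∃ c α : ℝ, 0 < c ∧ 0 < α ∧ ∀ d, α * ‖d‖ ^ 2 ≤ φ d + c * ψ d := by
  -- An increasing open cover of the unit sphere; a member that contains the sphere yields the
  -- constants.
  set U : ℕ → Set E := fun k => {d : E | 1 / ((k : ℝ) + 1) < φ d + ((k : ℝ) + 1) * ψ d} with hU
  have hcov : Metric.sphere (0 : E) 1 ⊆ ⋃ k, U k := by
    intro d hd
    have hd0 : d ≠ 0 := by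
      rintro rfl
      simp at hd
    rw [mem_iUnion]
    have hlim : Tendsto (fun k : ℕ => 1 / ((k : ℝ) + 1)) atTop (𝓝 0) :=
      tendsto_one_div_add_atTop_nhds_zero_nat
    rcases (hψ0 d).eq_or_lt with h0 | h0
    · obtain ⟨k, hk⟩ := (hlim.eventually_lt_const (hpos d hd0 h0.symm)).exists
      exact ⟨k, by simpa [hU, ← h0] using hk⟩
    · obtain ⟨k, hk⟩ := exists_nat_gt ((1 - φ d) / ψ d)
      refine ⟨k, ?_⟩
      rw [div_lt_iff₀ h0] at hk
      have h1 : 1 / ((k : ℝ) + 1) ≤ 1 := by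
        rw [div_le_one (by positivity)]
        linarith [Nat.cast_nonneg (α := ℝ) k]
      change 1 / ((k : ℝ) + 1) < φ d + ((k : ℝ) + 1) * ψ d
      linarith
  have hdir : Directed (· ⊆ ·) U := by
    refine directed_of_isDirected_le fun k l hkl d hd => ?_
    change 1 / ((k : ℝ) + 1) < φ d + ((k : ℝ) + 1) * ψ d at hd
    change 1 / ((l : ℝ) + 1) < φ d + ((l : ℝ) + 1) * ψ d
    have hkl' : (k : ℝ) ≤ l := by exact_mod_cast hkl
    have h1 : 1 / ((l : ℝ) + 1) ≤ 1 / ((k : ℝ) + 1) :=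
      one_div_le_one_div_of_le (by positivity) (by linarith)
    have h2 : ((k : ℝ) + 1) * ψ d ≤ ((l : ℝ) + 1) * ψ d :=
      mul_le_mul_of_nonneg_right (by linarith) (hψ0 d)
    linarith
  obtain ⟨k, hk⟩ := (isCompact_sphere (0 : E) 1).elim_directed_cover U
    (fun k => isOpen_lt continuous_const (by fun_prop)) hcov hdir
  refine ⟨k + 1, 1 / (k + 1), by positivity, by positivity, fun d => ?_⟩
  by_cases hd : d = 0
  · have h1 := hφ2 0 0
    have h2 := hψ2 0 0
    simp only [smul_zero, ne_eq, OfNat.ofNat_ne_zero, not_false_eq_true, zero_pow,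
      zero_mul] at h1 h2
    simp [hd, h1, h2]
  · have hn : 0 < ‖d‖ := norm_pos_iff.2 hd
    have hmem := hk (show ‖d‖⁻¹ • d ∈ Metric.sphere (0 : E) 1 by
      simp [norm_smul, inv_mul_cancel₀ hn.ne'])
    have e : d = ‖d‖ • (‖d‖⁻¹ • d) := by rw [smul_smul, mul_inv_cancel₀ hn.ne', one_smul]
    have e1 : φ d = ‖d‖ ^ 2 * φ (‖d‖⁻¹ • d) := by rw [← hφ2, ← e]
    have e2 : ψ d = ‖d‖ ^ 2 * ψ (‖d‖⁻¹ • d) := by rw [← hψ2, ← e]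
    have := mul_le_mul_of_nonneg_left (le_of_lt hmem) (sq_nonneg ‖d‖)
    rw [e1, e2]
    linarith

namespace BilevelProgram

variable {n m p q r s : ℕ} {D : BilevelProgram n m p q r s}

/-- The quadratic form `⟨∇²_yy ℒ d, d⟩` penalised by the active constraints. -/
def augmentedForm (D : BilevelProgram n m p q r s) (I : Set (Fin s)) (c : ℝ)
    (u : Vec n × Vec m × Vec r × Vec s) (d : Vec m) : ℝ :=
  inner ℝ (fderiv ℝ D.lowerGradient u (0, d, 0, 0)) d
    + c * (‖partialY D.h u.1 u.2.1 d‖ ^ 2 + ‖coordMask I (partialY D.g u.1 u.2.1 d)‖ ^ 2)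

theorem augmentedForm_smul (I : Set (Fin s)) (c : ℝ) (u : Vec n × Vec m × Vec r × Vec s)
    (t : ℝ) (d : Vec m) : D.augmentedForm I c u (t • d) = t ^ 2 * D.augmentedForm I c u d := by
  have e : ((0 : Vec n), t • d, (0 : Vec r), (0 : Vec s)) = t • (0, d, 0, 0) := by simp
  unfold augmentedForm
  rw [e]
  simp only [map_smul, norm_smul, inner_smul_left, inner_smul_right, conj_trivial, mul_pow,
    Real.norm_eq_abs, sq_abs]
  ring

theorem JacobianUniqueness.exists_augmentedForm_pos {x : Vec n} {y : Vec m} {μ : Vec r}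
    {ξ : Vec s} (hJ : D.JacobianUniqueness x y μ ξ) (hu : D.SmoothAt (x, y, μ, ξ)) :
    ∃ c α : ℝ, 0 < c ∧ 0 < α ∧ ∀ d,
      α * ‖d‖ ^ 2 ≤ D.augmentedForm {i | D.g (x, y) i = 0} c (x, y, μ, ξ) d := by
  set I := {i | D.g (x, y) i = 0}
  refine exists_penalty_pos
    (φ := fun d => inner ℝ (fderiv ℝ D.lowerGradient (x, y, μ, ξ) (0, d, 0, 0)) d)
    (ψ := fun d => ‖partialY D.h x y d‖ ^ 2 + ‖coordMask I (partialY D.g x y d)‖ ^ 2)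
    (by fun_prop) (by fun_prop) (fun t d => ?_) (fun t d => ?_) (fun d => by positivity)
    fun d hd h0 => ?_
  · simpa [augmentedForm] using D.augmentedForm_smul I 0 (x, y, μ, ξ) t d
  · simp only [map_smul, norm_smul, mul_pow, Real.norm_eq_abs, sq_abs]
    ring
  · have h1 : partialY D.h x y d = 0 := by
      rw [← norm_eq_zero, ← sq_eq_zero_iff]
      nlinarith [sq_nonneg ‖partialY D.h x y d‖, sq_nonneg ‖coordMask I (partialY D.g x y d)‖]
    have h2 : coordMask I (partialY D.g x y d) = 0 := by
      rw [← norm_eq_zero, ← sq_eq_zero_iff]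
      nlinarith [sq_nonneg ‖partialY D.h x y d‖, sq_nonneg ‖coordMask I (partialY D.g x y d)‖]
    have := hJ.sosc d ⟨(hJ.isStrictKKT.mem_lowerCriticalCone_iff hu d).2
      ⟨h1, coordMask_eq_zero.1 h2⟩, hd⟩
    rwa [hu.hessQuad_lowerLagrangian d] at this

/-- Positive definiteness of the augmented form is an open condition, by compactness of the unit
sphere. -/
theorem SmoothAt.eventually_augmentedForm_pos {u : Vec n × Vec m × Vec r × Vec s}
    (hu : D.SmoothAt u) {I : Set (Fin s)} {c : ℝ}
    (hpos : ∀ d, d ≠ 0 → 0 < D.augmentedForm I c u d) :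
    ∀ᶠ w in 𝓝 u, ∀ d, d ≠ 0 → 0 < D.augmentedForm I c w d := by
  have hev : ∀ᶠ w in 𝓝 u, ∀ d ∈ Metric.sphere (0 : Vec m) 1, 0 < D.augmentedForm I c w d := by
    refine (isCompact_sphere (0 : Vec m) 1).eventually_forall_of_forall_eventually
      fun d hd => ?_
    have hd0 : d ≠ 0 := by
      rintro rfl
      simp at hd
    have hπ : ContinuousAt (fun z : (Vec n × Vec m × Vec r × Vec s) × Vec m =>
        (z.1.1, z.1.2.1)) (u, d) := by fun_prop
    have c1 : ContinuousAt (fun z : (Vec n × Vec m × Vec r × Vec s) × Vec m =>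
        fderiv ℝ D.lowerGradient z.1) (u, d) :=
      ContinuousAt.comp (g := fderiv ℝ D.lowerGradient)
        (f := fun z : (Vec n × Vec m × Vec r × Vec s) × Vec m => z.1)
        (hu.lowerGradient.fderiv_right (m := 1) (by norm_num)).continuousAt continuousAt_fst
    have c2 : ContinuousAt (fun z : (Vec n × Vec m × Vec r × Vec s) × Vec m =>
        partialY D.h z.1.1 z.1.2.1) (u, d) :=
      ContinuousAt.comp (g := fun z : Vec n × Vec m => partialY D.h z.1 z.2)
        (f := fun z : (Vec n × Vec m × Vec r × Vec s) × Vec m => (z.1.1, z.1.2.1))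
        hu.h.partialY.continuousAt hπ
    have c3 : ContinuousAt (fun z : (Vec n × Vec m × Vec r × Vec s) × Vec m =>
        partialY D.g z.1.1 z.1.2.1) (u, d) :=
      ContinuousAt.comp (g := fun z : Vec n × Vec m => partialY D.g z.1 z.2)
        (f := fun z : (Vec n × Vec m × Vec r × Vec s) × Vec m => (z.1.1, z.1.2.1))
        hu.g.partialY.continuousAt hπ
    have e1 : ContinuousAt (fun z : (Vec n × Vec m × Vec r × Vec s) × Vec m =>
        ((0 : Vec n), z.2, (0 : Vec r), (0 : Vec s))) (u, d) := by fun_prop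
    have hc : ContinuousAt (fun z : (Vec n × Vec m × Vec r × Vec s) × Vec m =>
        D.augmentedForm I c z.1 z.2) (u, d) := by
      have k1 := (c1.clm_apply e1).inner (𝕜 := ℝ) (continuousAt_snd (p := (u, d)))
      have k2 := (c2.clm_apply (continuousAt_snd (p := (u, d)))).norm.pow 2
      have k3 := ((coordMask I).continuous.continuousAt.comp
        (c3.clm_apply (continuousAt_snd (p := (u, d))))).norm.pow 2
      exact k1.add (continuousAt_const.mul (k2.add k3))
    exact hc.eventually_const_lt (hpos d hd0)
  filter_upwards [hev] with w hw d hd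
  have hn : 0 < ‖d‖ := norm_pos_iff.2 hd
  have e : d = ‖d‖ • (‖d‖⁻¹ • d) := by rw [smul_smul, mul_inv_cancel₀ hn.ne', one_smul]
  have := hw (‖d‖⁻¹ • d) (by simp [norm_smul, inv_mul_cancel₀ hn.ne'])
  rw [e, augmentedForm_smul]
  positivity

theorem SmoothAt.eventually_injective_residualPartial {u : Vec n × Vec m × Vec r × Vec s}
    (hu : D.SmoothAt u) {I : Set (Fin s)} (hinj : Function.Injective (D.residualPartial I u)) :
    ∀ᶠ w in 𝓝 u, Function.Injective (D.residualPartial I w) := by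
  have hc : ContinuousAt (D.residualPartial I) u :=
    ((hu.contDiffAt_lowerResidual I).fderiv_right (m := 1) (by norm_num)).continuousAt.clm_comp
      continuousAt_const
  exact hc.tendsto.eventually (ContinuousLinearMap.isOpen_injective.mem_nhds hinj)

/-- Near a point with the Jacobian uniqueness conditions, they hold at all zeros of the residual.
Positivity on the critical cone, which moves with the point, is not visibly an open condition;
positivity of the augmented form on the whole space is. -/
theorem JacobianUniqueness.eventually {x : Vec n} {y : Vec m} {μ : Vec r}
    {ξ : Vec s} (hJ : D.JacobianUniqueness x y μ ξ) (hu : D.SmoothAt (x, y, μ, ξ)) :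
    ∀ᶠ w in 𝓝 (x, y, μ, ξ), D.lowerResidual {i | D.g (x, y) i = 0} w = 0 →
      D.JacobianUniqueness w.1 w.2.1 w.2.2.1 w.2.2.2 := by
  obtain ⟨c, α, hc, hα, hpos⟩ := hJ.exists_augmentedForm_pos hu
  have hpos' : ∀ d, d ≠ 0 → 0 < D.augmentedForm {i | D.g (x, y) i = 0} c (x, y, μ, ξ) d :=
    fun d hd => by
      have hn : 0 < ‖d‖ := norm_pos_iff.2 hd
      have : 0 < α * ‖d‖ ^ 2 := by positivity
      exact this.trans_le (hpos d)
  filter_upwards [hJ.isStrictKKT.eventually_of_lowerResidual_eq_zero hu,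
    hu.eventually_injective_residualPartial (hJ.injective_residualPartial hu),
    hu.eventually_augmentedForm_pos hpos', hu.eventually] with w h1 h2 h3 h4 h0
  have hK := h1 h0
  refine ⟨hK.isLowerKKT, hK.lowerLICQ h4 h2, hK.strict, fun d hd => ?_⟩
  rw [h4.hessQuad_lowerLagrangian d]
  obtain ⟨k1, k2⟩ := (hK.mem_lowerCriticalCone_iff h4 d).1 hd.1
  have := h3 d hd.2
  simpa [augmentedForm, k1, coordMask_eq_zero.2 k2] using this

/-! ### The lower level solution map -/

theorem isInvertible_of_injective {E : Type*} [NormedAddCommGroup E] [NormedSpace ℝ E]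
    [FiniteDimensional ℝ E] {A : E →L[ℝ] E} (hA : Function.Injective A) : A.IsInvertible :=
  ⟨(LinearEquiv.ofInjectiveEndo (A : E →ₗ[ℝ] E) hA).toContinuousLinearEquiv, by ext; rfl⟩

/-- The implicit function theorem for the residual: near the base point its zeros are the graph of a
twice continuously differentiable map. -/
theorem JacobianUniqueness.exists_implicit {x : Vec n} {y : Vec m} {μ : Vec r}
    {ξ : Vec s} (hJ : D.JacobianUniqueness x y μ ξ) (hu : D.SmoothAt (x, y, μ, ξ)) :
    ∃ v : Vec n → Vec m × Vec r × Vec s, v x = (y, μ, ξ) ∧ ContDiffAt ℝ 2 v x ∧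
      (∀ᶠ x' in 𝓝 x, D.lowerResidual {i | D.g (x, y) i = 0} (x', v x') = 0) ∧
      ∀ᶠ w in 𝓝 (x, y, μ, ξ), D.lowerResidual {i | D.g (x, y) i = 0} w = 0 → v w.1 = w.2 := by
  have hC := hu.contDiffAt_lowerResidual {i | D.g (x, y) i = 0}
  have hinv : (fderiv ℝ (D.lowerResidual {i | D.g (x, y) i = 0}) (x, y, μ, ξ) ∘L
      .inr ℝ (Vec n) (Vec m × Vec r × Vec s)).IsInvertible :=
    isInvertible_of_injective (hJ.injective_residualPartial hu)
  have h0 := hJ.isStrictKKT.lowerResidual_eq_zero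
  refine ⟨hC.implicitFunction (by simp) hinv, hC.implicitFunction_apply_self (by simp) hinv,
    hC.contDiffAt_implicitFunction (by simp) hinv, ?_, ?_⟩
  · have := hC.eventually_apply_implicitFunction (by simp) hinv
    rwa [h0] at this
  · filter_upwards [hC.eventually_apply_eq_iff_implicitFunction (by simp) hinv] with w hw hw0
    exact hw.1 (by rw [hw0, h0])

/-- Existence of the lower level solution map. -/
theorem JacobianUniqueness.exists_isLowerSolutionMap {xs : Vec n} {ys : Vec m} {μs : Vec r}
    {ξs : Vec s} (hJ : D.JacobianUniqueness xs ys μs ξs) (hu : D.SmoothAt (xs, ys, μs, ξs)) :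
    ∃ y μ ξ, D.IsLowerSolutionMap xs ys μs ξs y μ ξ := by
  obtain ⟨v, hv0, hvC, hvz, -⟩ := hJ.exists_implicit hu
  have hvt : Tendsto (fun x => (x, v x)) (𝓝 xs) (𝓝 (xs, ys, μs, ξs)) := by
    rw [← hv0]
    exact (continuousAt_id.prodMk hvC.continuousAt).tendsto
  have hy : ContDiffAt ℝ 2 (fun x => (v x).1) xs := hvC.fst
  have hμ : ContDiffAt ℝ 2 (fun x => (v x).2.1) xs := hvC.snd.fst
  have hξ : ContDiffAt ℝ 2 (fun x => (v x).2.2) xs := hvC.snd.snd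
  have hball : ∀ {k : ℕ} {φ : Vec n → Vec k}, ContDiffAt ℝ 2 φ xs →
      ∀ᶠ x in 𝓝 xs, φ x ∈ Metric.closedBall (φ xs) 1 := fun h =>
    h.continuousAt.tendsto.eventually (Metric.closedBall_mem_nhds _ one_pos)
  have hall := (hvt.eventually (hJ.eventually hu)).and (hvz.and ((hball hy).and ((hball hμ).and
    ((hball hξ).and ((hy.eventually (by simp)).and ((hμ.eventually (by simp)).and
      (hξ.eventually (by simp))))))))
  obtain ⟨δ, hδ, hsub⟩ := Metric.nhds_basis_closedBall.eventually_iff.1 hall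
  refine ⟨fun x => (v x).1, fun x => (v x).2.1, fun x => (v x).2.2, ?_, ?_, ?_, δ, 1, hδ,
    one_pos, fun x hx => ?_, fun x hx => ?_, fun x hx => ?_, fun x hx => ?_⟩
  · simp [hv0]
  · simp [hv0]
  · simp [hv0]
  · exact ((hsub hx).2.2.2.2.2.1.of_le (by norm_num)).contDiffWithinAt
  · exact ((hsub hx).2.2.2.2.2.2.1.of_le (by norm_num)).contDiffWithinAt
  · exact ((hsub hx).2.2.2.2.2.2.2.of_le (by norm_num)).contDiffWithinAt
  · obtain ⟨h1, h2, h3, h4, h5, -⟩ := hsub hx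
    refine ⟨by simpa [hv0] using h3, by simpa [hv0] using h4, by simpa [hv0] using h5, h1 h2⟩

/-- Uniqueness in the implicit function theorem makes every solution map twice continuously
differentiable; near the base point it consists of strict KKT points with constant active set. -/
theorem IsLowerSolutionMap.contDiffAt_and_isStrictKKT {xs : Vec n} {ys : Vec m} {μs : Vec r}
    {ξs : Vec s} {y : Vec n → Vec m} {μ : Vec n → Vec r} {ξ : Vec n → Vec s}
    (hS : D.IsLowerSolutionMap xs ys μs ξs y μ ξ)
    (hJ : D.JacobianUniqueness xs ys μs ξs) (hu : D.SmoothAt (xs, ys, μs, ξs)) :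
    ContDiffAt ℝ 2 (fun x => (y x, μ x, ξ x)) xs ∧
      ∀ᶠ x in 𝓝 xs, D.IsStrictKKT {i | D.g (xs, ys) i = 0} (x, y x, μ x, ξ x) := by
  obtain ⟨hy, hμ, hξ, δ, ε, hδ, -, hyC, hμC, hξC, hall⟩ := hS
  have hnhds := Metric.closedBall_mem_nhds xs hδ
  have ht : Tendsto (fun x => (x, y x, μ x, ξ x)) (𝓝 xs) (𝓝 (xs, ys, μs, ξs)) := by
    rw [← hy, ← hμ, ← hξ]
    exact (continuousAt_id.prodMk ((hyC.contDiffAt hnhds).continuousAt.prodMk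
      ((hμC.contDiffAt hnhds).continuousAt.prodMk (hξC.contDiffAt hnhds).continuousAt))).tendsto
  have hzero : ∀ᶠ x in 𝓝 xs,
      D.lowerResidual {i | D.g (xs, ys) i = 0} (x, y x, μ x, ξ x) = 0 := by
    filter_upwards [ht.eventually (hJ.isStrictKKT.compResidual_eventuallyEq hu), hnhds]
      with x hx hxb
    have hK := (hall x hxb).2.2.2.kkt
    refine Prod.ext hK.1 (Prod.ext hK.2.1 ?_)
    rw [← hx]
    exact hK.compResidual_eq_zero
  obtain ⟨v, -, hvC, -, hv⟩ := hJ.exists_implicit hu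
  refine ⟨hvC.congr_of_eventuallyEq ?_, ?_⟩
  · filter_upwards [hzero, ht.eventually hv] with x h1 h2 using (h2 h1).symm
  · filter_upwards [hzero, ht.eventually (hJ.isStrictKKT.eventually_of_lowerResidual_eq_zero hu)]
      with x h1 h2 using h2 h1

end BilevelProgram

/-! ### Bi-local solutions are local solutions of the reduced problem -/

/-- If the partial gradient `a` in the second variable of `A` is strictly differentiable at
`(x₀, y₀)` with positive definite partial derivative in the second variable, then near `(x₀, y₀)`
critical points in the second variable are minimizers, uniformly in the first variable: the
gradient is strictly monotone there. -/
theorem eventually_le_of_partial_gradient_pos {X Y : Type*} [NormedAddCommGroup X]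
    [NormedSpace ℝ X] [NormedAddCommGroup Y] [NormedSpace ℝ Y] {A : X × Y → ℝ}
    {a : X × Y → Y →L[ℝ] ℝ} {a' : X × Y →L[ℝ] Y →L[ℝ] ℝ} {z₀ : X × Y}
    (hA : ∀ᶠ z in 𝓝 z₀, HasFDerivAt (fun y => A (z.1, y)) (a z) z.2)
    (ha : HasStrictFDerivAt a a' z₀) {α : ℝ} (hα : 0 < α)
    (hpos : ∀ d, α * ‖d‖ ^ 2 ≤ a' (0, d) d) :
    ∃ ρ > 0, ∀ x y y', (x, y) ∈ Metric.ball z₀ ρ → (x, y') ∈ Metric.ball z₀ ρ → a (x, y) = 0 →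
      A (x, y) ≤ A (x, y') := by
  have hstrict := ha.isLittleO.def (half_pos hα)
  obtain ⟨ρ, hρ, hball⟩ := Metric.eventually_nhds_iff_ball.1 hA
  obtain ⟨ρ₁, hρ₁, htt⟩ := Metric.eventually_nhds_iff_ball.1 hstrict
  refine ⟨min ρ ρ₁, lt_min hρ hρ₁, fun x y y' hy hy' h0 => ?_⟩
  set e : ℝ → Y := fun s => y + s • (y' - y) with he
  have hmem : ∀ s ∈ Icc (0 : ℝ) 1, (x, e s) ∈ Metric.ball z₀ (min ρ ρ₁) := by
    intro s hs
    have := (convex_ball z₀ (min ρ ρ₁)).add_smul_sub_mem hy hy' hs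
    simpa [he] using this
  have hder : ∀ s ∈ Icc (0 : ℝ) 1,
      HasDerivAt (fun s => A (x, e s)) (a (x, e s) (y' - y)) s := by
    intro s hs
    have h1 := hball _ (Metric.ball_subset_ball (min_le_left _ _) (hmem s hs))
    have h2 : HasDerivAt e (y' - y) s := by
      simpa [he] using ((hasDerivAt_id s).smul_const (y' - y)).const_add y
    exact h1.comp_hasDerivAt s h2
  have hnn : ∀ s ∈ Icc (0 : ℝ) 1, 0 ≤ a (x, e s) (y' - y) := by
    intro s hs
    rcases hs.1.eq_or_lt with rfl | hs0
    · simp [he, h0]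
    · have h1 := htt ((x, e s), (x, y)) (by
        rw [Metric.mem_ball, Prod.dist_eq]
        exact max_lt (Metric.ball_subset_ball (min_le_right _ _) (hmem s hs))
          (Metric.ball_subset_ball (min_le_right _ _) hy))
      have e1 : (x, e s) - (x, y) = (0, s • (y' - y)) := by simp [he]
      simp only [e1, h0, sub_zero] at h1
      have h2 := (abs_le.1 (((a (x, e s) - a' (0, s • (y' - y))).le_opNorm (s • (y' - y))).trans
        (mul_le_mul_of_nonneg_right h1 (norm_nonneg _)))).1
      have h3 := hpos (s • (y' - y))
      have h4 : ‖((0 : X), s • (y' - y))‖ = ‖s • (y' - y)‖ := by simp [Prod.norm_def]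
      rw [h4, sub_apply] at h2
      have h5 : 0 ≤ s * a (x, e s) (y' - y) := by
        have h6 : a (x, e s) (s • (y' - y)) = s * a (x, e s) (y' - y) := by simp
        rw [← h6]
        nlinarith [sq_nonneg ‖s • (y' - y)‖]
      exact nonneg_of_mul_nonneg_right h5 hs0
  have hmono : MonotoneOn (fun s => A (x, e s)) (Icc 0 1) := by
    refine monotoneOn_of_deriv_nonneg (convex_Icc 0 1)
      (fun s hs => (hder s hs).continuousAt.continuousWithinAt)
      (fun s hs => (hder s (interior_subset hs)).differentiableAt.differentiableWithinAt)
      fun s hs => ?_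
    rw [(hder s (interior_subset hs)).deriv]
    exact hnn s (interior_subset hs)
  simpa [he] using hmono (left_mem_Icc.2 zero_le_one) (right_mem_Icc.2 zero_le_one) zero_le_one

namespace BilevelProgram

variable {n m p q r s : ℕ} {D : BilevelProgram n m p q r s}

/-- The lower level Lagrangian with multipliers depending on `x`, plus a quadratic penalty of the
active constraints. -/
def augmentedLagrangian (D : BilevelProgram n m p q r s) (I : Set (Fin s)) (c : ℝ)
    (μ : Vec n → Vec r) (ξ : Vec n → Vec s) (z : Vec n × Vec m) : ℝ :=
  D.lowerLagrangian z.1 z.2 (μ z.1) (ξ z.1)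
    + c / 2 * (‖D.h z‖ ^ 2 + ‖coordMask I (D.g z)‖ ^ 2)

/-- The partial derivative in `y` of the augmented Lagrangian. -/
def augmentedGradient (D : BilevelProgram n m p q r s) (I : Set (Fin s)) (c : ℝ)
    (μ : Vec n → Vec r) (ξ : Vec n → Vec s) (z : Vec n × Vec m) : Vec m →L[ℝ] ℝ :=
  innerSL ℝ (D.lowerGradient (z.1, z.2, μ z.1, ξ z.1))
    + c • ((innerSL ℝ (D.h z)).comp (partialY D.h z.1 z.2)
      + (innerSL ℝ (coordMask I (D.g z))).comp ((coordMask I).comp (partialY D.g z.1 z.2)))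

/-- Differentiation in `y` does not see the dependence of the multipliers on `x`. -/
theorem hasFDerivAt_augmentedLagrangian {z : Vec n × Vec m} (hf : DifferentiableAt ℝ D.f z)
    (hh : DifferentiableAt ℝ D.h z) (hg : DifferentiableAt ℝ D.g z) (I : Set (Fin s)) (c : ℝ)
    (μ : Vec n → Vec r) (ξ : Vec n → Vec s) :
    HasFDerivAt (fun y => D.augmentedLagrangian I c μ ξ (z.1, y))
      (D.augmentedGradient I c μ ξ z) z.2 := by
  have h1 := hasFDerivAt_lowerLagrangian hf hh hg (μ z.1) (ξ z.1)
  have h2 := (hasFDerivAt_partialY (x := z.1) (y := z.2) hh).norm_sq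
  have h3 := ((coordMask I).hasFDerivAt.comp z.2
    (hasFDerivAt_partialY (x := z.1) (y := z.2) hg)).norm_sq
  have h4 := h1.add ((h2.add h3).const_mul (c / 2))
  refine h4.congr_fderiv ?_
  ext v
  have e := inner_gradLowerLagrangian hf hh hg (μ z.1) (ξ z.1) v
  simp only [augmentedGradient, lowerGradient, add_apply, smul_apply,
    ContinuousLinearMap.comp_apply, innerSL_apply_apply, e, Function.comp_apply, smul_eq_mul,
    nsmul_eq_mul]
  push_cast
  ring

section

variable {xs : Vec n} {ys : Vec m} {μs : Vec r} {ξs : Vec s}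
  {y : Vec n → Vec m} {μ : Vec n → Vec r} {ξ : Vec n → Vec s}

theorem contDiffAt_augmentedGradient (hu : D.SmoothAt (xs, ys, μ xs, ξ xs))
    (hμ : ContDiffAt ℝ 1 μ xs) (hξ : ContDiffAt ℝ 1 ξ xs) (I : Set (Fin s)) (c : ℝ) :
    ContDiffAt ℝ 1 (D.augmentedGradient I c μ ξ) (xs, ys) := by
  have k1 : ContDiffAt ℝ 1 (fun z : Vec n × Vec m => (z.1, z.2, μ z.1, ξ z.1)) (xs, ys) := by
    have hf : ContDiffAt ℝ 1 (Prod.fst : Vec n × Vec m → Vec n) (xs, ys) := contDiffAt_fst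
    exact hf.prodMk (contDiffAt_snd.prodMk ((ContDiffAt.comp (xs, ys) hμ hf).prodMk
      (ContDiffAt.comp (xs, ys) hξ hf)))
  have k2 : ContDiffAt ℝ 1 (fun z : Vec n × Vec m =>
      D.lowerGradient (z.1, z.2, μ z.1, ξ z.1)) (xs, ys) :=
    ContDiffAt.comp (g := D.lowerGradient) (xs, ys) (hu.lowerGradient.of_le (by norm_num)) k1
  have k3 : ContDiffAt ℝ 1 (fun z : Vec n × Vec m =>
      innerSL ℝ (D.lowerGradient (z.1, z.2, μ z.1, ξ z.1))) (xs, ys) :=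
    (innerSL ℝ : Vec m →L[ℝ] Vec m →L[ℝ] ℝ).contDiff.contDiffAt.comp (xs, ys) k2
  have k4 : ContDiffAt ℝ 1 (fun z : Vec n × Vec m => innerSL ℝ (D.h z)) (xs, ys) :=
    (innerSL ℝ : Vec r →L[ℝ] Vec r →L[ℝ] ℝ).contDiff.contDiffAt.comp (xs, ys)
      (hu.h.of_le (by norm_num))
  have k5 : ContDiffAt ℝ 1 (fun z : Vec n × Vec m => innerSL ℝ (coordMask I (D.g z))) (xs, ys) :=
    ((innerSL ℝ : Vec s →L[ℝ] Vec s →L[ℝ] ℝ).comp (coordMask I)).contDiff.contDiffAt.comp (xs, ys)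
      (hu.g.of_le (by norm_num))
  exact k3.add (((k4.clm_comp hu.h.partialY).add
    (k5.clm_comp (contDiffAt_const.clm_comp hu.g.partialY))).const_smul c)

/-- At a KKT point the Hessian in `y` of the augmented Lagrangian is the augmented form: the terms
with second derivatives of the active constraints carry vanishing factors. -/
theorem fderiv_augmentedGradient {I : Set (Fin s)} {c : ℝ}
    (hu : D.SmoothAt (xs, ys, μ xs, ξ xs)) (hK : D.IsStrictKKT I (xs, ys, μ xs, ξ xs))
    (hμ : ContDiffAt ℝ 1 μ xs) (hξ : ContDiffAt ℝ 1 ξ xs) (d : Vec m) :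
    fderiv ℝ (D.augmentedGradient I c μ ξ) (xs, ys) (0, d) d
      = D.augmentedForm I c (xs, ys, μ xs, ξ xs) d := by
  have hC := ((contDiffAt_augmentedGradient hu hμ hξ I c).differentiableAt (by simp)).hasFDerivAt
  have h1 : HasFDerivAt (fun y' => D.augmentedGradient I c μ ξ (xs, y') d) _ ys :=
    (HasFDerivAt.comp (g := D.augmentedGradient I c μ ξ) (f := Prod.mk xs) ys hC
      (hasFDerivAt_prodMk_right xs ys)).clm_apply (hasFDerivAt_const d ys)
  have k1 : HasFDerivAt (fun y' => D.lowerGradient (xs, y', μ xs, ξ xs)) _ ys :=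
    HasFDerivAt.comp (g := D.lowerGradient) (f := fun y' => (xs, y', μ xs, ξ xs)) ys
      hu.hasFDerivAt_lowerGradient
      (HasFDerivAt.comp (g := Prod.mk xs) (f := fun y' => (y', μ xs, ξ xs)) ys
        (hasFDerivAt_prodMk_right xs (ys, μ xs, ξ xs)) (hasFDerivAt_prodMk_left ys (μ xs, ξ xs)))
  have aux : ∀ {k : ℕ} {θ : Vec n × Vec m → Vec k}, ContDiffAt ℝ 2 θ (xs, ys) →
      ∃ B, HasFDerivAt (fun y' => partialY θ xs y' d) B ys := fun h =>
    ⟨_, (HasFDerivAt.comp (g := fun z : Vec n × Vec m => partialY _ z.1 z.2) (f := Prod.mk xs) ys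
      (h.partialY.differentiableAt (by simp)).hasFDerivAt
      (hasFDerivAt_prodMk_right xs ys)).clm_apply (hasFDerivAt_const d ys)⟩
  obtain ⟨B1, hB1⟩ := aux hu.h
  obtain ⟨B2, hB2⟩ := aux hu.g
  have k2 := (hasFDerivAt_partialY hu.hasFDerivAt_h.differentiableAt).inner ℝ hB1
  have k3 := ((coordMask I).hasFDerivAt.comp ys
    (hasFDerivAt_partialY hu.hasFDerivAt_g.differentiableAt)).inner ℝ
    ((coordMask I).hasFDerivAt.comp ys hB2)
  have k4 := (k1.inner ℝ (hasFDerivAt_const d ys)).add ((k2.add k3).const_smul c)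
  have e := DFunLike.congr_fun (h1.unique k4) d
  have hh0 : D.h (xs, ys) = 0 := hK.h
  have hg0 : coordMask I (D.g (xs, ys)) = 0 :=
    coordMask_eq_zero.2 fun i hi => (hK.active i hi).1
  simpa [augmentedForm, mul_add, Prod.mk_zero_zero, fderivInnerCLM_apply, hh0, hg0] using e

/-- Along a solution map, `y x` minimises the lower level problem of `x` on a neighbourhood of `ys`
that does not depend on `x`: it minimises the augmented Lagrangian there, which is at most `f` on
feasible points and equal to `f` at `y x`. -/
theorem eventually_lower_le (hJ : D.JacobianUniqueness xs ys (μ xs) (ξ xs))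
    (hu : D.SmoothAt (xs, ys, μ xs, ξ xs)) (hys : y xs = ys) (hy : ContinuousAt y xs)
    (hμ : ContDiffAt ℝ 1 μ xs) (hξ : ContDiffAt ℝ 1 ξ xs)
    (hK : ∀ᶠ x in 𝓝 xs, D.IsStrictKKT {i | D.g (xs, ys) i = 0} (x, y x, μ x, ξ x)) :
    ∀ᶠ z in 𝓝 (xs, ys), z.2 ∈ D.lowerFeasible z.1 → D.f (z.1, y z.1) ≤ D.f z := by
  set I := {i | D.g (xs, ys) i = 0}
  obtain ⟨c, α, hc, hα, hpos⟩ := hJ.exists_augmentedForm_pos hu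
  have hstrict := (contDiffAt_augmentedGradient hu hμ hξ I c).hasStrictFDerivAt (by simp)
  have hA : ∀ᶠ z in 𝓝 (xs, ys), HasFDerivAt (fun y => D.augmentedLagrangian I c μ ξ (z.1, y))
      (D.augmentedGradient I c μ ξ z) z.2 := by
    filter_upwards [hu.f.eventually (by simp), hu.h.eventually (by simp),
      hu.g.eventually (by simp)] with z h1 h2 h3
    exact hasFDerivAt_augmentedLagrangian (h1.differentiableAt (by simp))
      (h2.differentiableAt (by simp)) (h3.differentiableAt (by simp)) I c μ ξ
  obtain ⟨ρ, hρ, hmin⟩ := eventually_le_of_partial_gradient_pos hA hstrict hα fun d => by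
    rw [fderiv_augmentedGradient hu hJ.isStrictKKT hμ hξ]
    exact hpos d
  have hfst : Tendsto (Prod.fst : Vec n × Vec m → Vec n) (𝓝 (xs, ys)) (𝓝 xs) :=
    continuous_fst.tendsto (xs, ys)
  have hyx : Tendsto (fun z : Vec n × Vec m => (z.1, y z.1)) (𝓝 (xs, ys)) (𝓝 (xs, ys)) := by
    have : Tendsto (fun x => (x, y x)) (𝓝 xs) (𝓝 (xs, ys)) := by
      rw [← hys]; exact (continuousAt_id.prodMk hy).tendsto
    exact this.comp hfst
  -- Near the base point, `ξ i > 0` outweighs the penalty: `ξ i g i + (c / 2) (g i)² ≤ 0`.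
  have hsmall : ∀ᶠ z in 𝓝 (xs, ys), ∀ i, i ∈ I → 0 ≤ ξ z.1 i + c / 2 * D.g z i := by
    refine eventually_all.2 fun i => ?_
    by_cases hi : i ∈ I
    · have hcont : ContinuousAt (fun z : Vec n × Vec m => ξ z.1 i + c / 2 * D.g z i) (xs, ys) := by
        have h1 : ContinuousAt (fun z : Vec n × Vec m => ξ z.1 i) (xs, ys) :=
          ContinuousAt.comp (g := fun x => ξ x i) (f := Prod.fst)
            (hξ.euclidean_apply i).continuousAt continuousAt_fst
        exact h1.add (continuousAt_const.mul (hu.g.euclidean_apply i).continuousAt)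
      have h0 : 0 < ξ xs i + c / 2 * D.g (xs, ys) i := by
        have := hJ.isStrictKKT.active i hi
        rw [show D.g (xs, ys) i = 0 from hi, mul_zero, add_zero]
        exact this.2
      filter_upwards [hcont.eventually_const_lt h0] with z hz _ using le_of_lt hz
    · exact Eventually.of_forall fun z hi' => absurd hi' hi
  filter_upwards [hfst.eventually hK, hyx.eventually (Metric.ball_mem_nhds _ hρ),
    Metric.ball_mem_nhds _ hρ, hsmall] with z hKz hyz hz hsm hfeas
  have hh0 : D.h (z.1, y z.1) = 0 := hKz.h
  have hg0 : coordMask I (D.g (z.1, y z.1)) = 0 :=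
    coordMask_eq_zero.2 fun i hi => (hKz.active i hi).1
  have hgrad : D.augmentedGradient I c μ ξ (z.1, y z.1) = 0 := by
    have h1 : D.lowerGradient (z.1, y z.1, μ z.1, ξ z.1) = 0 := hKz.grad
    simp [augmentedGradient, h1, hh0, hg0]
  have hle := hmin z.1 (y z.1) z.2 hyz hz hgrad
  have e1 : D.augmentedLagrangian I c μ ξ (z.1, y z.1) = D.f (z.1, y z.1) := by
    have h1 : inner ℝ (ξ z.1) (D.g (z.1, y z.1)) = 0 := hKz.isLowerKKT.2.2.2.2
    simp [augmentedLagrangian, lowerLagrangian, hh0, hg0, h1]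
  have e2 : D.augmentedLagrangian I c μ ξ z ≤ D.f z := by
    have h1 : D.h z = 0 := hfeas.1
    have h2 : inner ℝ (ξ z.1) (D.g z) + c / 2 * ‖coordMask I (D.g z)‖ ^ 2 ≤ 0 := by
      rw [EuclideanSpace.inner_eq_sum, EuclideanSpace.norm_sq_eq, Finset.mul_sum,
        ← Finset.sum_add_distrib]
      refine Finset.sum_nonpos fun i _ => ?_
      have hgi : D.g z i ≤ 0 := hfeas.2 i
      by_cases hi : i ∈ I
      · rw [coordMask_apply_mem hi, Real.norm_eq_abs, sq_abs]
        nlinarith [mul_nonneg (hsm i hi) (neg_nonneg.2 hgi)]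
      · have : ξ z.1 i = 0 := (hKz.inactive i hi).2
        rw [coordMask_apply_notMem hi, this]
        simp
    change D.f z + inner ℝ (μ z.1) (D.h z) + inner ℝ (ξ z.1) (D.g z)
      + c / 2 * (‖D.h z‖ ^ 2 + ‖coordMask I (D.g z)‖ ^ 2) ≤ D.f z
    rw [h1, inner_zero_right, norm_zero]
    linarith
  rw [e1] at hle
  exact hle.trans e2

/-- A bi-local solution of the bilevel program is a local solution of the reduced problem. -/
theorem IsBiLocalSolution.isLocalMinOn (hB : D.IsBiLocalSolution xs ys) (hys : y xs = ys)
    (hy : ContinuousAt y xs)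
    (hfeas : ∀ᶠ x in 𝓝 xs, y x ∈ D.lowerFeasible x)
    (hle : ∀ᶠ z in 𝓝 (xs, ys), z.2 ∈ D.lowerFeasible z.1 → D.f (z.1, y z.1) ≤ D.f z) :
    IsLocalMinOn (fun x => D.F (x, y x)) {x | D.H (x, y x) = 0 ∧ ∀ i, D.G (x, y x) i ≤ 0} xs := by
  obtain ⟨-, -, δ₀, hδ₀, η, hη, hηt, hopt⟩ := hB
  obtain ⟨ρ, hρ, hball⟩ := Metric.nhds_basis_ball.eventually_iff.1 hle
  -- A radius `δ` for which the lower level ball lies in the region of uniform optimality.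
  obtain ⟨δ, hδρ, hδpos, hδle⟩ := ((hηt.eventually_lt_const hρ).and
    (Ioc_mem_nhdsGT hδ₀)).exists
  have hδ : δ ∈ Ioc 0 δ₀ := ⟨hδpos, hδle⟩
  have hyt : Tendsto y (𝓝 xs) (𝓝 ys) := hys ▸ hy.tendsto
  refine eventually_nhdsWithin_iff.2 ?_
  filter_upwards [hfeas, Metric.ball_mem_nhds xs hρ, Metric.closedBall_mem_nhds xs hδpos,
    hyt.eventually (Metric.closedBall_mem_nhds ys (hη δ hδ))] with x h1 h2 h3 h4 hx
  have := (hopt δ hδ).2 x h3 (y x) h4 hx h1 fun z hz => by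
    refine hball (x := (x, z)) ?_ hz.1
    rw [Metric.mem_ball, Prod.dist_eq]
    exact max_lt h2 ((Metric.mem_closedBall.1 hz.2).trans_lt hδρ)
  simpa [hys] using this

end

end BilevelProgram

/-! ### Equivalence of the reduced problem and the first-order reformulation -/

/-- At a critical point of `φ`, the second-order chain rule has no first-order term. -/
theorem hessQuad_comp {E U : Type*} [NormedAddCommGroup E] [NormedSpace ℝ E]
    [NormedAddCommGroup U] [NormedSpace ℝ U] {φ : U → ℝ} {w : E → U} {x : E}
    (hφ : ContDiffAt ℝ 2 φ (w x)) (hw : ContDiffAt ℝ 2 w x) (h0 : fderiv ℝ φ (w x) = 0) (d : E) :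
    hessQuad (fun x => φ (w x)) x d = hessQuad φ (w x) (fderiv ℝ w x d) := by
  have hev : fderiv ℝ (fun x => φ (w x)) =ᶠ[𝓝 x] fun z =>
      (fderiv ℝ φ (w z)).comp (fderiv ℝ w z) := by
    filter_upwards [hw.continuousAt.tendsto.eventually (hφ.eventually (by simp)),
      hw.eventually (by simp)] with z h1 h2
    exact (HasFDerivAt.comp (g := φ) z (h1.differentiableAt (by simp)).hasFDerivAt
      (h2.differentiableAt (by simp)).hasFDerivAt).fderiv
  have h1 : HasFDerivAt (fun z => fderiv ℝ φ (w z)) _ x :=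
    HasFDerivAt.comp (g := fderiv ℝ φ) x
      ((hφ.fderiv_right (m := 1) (by norm_num)).differentiableAt (by simp)).hasFDerivAt
      (hw.differentiableAt (by simp)).hasFDerivAt
  have h2 := ((hw.fderiv_right (m := 1) (by norm_num)).differentiableAt (by simp)).hasFDerivAt
  unfold hessQuad
  rw [hev.fderiv_eq, (h1.clm_comp h2).fderiv, h0]
  simp

/-- The pairing of `ℝᵐ × ℝʳ × ℝˢ` with itself; the product carries the supremum norm, hence no
inner product of its own. -/
def dotProd {m r s : ℕ} (t : Vec m × Vec r × Vec s) : (Vec m × Vec r × Vec s) →L[ℝ] ℝ :=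
  (innerSL ℝ t.1).comp (ContinuousLinearMap.fst ℝ _ _)
    + ((innerSL ℝ t.2.1).comp (ContinuousLinearMap.fst ℝ _ _)
      + (innerSL ℝ t.2.2).comp (ContinuousLinearMap.snd ℝ _ _)).comp
        (ContinuousLinearMap.snd ℝ _ _)

theorem dotProd_apply {m r s : ℕ} (t a : Vec m × Vec r × Vec s) :
    dotProd t a = inner ℝ t.1 a.1 + (inner ℝ t.2.1 a.2.1 + inner ℝ t.2.2 a.2.2) := rfl

theorem dotProd_injective {m r s : ℕ} :
    Function.Injective (dotProd : Vec m × Vec r × Vec s → _) := by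
  intro t t' h
  have h' : ∀ a, dotProd t a = dotProd t' a := fun a => DFunLike.congr_fun h a
  simp only [dotProd_apply] at h'
  refine Prod.ext ?_ (Prod.ext ?_ ?_)
  · exact ext_inner_right ℝ fun v => by simpa using h' (v, 0, 0)
  · exact ext_inner_right ℝ fun v => by simpa using h' (0, v, 0)
  · exact ext_inner_right ℝ fun v => by simpa using h' (0, 0, v)

/-- The vector representing a linear functional with respect to `dotProd`. -/
def rieszProd {m r s : ℕ} (ℓ : (Vec m × Vec r × Vec s) →L[ℝ] ℝ) : Vec m × Vec r × Vec s :=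
  (WithLp.toLp 2 fun i => ℓ (EuclideanSpace.single i 1, 0, 0),
    WithLp.toLp 2 fun i => ℓ (0, EuclideanSpace.single i 1, 0),
    WithLp.toLp 2 fun i => ℓ (0, 0, EuclideanSpace.single i 1))

theorem continuous_rieszProd {m r s : ℕ} :
    Continuous (rieszProd : ((Vec m × Vec r × Vec s) →L[ℝ] ℝ) → _) := by
  unfold rieszProd
  refine Continuous.prodMk ?_ (Continuous.prodMk ?_ ?_) <;>
    exact (PiLp.continuous_toLp 2 _).comp (continuous_pi fun i => by fun_prop)

theorem dotProd_rieszProd {m r s : ℕ} (ℓ : (Vec m × Vec r × Vec s) →L[ℝ] ℝ) :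
    dotProd (rieszProd ℓ) = ℓ := by
  have key : ∀ {k : ℕ} (L : Vec k →L[ℝ] ℝ) (v : Vec k),
      inner ℝ (WithLp.toLp 2 fun i => L (EuclideanSpace.single i 1)) v = L v := by
    intro k L v
    conv_rhs => rw [← (EuclideanSpace.basisFun (Fin k) ℝ).sum_repr v, map_sum]
    rw [EuclideanSpace.inner_eq_sum]
    exact Finset.sum_congr rfl fun i _ => by simp [mul_comm]
  refine ContinuousLinearMap.ext fun a => ?_
  rw [dotProd_apply]
  have e1 := key (ℓ.comp (ContinuousLinearMap.inl ℝ _ _)) a.1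
  have e2 := key (ℓ.comp ((ContinuousLinearMap.inr ℝ _ _).comp
    (ContinuousLinearMap.inl ℝ _ _))) a.2.1
  have e3 := key (ℓ.comp ((ContinuousLinearMap.inr ℝ _ _).comp
    (ContinuousLinearMap.inr ℝ _ _))) a.2.2
  refine (congrArg₂ (· + ·) e1 (congrArg₂ (· + ·) e2 e3)).trans ?_
  simp only [ContinuousLinearMap.comp_apply, ContinuousLinearMap.inl_apply,
    ContinuousLinearMap.inr_apply, ← map_add]
  simp

namespace BilevelProgram

variable {n m p q r s : ℕ} {D : BilevelProgram n m p q r s}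

/-- A twice continuously differentiable curve `x ↦ (x, y x, μ x, ξ x)` of strict lower level KKT
points with constant active set, through a point satisfying the Jacobian uniqueness conditions. -/
structure IsSolutionCurve (D : BilevelProgram n m p q r s) (xs : Vec n) (y : Vec n → Vec m)
    (μ : Vec n → Vec r) (ξ : Vec n → Vec s) : Prop where
  smooth : D.SmoothAt (xs, y xs, μ xs, ξ xs)
  jac : D.JacobianUniqueness xs (y xs) (μ xs) (ξ xs)
  contDiffAt : ContDiffAt ℝ 2 (fun x => (x, y x, μ x, ξ x)) xs
  kkt : ∀ᶠ x in 𝓝 xs, D.IsStrictKKT {i | D.g (xs, y xs) i = 0} (x, y x, μ x, ξ x)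
  F : ContDiffAt ℝ 2 D.F (xs, y xs)
  H : ContDiffAt ℝ 2 D.H (xs, y xs)
  G : ContDiffAt ℝ 2 D.G (xs, y xs)

/-- `L^FP` near a strict KKT point, with the projection replaced by its local linear form. -/
theorem lagrangianFP_eventuallyEq {I : Set (Fin s)} {u : Vec n × Vec m × Vec r × Vec s}
    (hK : D.IsStrictKKT I u) (hu : D.SmoothAt u) (l : Vec p × Vec q × Vec m × Vec r × Vec s) :
    D.lagrangianFP l =ᶠ[𝓝 u] fun w =>
      nlpLagrangian (fun w : Vec n × Vec m × Vec r × Vec s => D.F (w.1, w.2.1))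
        (fun w => D.H (w.1, w.2.1)) (fun w => D.G (w.1, w.2.1)) (l.1, l.2.1) w
      + dotProd l.2.2 (D.lowerResidual I w) := by
  filter_upwards [hK.compResidual_eventuallyEq hu] with w hw
  rw [dotProd_apply, ← hw]
  change D.F (w.1, w.2.1) + inner ℝ l.1 (D.H (w.1, w.2.1)) + inner ℝ l.2.1 (D.G (w.1, w.2.1))
      + inner ℝ l.2.2.1 (D.gradLowerLagrangian w.1 w.2.1 w.2.2.1 w.2.2.2)
      + inner ℝ l.2.2.2.1 (D.h (w.1, w.2.1))
      + inner ℝ l.2.2.2.2 (D.compResidual w.1 w.2.1 w.2.2.2)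
    = D.F (w.1, w.2.1) + inner ℝ l.1 (D.H (w.1, w.2.1)) + inner ℝ l.2.1 (D.G (w.1, w.2.1))
      + (inner ℝ l.2.2.1 (D.gradLowerLagrangian w.1 w.2.1 w.2.2.1 w.2.2.2)
        + (inner ℝ l.2.2.2.1 (D.h (w.1, w.2.1))
          + inner ℝ l.2.2.2.2 (D.compResidual w.1 w.2.1 w.2.2.2)))
  ring

theorem contDiffAt_comp_proj {V : Type*} [NormedAddCommGroup V] [NormedSpace ℝ V]
    {θ : Vec n × Vec m → V} {u : Vec n × Vec m × Vec r × Vec s}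
    (h : ContDiffAt ℝ 2 θ (u.1, u.2.1)) :
    ContDiffAt ℝ 2 (fun w : Vec n × Vec m × Vec r × Vec s => θ (w.1, w.2.1)) u :=
  ContDiffAt.comp (g := θ) (f := fun w : Vec n × Vec m × Vec r × Vec s => (w.1, w.2.1)) u h
    (by fun_prop)

set_option synthInstance.maxHeartbeats 200000 in
theorem fderiv_comp_proj {V : Type*} [NormedAddCommGroup V] [NormedSpace ℝ V]
    {θ : Vec n × Vec m → V} {u : Vec n × Vec m × Vec r × Vec s}
    (h : DifferentiableAt ℝ θ (u.1, u.2.1)) (d : Vec n × Vec m × Vec r × Vec s) :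
    fderiv ℝ (fun w : Vec n × Vec m × Vec r × Vec s => θ (w.1, w.2.1)) u d
      = fderiv ℝ θ (u.1, u.2.1) (d.1, d.2.1) := by
  let π : (Vec n × Vec m × Vec r × Vec s) →L[ℝ] Vec n × Vec m :=
    (ContinuousLinearMap.fst ℝ _ _).prod
      ((ContinuousLinearMap.fst ℝ _ _).comp (ContinuousLinearMap.snd ℝ _ _))
  have h1 : HasFDerivAt (fun w : Vec n × Vec m × Vec r × Vec s => θ (w.1, w.2.1)) _ u :=
    HasFDerivAt.comp (g := θ) (f := π) u h.hasFDerivAt π.hasFDerivAt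
  rw [h1.fderiv]
  rfl

theorem contDiffAt_lagrangianFP {I : Set (Fin s)} {u : Vec n × Vec m × Vec r × Vec s}
    (hK : D.IsStrictKKT I u) (hu : D.SmoothAt u) (hF : ContDiffAt ℝ 2 D.F (u.1, u.2.1))
    (hH : ContDiffAt ℝ 2 D.H (u.1, u.2.1)) (hG : ContDiffAt ℝ 2 D.G (u.1, u.2.1))
    (l : Vec p × Vec q × Vec m × Vec r × Vec s) : ContDiffAt ℝ 2 (D.lagrangianFP l) u := by
  refine ContDiffAt.congr_of_eventuallyEq ?_ (lagrangianFP_eventuallyEq hK hu l)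
  exact (((contDiffAt_comp_proj hF).add
    ((innerSL ℝ l.1).contDiff.contDiffAt.comp u (contDiffAt_comp_proj hH))).add
    ((innerSL ℝ l.2.1).contDiff.contDiffAt.comp u (contDiffAt_comp_proj hG))).add
    ((dotProd l.2.2).contDiff.contDiffAt.comp u (hu.contDiffAt_lowerResidual I))

set_option synthInstance.maxHeartbeats 200000 in
theorem fderiv_lagrangianFP_apply {I : Set (Fin s)} {u : Vec n × Vec m × Vec r × Vec s}
    (hK : D.IsStrictKKT I u) (hu : D.SmoothAt u) (hF : DifferentiableAt ℝ D.F (u.1, u.2.1))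
    (hH : DifferentiableAt ℝ D.H (u.1, u.2.1)) (hG : DifferentiableAt ℝ D.G (u.1, u.2.1))
    (l : Vec p × Vec q × Vec m × Vec r × Vec s) (d : Vec n × Vec m × Vec r × Vec s) :
    fderiv ℝ (D.lagrangianFP l) u d = fderiv ℝ D.F (u.1, u.2.1) (d.1, d.2.1)
      + inner ℝ l.1 (fderiv ℝ D.H (u.1, u.2.1) (d.1, d.2.1))
      + inner ℝ l.2.1 (fderiv ℝ D.G (u.1, u.2.1) (d.1, d.2.1))
      + dotProd l.2.2 (fderiv ℝ (D.lowerResidual I) u d) := by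
  have hdiff : ∀ {V : Type} [NormedAddCommGroup V] [NormedSpace ℝ V] {θ : Vec n × Vec m → V},
      DifferentiableAt ℝ θ (u.1, u.2.1) → DifferentiableAt ℝ
        (fun w : Vec n × Vec m × Vec r × Vec s => θ (w.1, w.2.1)) u := fun h =>
    DifferentiableAt.comp (f := fun w : Vec n × Vec m × Vec r × Vec s => (w.1, w.2.1)) u h
      (by fun_prop)
  have h1 := hasFDerivAt_nlpLagrangian (hdiff hF) (hdiff hH) (hdiff hG) (l.1, l.2.1)
  have h2 := (dotProd l.2.2).hasFDerivAt.comp u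
    ((hu.contDiffAt_lowerResidual I).differentiableAt (by simp)).hasFDerivAt
  have h3 := (lagrangianFP_eventuallyEq hK hu l).fderiv_eq.trans (h1.add h2).fderiv
  rw [h3, ← fderiv_comp_proj hF, ← fderiv_comp_proj hH, ← fderiv_comp_proj hG]
  rfl


namespace IsSolutionCurve

variable {xs : Vec n} {y : Vec n → Vec m} {μ : Vec n → Vec r} {ξ : Vec n → Vec s}

theorem isStrictKKT (hS : D.IsSolutionCurve xs y μ ξ) :
    D.IsStrictKKT {i | D.g (xs, y xs) i = 0} (xs, y xs, μ xs, ξ xs) :=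
  hS.kkt.self_of_nhds

theorem contDiffAt_y (hS : D.IsSolutionCurve xs y μ ξ) : ContDiffAt ℝ 2 y xs :=
  hS.contDiffAt.snd.fst

theorem contDiffAt_μ (hS : D.IsSolutionCurve xs y μ ξ) : ContDiffAt ℝ 2 μ xs :=
  hS.contDiffAt.snd.snd.fst

theorem contDiffAt_ξ (hS : D.IsSolutionCurve xs y μ ξ) : ContDiffAt ℝ 2 ξ xs :=
  hS.contDiffAt.snd.snd.snd

theorem hasFDerivAt (hS : D.IsSolutionCurve xs y μ ξ) :
    HasFDerivAt (fun x => (x, y x, μ x, ξ x))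
      ((ContinuousLinearMap.id ℝ (Vec n)).prod ((fderiv ℝ y xs).prod
        ((fderiv ℝ μ xs).prod (fderiv ℝ ξ xs)))) xs :=
  (hasFDerivAt_id xs).prodMk
    ((hS.contDiffAt_y.differentiableAt (by simp)).hasFDerivAt.prodMk
      ((hS.contDiffAt_μ.differentiableAt (by simp)).hasFDerivAt.prodMk
        (hS.contDiffAt_ξ.differentiableAt (by simp)).hasFDerivAt))

set_option synthInstance.maxHeartbeats 200000 in
theorem fderiv_apply (hS : D.IsSolutionCurve xs y μ ξ) (d : Vec n) :
    fderiv ℝ (fun x => (x, y x, μ x, ξ x)) xs d = solutionTangent y μ ξ xs d := by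
  rw [hS.hasFDerivAt.fderiv]
  rfl

/-- The chain rule for a function of `(x, y)` along `x ↦ (x, y x)`. -/
theorem fderiv_comp (hS : D.IsSolutionCurve xs y μ ξ) {V : Type*} [NormedAddCommGroup V]
    [NormedSpace ℝ V] {θ : Vec n × Vec m → V} (hθ : DifferentiableAt ℝ θ (xs, y xs)) (d : Vec n) :
    fderiv ℝ (fun x => θ (x, y x)) xs d = fderiv ℝ θ (xs, y xs) (d, fderiv ℝ y xs d) := by
  have h1 : HasFDerivAt (fun x => θ (x, y x)) _ xs :=
    HasFDerivAt.comp (g := θ) (f := fun x => (x, y x)) xs hθ.hasFDerivAt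
      ((hasFDerivAt_id xs).prodMk (hS.contDiffAt_y.differentiableAt (by simp)).hasFDerivAt)
  rw [h1.fderiv]
  rfl

theorem contDiffAt_comp (hS : D.IsSolutionCurve xs y μ ξ) {V : Type*} [NormedAddCommGroup V]
    [NormedSpace ℝ V] {θ : Vec n × Vec m → V} (hθ : ContDiffAt ℝ 2 θ (xs, y xs)) :
    ContDiffAt ℝ 2 (fun x => θ (x, y x)) xs :=
  ContDiffAt.comp (g := θ) (f := fun x => (x, y x)) xs hθ
    (contDiffAt_id.prodMk hS.contDiffAt_y)

theorem contDiffAt_lagrangianSP (hS : D.IsSolutionCurve xs y μ ξ) (l : Vec p × Vec q) :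
    ContDiffAt ℝ 2 (D.lagrangianSP y l) xs :=
  ((hS.contDiffAt_comp hS.F).add
    ((innerSL ℝ l.1).contDiff.contDiffAt.comp xs (hS.contDiffAt_comp hS.H))).add
    ((innerSL ℝ l.2).contDiff.contDiffAt.comp xs (hS.contDiffAt_comp hS.G))

theorem fderiv_lagrangianSP_apply (hS : D.IsSolutionCurve xs y μ ξ) (l : Vec p × Vec q)
    (d : Vec n) :
    fderiv ℝ (D.lagrangianSP y l) xs d = fderiv ℝ D.F (xs, y xs) (d, fderiv ℝ y xs d)
      + inner ℝ l.1 (fderiv ℝ D.H (xs, y xs) (d, fderiv ℝ y xs d))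
      + inner ℝ l.2 (fderiv ℝ D.G (xs, y xs) (d, fderiv ℝ y xs d)) := by
  rw [← hS.fderiv_comp (hS.F.differentiableAt (by simp)),
    ← hS.fderiv_comp (hS.H.differentiableAt (by simp)),
    ← hS.fderiv_comp (hS.G.differentiableAt (by simp))]
  exact fderiv_nlpLagrangian_apply ((hS.contDiffAt_comp hS.F).differentiableAt (by simp))
    ((hS.contDiffAt_comp hS.H).differentiableAt (by simp))
    ((hS.contDiffAt_comp hS.G).differentiableAt (by simp)) l d

/-- The residual vanishes along the curve, so its derivative annihilates the tangents. -/
theorem fderiv_lowerResidual_solutionTangent (hS : D.IsSolutionCurve xs y μ ξ) (d : Vec n) :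
    fderiv ℝ (D.lowerResidual {i | D.g (xs, y xs) i = 0}) (xs, y xs, μ xs, ξ xs)
      (solutionTangent y μ ξ xs d) = 0 := by
  set I := {i | D.g (xs, y xs) i = 0}
  have h1 : HasFDerivAt (fun x => D.lowerResidual I (x, y x, μ x, ξ x)) _ xs :=
    HasFDerivAt.comp (g := D.lowerResidual I) (f := fun x => (x, y x, μ x, ξ x)) xs
      ((hS.smooth.contDiffAt_lowerResidual I).differentiableAt (by simp)).hasFDerivAt
      hS.hasFDerivAt
  have h2 : (fun x => D.lowerResidual I (x, y x, μ x, ξ x)) =ᶠ[𝓝 xs] fun _ => 0 :=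
    hS.kkt.mono fun x hx => hx.lowerResidual_eq_zero
  have h3 := h1.unique ((hasFDerivAt_const _ xs).congr_of_eventuallyEq h2)
  exact DFunLike.congr_fun h3 d

/-- The kernel of the derivative of the residual is the tangent space of the solution curve. -/
theorem fderiv_lowerResidual_eq_zero_iff (hS : D.IsSolutionCurve xs y μ ξ)
    (d : Vec n × Vec m × Vec r × Vec s) :
    fderiv ℝ (D.lowerResidual {i | D.g (xs, y xs) i = 0}) (xs, y xs, μ xs, ξ xs) d = 0 ↔
      d = solutionTangent y μ ξ xs d.1 := by
  constructor
  · intro h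
    have h1 : D.residualPartial {i | D.g (xs, y xs) i = 0} (xs, y xs, μ xs, ξ xs)
        (d.2 - (solutionTangent y μ ξ xs d.1).2) = 0 := by
      have e : ((0 : Vec n), d.2 - (solutionTangent y μ ξ xs d.1).2)
          = d - solutionTangent y μ ξ xs d.1 := by
        refine Prod.ext ?_ rfl
        exact (sub_self d.1).symm
      change fderiv ℝ _ _ ((0 : Vec n), d.2 - (solutionTangent y μ ξ xs d.1).2) = 0
      rw [e, map_sub, h, hS.fderiv_lowerResidual_solutionTangent, sub_zero]
    have h2 := (injective_iff_map_eq_zero _).1 (hS.jac.injective_residualPartial hS.smooth) _ h1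
    exact Prod.ext rfl (sub_eq_zero.1 h2)
  · intro h
    rw [h]
    exact hS.fderiv_lowerResidual_solutionTangent d.1

/-- The derivative of the residual is surjective, already in the directions `(0, dy, dμ, dξ)`. -/
theorem exists_rightInverse (hS : D.IsSolutionCurve xs y μ ξ) :
    ∃ R : (Vec m × Vec r × Vec s) →L[ℝ] Vec n × Vec m × Vec r × Vec s, ∀ v,
      fderiv ℝ (D.lowerResidual {i | D.g (xs, y xs) i = 0}) (xs, y xs, μ xs, ξ xs) (R v) = v := by
  obtain ⟨M, hM⟩ := isInvertible_of_injective (hS.jac.injective_residualPartial hS.smooth)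
  refine ⟨(ContinuousLinearMap.inr ℝ (Vec n) _).comp (M.symm : _ →L[ℝ] _), fun v => ?_⟩
  have := DFunLike.congr_fun hM (M.symm v)
  simp only [ContinuousLinearEquiv.coe_coe, ContinuousLinearEquiv.apply_symm_apply] at this
  exact this.symm

/-- A multiplier of the reformulation consists of a multiplier of the reduced problem and the
multipliers of the lower level system, which are a continuous function of it: stationarity on the
kernel of the derivative of the residual is stationarity of the reduced problem, and off the
kernel it determines the remaining multipliers, since that derivative is surjective. -/
theorem exists_multiplier_map (hS : D.IsSolutionCurve xs y μ ξ) :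
    ∃ τ : Vec p × Vec q → Vec m × Vec r × Vec s, Continuous τ ∧ ∀ lH lG t,
      (lH, lG, t) ∈ D.multipliersFP xs (y xs) (μ xs) (ξ xs) ↔
        (lH, lG) ∈ D.multipliersSP y xs ∧ t = τ (lH, lG) := by
  obtain ⟨R, hR⟩ := hS.exists_rightInverse
  set Ψ' := fderiv ℝ (D.lowerResidual {i | D.g (xs, y xs) i = 0}) (xs, y xs, μ xs, ξ xs)
  let π : (Vec n × Vec m × Vec r × Vec s) →L[ℝ] Vec n × Vec m :=
    (ContinuousLinearMap.fst ℝ _ _).prod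
      ((ContinuousLinearMap.fst ℝ _ _).comp (ContinuousLinearMap.snd ℝ _ _))
  set A : Vec p × Vec q → Vec n × Vec m →L[ℝ] ℝ := fun l => fderiv ℝ D.F (xs, y xs)
    + (innerSL ℝ l.1).comp (fderiv ℝ D.H (xs, y xs))
    + (innerSL ℝ l.2).comp (fderiv ℝ D.G (xs, y xs))
  have hAc : Continuous A := by
    refine (continuous_const.add ?_).add ?_
    · exact (((innerSL ℝ : Vec p →L[ℝ] Vec p →L[ℝ] ℝ).continuous.comp continuous_fst).clm_comp
        continuous_const)
    · exact (((innerSL ℝ : Vec q →L[ℝ] Vec q →L[ℝ] ℝ).continuous.comp continuous_snd).clm_comp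
        continuous_const)
  have hFP : ∀ lH lG t d, fderiv ℝ (D.lagrangianFP (lH, lG, t)) (xs, y xs, μ xs, ξ xs) d
      = A (lH, lG) (π d) + dotProd t (Ψ' d) := fun lH lG t d =>
    fderiv_lagrangianFP_apply hS.isStrictKKT hS.smooth (hS.F.differentiableAt (by simp))
      (hS.H.differentiableAt (by simp)) (hS.G.differentiableAt (by simp)) (lH, lG, t) d
  have hSP : ∀ l d, fderiv ℝ (D.lagrangianSP y l) xs d
      = A l (π (solutionTangent y μ ξ xs d)) := hS.fderiv_lagrangianSP_apply
  -- Stationarity in the directions `R v` reads `⟨t, v⟩ = -A l (π (R v))`.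
  refine ⟨fun l => rieszProd (-((A l).comp (π.comp R))), ?_, fun lH lG t => ?_⟩
  · exact continuous_rieszProd.comp (hAc.clm_comp continuous_const).neg
  have hK := hS.isStrictKKT
  constructor
  · rintro ⟨h1, h2, h3, h4, h5, -⟩
    have h1' : ∀ d, A (lH, lG) (π d) + dotProd t (Ψ' d) = 0 := fun d => by
      rw [← hFP, h1]; rfl
    refine ⟨⟨?_, h2, h3, h4, h5⟩, dotProd_injective ?_⟩
    · refine ContinuousLinearMap.ext fun d => ?_
      have := h1' (solutionTangent y μ ξ xs d)
      rw [hS.fderiv_lowerResidual_solutionTangent, map_zero, add_zero] at this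
      rw [hSP, this]; rfl
    · rw [dotProd_rieszProd]
      refine ContinuousLinearMap.ext fun v => ?_
      have := h1' (R v)
      rw [hR] at this
      change dotProd t v = -(A (lH, lG) (π (R v)))
      linarith
  · rintro ⟨⟨h1, h2, h3, h4, h5⟩, rfl⟩
    refine ⟨?_, h2, h3, h4, h5, hK.grad, hK.h, hK.isLowerKKT.compResidual_eq_zero⟩
    refine ContinuousLinearMap.ext fun d => ?_
    rw [hFP, dotProd_rieszProd]
    have hker : d - R (Ψ' d) = solutionTangent y μ ξ xs (d - R (Ψ' d)).1 := by
      rw [← hS.fderiv_lowerResidual_eq_zero_iff, map_sub, hR, sub_self]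
    have h6 : A (lH, lG) (π (d - R (Ψ' d))) = 0 := by
      rw [hker, ← hSP, h1]; rfl
    rw [map_sub, map_sub] at h6
    change A (lH, lG) (π d) + -(A (lH, lG) (π (R (Ψ' d)))) = 0
    linarith

/-- `L^SP` is the restriction of `L^FP` to the solution curve, and the multipliers make the base
point critical, so the Hessians agree on tangents of the curve. -/
theorem hessQuad_lagrangianSP (hS : D.IsSolutionCurve xs y μ ξ)
    {l : Vec p × Vec q × Vec m × Vec r × Vec s}
    (hl : l ∈ D.multipliersFP xs (y xs) (μ xs) (ξ xs)) (d : Vec n) :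
    hessQuad (D.lagrangianSP y (l.1, l.2.1)) xs d
      = hessQuad (D.lagrangianFP l) (xs, y xs, μ xs, ξ xs) (solutionTangent y μ ξ xs d) := by
  have hC := contDiffAt_lagrangianFP hS.isStrictKKT hS.smooth hS.F hS.H hS.G l
  rw [← hS.fderiv_apply d, ← hessQuad_comp (w := fun x => (x, y x, μ x, ξ x)) hC hS.contDiffAt hl.1]
  have hev : D.lagrangianSP y (l.1, l.2.1) =ᶠ[𝓝 xs]
      fun x => D.lagrangianFP l (x, y x, μ x, ξ x) := by
    filter_upwards [hS.kkt] with x hx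
    have h1 : D.gradLowerLagrangian x (y x) (μ x) (ξ x) = 0 := hx.grad
    have h2 : D.h (x, y x) = 0 := hx.h
    have h3 : D.compResidual x (y x) (ξ x) = 0 := hx.isLowerKKT.compResidual_eq_zero
    simp [lagrangianSP, lagrangianFP, h1, h2, h3]
  unfold hessQuad
  rw [hev.fderiv.fderiv_eq]

theorem multipliersFP_eq_image (hS : D.IsSolutionCurve xs y μ ξ) :
    ∃ τ : Vec p × Vec q → Vec m × Vec r × Vec s, Continuous τ ∧
      D.multipliersFP xs (y xs) (μ xs) (ξ xs)
        = (fun l : Vec p × Vec q => (l.1, l.2, τ l)) '' D.multipliersSP y xs := by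
  obtain ⟨τ, hτ, h⟩ := hS.exists_multiplier_map
  refine ⟨τ, hτ, ?_⟩
  ext ⟨lH, lG, t⟩
  rw [h]
  constructor
  · rintro ⟨h1, rfl⟩
    exact ⟨_, h1, rfl⟩
  · rintro ⟨l, hl, he⟩
    simp only [Prod.mk.injEq] at he
    obtain ⟨rfl, rfl, rfl⟩ := he
    exact ⟨hl, rfl⟩

theorem multipliersSP_eq_image (hS : D.IsSolutionCurve xs y μ ξ) :
    D.multipliersSP y xs = (fun l : Vec p × Vec q × Vec m × Vec r × Vec s => (l.1, l.2.1)) ''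
      D.multipliersFP xs (y xs) (μ xs) (ξ xs) := by
  obtain ⟨τ, -, h⟩ := hS.multipliersFP_eq_image
  rw [h, image_image]
  simp

theorem image_hessQuad_eq (hS : D.IsSolutionCurve xs y μ ξ) (d : Vec n) :
    (fun l => hessQuad (D.lagrangianSP y l) xs d) '' D.multipliersSP y xs
      = (fun l => hessQuad (D.lagrangianFP l) (xs, y xs, μ xs, ξ xs)
          (solutionTangent y μ ξ xs d)) '' D.multipliersFP xs (y xs) (μ xs) (ξ xs) := by
  rw [hS.multipliersSP_eq_image, image_image]
  exact image_congr fun l hl => hS.hessQuad_lagrangianSP hl d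

theorem mem_criticalConeSP_iff (hS : D.IsSolutionCurve xs y μ ξ) (d : Vec n) :
    d ∈ D.criticalConeSP y xs ↔
      fderiv ℝ (fun x => D.H (x, y x)) xs d = 0 ∧
      (∀ i, D.G (xs, y xs) i = 0 → fderiv ℝ (fun x => D.G (x, y x)) xs d i ≤ 0) ∧
      fderiv ℝ (fun x => D.F (x, y x)) xs d ≤ 0 := by
  have dF := hS.F.differentiableAt (by simp)
  have dH := hS.H.differentiableAt (by simp)
  have dG := hS.G.differentiableAt (by simp)
  simp only [criticalConeSP, mem_ofPred_eq, partialX_add_partialY dF, partialX_add_partialY dH,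
    partialX_add_partialY dG, hS.fderiv_comp dF, hS.fderiv_comp dH, hS.fderiv_comp dG]

/-- The matrix `A` of the critical cone is the Jacobian of `H` and the residual. -/
theorem jacobianFP_eq (hS : D.IsSolutionCurve xs y μ ξ) (d : Vec n × Vec m × Vec r × Vec s) :
    D.jacobianFP xs (y xs) (μ xs) (ξ xs) d
      = (fderiv ℝ D.H (xs, y xs) (d.1, d.2.1),
        fderiv ℝ (D.lowerResidual {i | D.g (xs, y xs) i = 0}) (xs, y xs, μ xs, ξ xs) d) := by
  obtain ⟨dx, dy, dμ, dξ⟩ := d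
  have hu := hS.smooth
  have hgr := hu.hasFDerivAt_lowerGradient
  rw [hu.fderiv_lowerResidual]
  have k1 : fderiv ℝ (fun x' => D.gradLowerLagrangian x' (y xs) (μ xs) (ξ xs)) xs dx
      = fderiv ℝ D.lowerGradient (xs, y xs, μ xs, ξ xs) (dx, 0, 0, 0) := by
    have h1 := (HasFDerivAt.comp (g := D.lowerGradient)
      (f := fun x' => (x', y xs, μ xs, ξ xs)) xs hgr (hasFDerivAt_prodMk_left xs _)).fderiv
    exact DFunLike.congr_fun h1 dx
  have k2 : fderiv ℝ (fun y' => D.gradLowerLagrangian xs y' (μ xs) (ξ xs)) (y xs) dy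
      = fderiv ℝ D.lowerGradient (xs, y xs, μ xs, ξ xs) (0, dy, 0, 0) := by
    have h1 := (HasFDerivAt.comp (g := D.lowerGradient)
      (f := fun y' => (xs, y', μ xs, ξ xs)) (y xs) hgr
      (HasFDerivAt.comp (g := Prod.mk xs) (f := fun y' => (y', μ xs, ξ xs)) (y xs)
        (hasFDerivAt_prodMk_right xs (y xs, μ xs, ξ xs))
        (hasFDerivAt_prodMk_left (y xs) (μ xs, ξ xs)))).fderiv
    exact DFunLike.congr_fun h1 dy
  have k3 : ContinuousLinearMap.adjoint (partialY D.h xs (y xs)) dμ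
      + ContinuousLinearMap.adjoint (partialY D.g xs (y xs)) dξ
      = fderiv ℝ D.lowerGradient (xs, y xs, μ xs, ξ xs) (0, 0, dμ, dξ) := by
    refine ext_inner_right ℝ fun v => ?_
    rw [hu.inner_fderiv_lowerGradient_multiplier, inner_add_left,
      ContinuousLinearMap.adjoint_inner_left, ContinuousLinearMap.adjoint_inner_left]
  have k4 : fderiv ℝ D.lowerGradient (xs, y xs, μ xs, ξ xs) (dx, dy, dμ, dξ)
      = fderiv ℝ D.lowerGradient (xs, y xs, μ xs, ξ xs) (dx, 0, 0, 0)
        + fderiv ℝ D.lowerGradient (xs, y xs, μ xs, ξ xs) (0, dy, 0, 0)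
        + fderiv ℝ D.lowerGradient (xs, y xs, μ xs, ξ xs) (0, 0, dμ, dξ) := by
    rw [← map_add, ← map_add]
    congr 1
    simp only [Prod.mk_add_mk, add_zero, zero_add]
  have k5 : ∀ v, D.projJacobian xs (y xs) (ξ xs) v
      = v - coordMask {i | D.g (xs, y xs) i = 0} v := hS.isStrictKKT.projJacobian_apply
  have k6 := partialX_add_partialY hu.hasFDerivAt_g.differentiableAt dx dy
  refine Prod.ext (partialX_add_partialY (hS.H.differentiableAt (by simp)) dx dy)
    (Prod.ext ?_ (Prod.ext (partialX_add_partialY hu.hasFDerivAt_h.differentiableAt dx dy) ?_))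
  · simp only [jacobianFP]
    rw [k4, ← k1, ← k2, ← k3, add_assoc _ (ContinuousLinearMap.adjoint _ dμ)]
  · simp only [jacobianFP]
    rw [k5, k5, k5, ← k6, map_add]
    abel

/-- The lower level rows of `A d = 0` say that `d` is tangent to the solution curve. -/
theorem criticalConeFP_eq (hS : D.IsSolutionCurve xs y μ ξ) :
    D.criticalConeFP xs (y xs) (μ xs) (ξ xs)
      = solutionTangent y μ ξ xs '' D.criticalConeSP y xs := by
  have dH := hS.H.differentiableAt (by simp)
  have key : ∀ d, D.jacobianFP xs (y xs) (μ xs) (ξ xs) d = 0 ↔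
      (partialX D.H xs (y xs) d.1 + partialY D.H xs (y xs) d.2.1 = 0 ∧
        d = solutionTangent y μ ξ xs d.1) := fun d => by
    rw [hS.jacobianFP_eq, Prod.mk_eq_zero, hS.fderiv_lowerResidual_eq_zero_iff,
      partialX_add_partialY dH]
  ext d
  constructor
  · rintro ⟨h1, h2, h3⟩
    obtain ⟨h4, h5⟩ := (key d).1 h2
    refine ⟨d.1, ?_, h5.symm⟩
    rw [h5] at h1 h3 h4
    exact ⟨h4, h1, h3⟩
  · rintro ⟨dx, ⟨h1, h2, h3⟩, rfl⟩
    exact ⟨h2, (key _).2 ⟨h1, rfl⟩, h3⟩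

/-- Convexity needs no constraint qualification. -/
theorem convex_multipliersFP (hS : D.IsSolutionCurve xs y μ ξ) :
    Convex ℝ (D.multipliersFP xs (y xs) (μ xs) (ξ xs)) := by
  have hap := fderiv_lagrangianFP_apply hS.isStrictKKT hS.smooth
    (hS.F.differentiableAt (by simp)) (hS.H.differentiableAt (by simp))
    (hS.G.differentiableAt (by simp))
  rintro l ⟨h1, h2, h3, h4, h5, h6⟩ l' ⟨h1', -, h3', -, h5', -⟩ a b ha hb hab
  refine ⟨?_, h2, fun i => ?_, h4, ?_, h6⟩
  · refine ContinuousLinearMap.ext fun d => ?_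
    have e1 := DFunLike.congr_fun h1 d
    have e2 := DFunLike.congr_fun h1' d
    rw [hap, zero_apply, dotProd_apply] at e1 e2 ⊢
    simp only [Prod.fst_add, Prod.snd_add, Prod.smul_fst, Prod.smul_snd, inner_add_left,
      inner_smul_left, conj_trivial]
    linear_combination a * e1 + b * e2 - fderiv ℝ D.F (xs, y xs) (d.1, d.2.1) * hab
  · exact add_nonneg (mul_nonneg ha (h3 i)) (mul_nonneg hb (h3' i))
  · simp only [Prod.snd_add, Prod.smul_snd, Prod.fst_add, Prod.smul_fst, inner_add_left,
      inner_smul_left, h5, h5', mul_zero, add_zero]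

theorem convex_multipliersSP (hS : D.IsSolutionCurve xs y μ ξ) :
    Convex ℝ (D.multipliersSP y xs) :=
  convex_nlpMultipliers ((hS.contDiffAt_comp hS.F).differentiableAt (by simp))
    ((hS.contDiffAt_comp hS.H).differentiableAt (by simp))
    ((hS.contDiffAt_comp hS.G).differentiableAt (by simp))

theorem secondOrderSP_iff (hS : D.IsSolutionCurve xs y μ ξ) :
    D.SecondOrderSP y xs ↔ D.SecondOrderFP xs (y xs) (μ xs) (ξ xs) := by
  have h1 : (D.multipliersSP y xs).Nonempty ↔
      (D.multipliersFP xs (y xs) (μ xs) (ξ xs)).Nonempty := by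
    rw [hS.multipliersSP_eq_image, image_nonempty]
  have h2 : IsCompact (D.multipliersSP y xs) ↔
      IsCompact (D.multipliersFP xs (y xs) (μ xs) (ξ xs)) := by
    constructor
    · intro h
      obtain ⟨τ, hτ, e⟩ := hS.multipliersFP_eq_image
      rw [e]
      exact h.image (by fun_prop)
    · intro h
      rw [hS.multipliersSP_eq_image]
      exact h.image (by fun_prop)
  unfold SecondOrderSP SecondOrderFP
  refine and_congr h1 (and_congr h2 (and_congr
    (iff_of_true hS.convex_multipliersSP hS.convex_multipliersFP) ?_))
  rw [hS.criticalConeFP_eq, forall_mem_image]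
  refine forall₂_congr fun d _ => ?_
  rw [hS.image_hessQuad_eq]

set_option synthInstance.maxHeartbeats 200000 in
/-- MFCQ for the reformulation, in terms of the derivatives of the vector-valued maps. -/
theorem mfcqFP_iff (hS : D.IsSolutionCurve xs y μ ξ) :
    D.MFCQFP xs (y xs) (μ xs) (ξ xs) ↔
      (∀ (c : Vec p) (t : Vec m × Vec r × Vec s), (∀ d,
        inner ℝ c (fderiv ℝ D.H (xs, y xs) (d.1, d.2.1)) + dotProd t
          (fderiv ℝ (D.lowerResidual {i | D.g (xs, y xs) i = 0}) (xs, y xs, μ xs, ξ xs) d) = 0) →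
        c = 0 ∧ t = 0) ∧
      ∃ d : Vec n × Vec m × Vec r × Vec s, fderiv ℝ D.H (xs, y xs) (d.1, d.2.1) = 0 ∧
        fderiv ℝ (D.lowerResidual {i | D.g (xs, y xs) i = 0}) (xs, y xs, μ xs, ξ xs) d = 0 ∧
        ∀ i, D.G (xs, y xs) i = 0 → fderiv ℝ D.G (xs, y xs) (d.1, d.2.1) i < 0 := by
  set I := {i | D.g (xs, y xs) i = 0}
  set u : Vec n × Vec m × Vec r × Vec s := (xs, y xs, μ xs, ξ xs)
  set Ψ' := fderiv ℝ (D.lowerResidual I) u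
  have hΨd : HasFDerivAt (D.lowerResidual I) Ψ' u :=
    ((hS.smooth.contDiffAt_lowerResidual I).differentiableAt (by simp)).hasFDerivAt
  have hcoord : ∀ {k : ℕ} {φ : Vec n × Vec m × Vec r × Vec s → Vec k}
      {φ' : (Vec n × Vec m × Vec r × Vec s) →L[ℝ] Vec k}, HasFDerivAt φ φ' u →
      ∀ j d, fderiv ℝ (fun w => φ w j) u d = φ' d j := fun h j d => by
    rw [fderiv_euclidean_apply h.differentiableAt, h.fderiv]; rfl
  have hHd : ∀ j d, fderiv ℝ (D.eqConstraintsFP (.inl j)) u d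
      = fderiv ℝ D.H (xs, y xs) (d.1, d.2.1) j := fun j d => by
    rw [← fderiv_comp_proj (u := u) (hS.H.differentiableAt (by simp))]
    exact hcoord ((contDiffAt_comp_proj (u := u) hS.H).differentiableAt (by simp)).hasFDerivAt j d
  have h1d : ∀ j d, fderiv ℝ (D.eqConstraintsFP (.inr (.inl j))) u d = (Ψ' d).1 j :=
    fun j d => hcoord hΨd.fst j d
  have h2d : ∀ j d, fderiv ℝ (D.eqConstraintsFP (.inr (.inr (.inl j)))) u d = (Ψ' d).2.1 j :=
    fun j d => hcoord hΨd.snd.fst j d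
  have h3d : ∀ j d, fderiv ℝ (D.eqConstraintsFP (.inr (.inr (.inr j)))) u d = (Ψ' d).2.2 j := by
    intro j d
    have hev : D.eqConstraintsFP (.inr (.inr (.inr j))) =ᶠ[𝓝 u]
        fun w => (D.lowerResidual I w).2.2 j := by
      filter_upwards [hS.isStrictKKT.compResidual_eventuallyEq hS.smooth] with w hw
      exact congrArg (fun z : Vec s => z j) hw
    rw [hev.fderiv_eq]
    exact hcoord hΨd.snd.snd j d
  have hGd : ∀ i d, fderiv ℝ (fun w : Vec n × Vec m × Vec r × Vec s => D.G (w.1, w.2.1) i) u d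
      = fderiv ℝ D.G (xs, y xs) (d.1, d.2.1) i := fun i d => by
    rw [← fderiv_comp_proj (u := u) (hS.G.differentiableAt (by simp))]
    exact hcoord ((contDiffAt_comp_proj (u := u) hS.G).differentiableAt (by simp)).hasFDerivAt i d
  unfold MFCQFP MFCQ
  refine and_congr ?_ (exists_congr fun d => ?_)
  · rw [Fintype.linearIndependent_iff]
    have hsum : ∀ (c : Vec p) (t : Vec m × Vec r × Vec s) (e : Fin p ⊕ Fin m ⊕ Fin r ⊕ Fin s → ℝ),
        e = Sum.elim (fun j => c j) (Sum.elim (fun j => t.1 j)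
          (Sum.elim (fun j => t.2.1 j) fun j => t.2.2 j)) →
        (∑ i, e i • fderiv ℝ (D.eqConstraintsFP i) u = 0 ↔ ∀ d,
          inner ℝ c (fderiv ℝ D.H (xs, y xs) (d.1, d.2.1)) + dotProd t (Ψ' d) = 0) := by
      rintro c t e rfl
      rw [ContinuousLinearMap.ext_iff]
      refine forall_congr' fun d => ?_
      rw [dotProd_apply, EuclideanSpace.inner_eq_sum, EuclideanSpace.inner_eq_sum,
        EuclideanSpace.inner_eq_sum, EuclideanSpace.inner_eq_sum]
      simp [Fintype.sum_sum_type, hHd, h1d, h2d, h3d]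
    constructor
    · intro h c t hct
      have h0 := h _ ((hsum c t _ rfl).2 hct)
      refine ⟨?_, Prod.ext ?_ (Prod.ext ?_ ?_)⟩
      · ext j; exact h0 (.inl j)
      · ext j; exact h0 (.inr (.inl j))
      · ext j; exact h0 (.inr (.inr (.inl j)))
      · ext j; exact h0 (.inr (.inr (.inr j)))
    · intro h e he
      obtain ⟨h1, h2⟩ := h (WithLp.toLp 2 fun j => e (.inl j))
        (WithLp.toLp 2 fun j => e (.inr (.inl j)), WithLp.toLp 2 fun j => e (.inr (.inr (.inl j))),
          WithLp.toLp 2 fun j => e (.inr (.inr (.inr j)))) ((hsum _ _ e (by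
            funext i; rcases i with j | j | j | j <;> rfl)).1 he)
      simp only [Prod.mk_eq_zero] at h2
      rintro (j | j | j | j)
      · exact congrArg (fun z : Vec p => z j) h1
      · exact congrArg (fun z : Vec m => z j) h2.1
      · exact congrArg (fun z : Vec r => z j) h2.2.1
      · exact congrArg (fun z : Vec s => z j) h2.2.2
  · rw [← and_assoc]
    refine and_congr ?_ (forall₂_congr fun i _ => by rw [hGd])
    constructor
    · intro h
      refine ⟨?_, Prod.ext ?_ (Prod.ext ?_ ?_)⟩
      · ext j; rw [← hHd, h]; rfl
      · ext j; rw [← h1d, h]; rfl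
      · ext j; rw [← h2d, h]; rfl
      · ext j; rw [← h3d, h]; rfl
    · rintro ⟨h1, h2⟩ (j | j | j | j)
      · rw [hHd, h1]; rfl
      · rw [h1d, h2]; rfl
      · rw [h2d, h2]; rfl
      · rw [h3d, h2]; rfl

/-- The MFCQ directions of the two problems correspond, and so do the linear relations between the
gradients of the equality constraints, because the derivative of the residual is surjective with
kernel the tangent space of the curve. -/
theorem mfcqSP_iff_mfcqFP (hS : D.IsSolutionCurve xs y μ ξ) :
    D.MFCQSP y xs ↔ D.MFCQFP xs (y xs) (μ xs) (ξ xs) := by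
  have dH := hS.H.differentiableAt (by simp)
  have dG := hS.G.differentiableAt (by simp)
  rw [hS.mfcqFP_iff]
  unfold MFCQSP
  rw [mfcq_iff ((hS.contDiffAt_comp hS.H).differentiableAt (by simp))
    ((hS.contDiffAt_comp hS.G).differentiableAt (by simp))]
  simp only [hS.fderiv_comp dH, hS.fderiv_comp dG]
  obtain ⟨R, hR⟩ := hS.exists_rightInverse
  refine and_congr ⟨fun h c t hct => ?_, fun h c hc => ?_⟩ ⟨?_, ?_⟩
  · have hc : c = 0 := h c fun w => by
      have := hct (solutionTangent y μ ξ xs w)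
      rwa [hS.fderiv_lowerResidual_solutionTangent, map_zero, add_zero] at this
    refine ⟨hc, dotProd_injective (ContinuousLinearMap.ext fun v => ?_)⟩
    have := hct (R v)
    rw [hc, inner_zero_left, zero_add, hR] at this
    rw [this]
    simp [dotProd_apply]
  · -- The functional `⟨c, H' ·⟩` vanishes on the kernel, hence factors through the residual.
    let π : (Vec n × Vec m × Vec r × Vec s) →L[ℝ] Vec n × Vec m :=
      (ContinuousLinearMap.fst ℝ _ _).prod
        ((ContinuousLinearMap.fst ℝ _ _).comp (ContinuousLinearMap.snd ℝ _ _))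
    set L : Vec n × Vec m × Vec r × Vec s →L[ℝ] ℝ :=
      (innerSL ℝ c).comp ((fderiv ℝ D.H (xs, y xs)).comp π) with hL
    refine (h c (rieszProd (-(L.comp R))) fun d => ?_).1
    rw [dotProd_rieszProd]
    set Ψ' := fderiv ℝ (D.lowerResidual {i | D.g (xs, y xs) i = 0}) (xs, y xs, μ xs, ξ xs)
    have hker : d - R (Ψ' d) = solutionTangent y μ ξ xs (d - R (Ψ' d)).1 := by
      rw [← hS.fderiv_lowerResidual_eq_zero_iff, map_sub, hR, sub_self]
    have h6 : L (d - R (Ψ' d)) = 0 := by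
      rw [hker]; exact hc _
    rw [map_sub] at h6
    change L d + -(L (R (Ψ' d))) = 0
    linarith
  · rintro ⟨d, h1, h2⟩
    exact ⟨solutionTangent y μ ξ xs d, h1, hS.fderiv_lowerResidual_solutionTangent d, h2⟩
  · rintro ⟨d, h1, h2, h3⟩
    rw [(hS.fderiv_lowerResidual_eq_zero_iff d).1 h2] at h1 h3
    exact ⟨d.1, h1, h3⟩

/-- The second-order necessary conditions hold at bi-local solutions. -/
theorem secondOrderSP_of_isBiLocalSolution (hS : D.IsSolutionCurve xs y μ ξ)
    (hB : D.IsBiLocalSolution xs (y xs)) (hcq : D.MFCQSP y xs) : D.SecondOrderSP y xs := by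
  have hfeas : ∀ᶠ x in 𝓝 xs, y x ∈ D.lowerFeasible x :=
    hS.kkt.mono fun x hx => ⟨hx.h, hx.isLowerKKT.2.2.2.1⟩
  have hle := eventually_lower_le hS.jac hS.smooth rfl hS.contDiffAt_y.continuousAt
    (hS.contDiffAt_μ.of_le (by norm_num)) (hS.contDiffAt_ξ.of_le (by norm_num)) hS.kkt
  have hmin := hB.isLocalMinOn rfl hS.contDiffAt_y.continuousAt hfeas hle
  obtain ⟨h1, h2, h3, h4⟩ := nlp_second_order_necessary (hS.contDiffAt_comp hS.F)
    (hS.contDiffAt_comp hS.H) (hS.contDiffAt_comp hS.G) hB.1.1 hB.1.2 hmin hcq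
  refine ⟨h1, h2, h3, fun d hd => ?_⟩
  obtain ⟨k1, k2, k3⟩ := (hS.mem_criticalConeSP_iff d).1 hd
  exact h4 d k1 k2 k3

end IsSolutionCurve

end BilevelProgram

end

theorem mainTheorem3 {n m p q r s : ℕ} (D : BilevelProgram n m p q r s)
    (xs : Vec n) (ys : Vec m) (μs : Vec r) (ξs : Vec s)
    (hf : IsC2WithC3InY D.f xs ys) (hh : IsC2WithC3InY D.h xs ys) (hg : IsC2WithC3InY D.g xs ys)
    (hF : ContDiffAt ℝ 2 D.F (xs, ys)) (hH : ContDiffAt ℝ 2 D.H (xs, ys))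
    (hG : ContDiffAt ℝ 2 D.G (xs, ys))
    (hJ : D.JacobianUniqueness xs ys μs ξs) :
    -- the lower level solution map `(y(·), μ(·), ξ(·))` exists, and `L^FP` is `C²` around `u*`
    (∃ y μ ξ, D.IsLowerSolutionMap xs ys μs ξs y μ ξ) ∧
    (∀ l, ContDiffAt ℝ 2 (D.lagrangianFP l) (xs, ys, μs, ξs)) ∧
    -- part (ii)
    (D.IsBiLocalSolution xs ys → D.MFCQFP xs ys μs ξs → D.SecondOrderFP xs ys μs ξs) ∧
    ∀ y μ ξ, D.IsLowerSolutionMap xs ys μs ξs y μ ξ →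
      -- the solution map and `L^SP` are `C²` around `x*`
      (ContDiffAt ℝ 2 y xs ∧ ContDiffAt ℝ 2 μ xs ∧ ContDiffAt ℝ 2 ξ xs) ∧
      (∀ l, ContDiffAt ℝ 2 (D.lagrangianSP y l) xs) ∧
      -- part (i)
      (D.IsBiLocalSolution xs ys → D.MFCQSP y xs → D.SecondOrderSP y xs) ∧
      -- (i) and (ii) are equivalent: hypotheses and conclusions correspond
      (D.MFCQSP y xs ↔ D.MFCQFP xs ys μs ξs) ∧
      (D.SecondOrderSP y xs ↔ D.SecondOrderFP xs ys μs ξs) ∧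
      -- critical directions
      D.criticalConeFP xs ys μs ξs = solutionTangent y μ ξ xs '' D.criticalConeSP y xs ∧
      -- multipliers
      (∀ lH lG, (lH, lG) ∈ D.multipliersSP y xs →
        ∃! t : Vec m × Vec r × Vec s, (lH, lG, t) ∈ D.multipliersFP xs ys μs ξs) ∧
      (∀ lH lG, ∀ t : Vec m × Vec r × Vec s, (lH, lG, t) ∈ D.multipliersFP xs ys μs ξs →
        (lH, lG) ∈ D.multipliersSP y xs) ∧
      -- maxima
      ∀ dx ∈ D.criticalConeSP y xs, ∀ v : ℝ,
        IsGreatest ((fun l => hessQuad (D.lagrangianSP y l) xs dx) '' D.multipliersSP y xs) v ↔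
        IsGreatest ((fun l => hessQuad (D.lagrangianFP l) (xs, ys, μs, ξs)
          (solutionTangent y μ ξ xs dx)) '' D.multipliersFP xs ys μs ξs) v := by
  have hu : D.SmoothAt (xs, ys, μs, ξs) := BilevelProgram.SmoothAt.of_isC2WithC3InY hf hh hg μs ξs
  have key : ∀ y μ ξ, D.IsLowerSolutionMap xs ys μs ξs y μ ξ →
      y xs = ys ∧ μ xs = μs ∧ ξ xs = ξs ∧ D.IsSolutionCurve xs y μ ξ := by
    intro y μ ξ hS
    obtain ⟨hC, hk⟩ := hS.contDiffAt_and_isStrictKKT hJ hu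
    obtain ⟨rfl, rfl, rfl, -⟩ := hS
    exact ⟨rfl, rfl, rfl, hu, hJ, contDiffAt_id.prodMk hC, hk, hF, hH, hG⟩
  have hex := hJ.exists_isLowerSolutionMap hu
  refine ⟨hex, BilevelProgram.contDiffAt_lagrangianFP hJ.isStrictKKT hu hF hH hG, fun hB hcq => ?_,
    fun y μ ξ hS => ?_⟩
  · -- The statement does not mention the solution map; any one reduces it to part (i).
    obtain ⟨y, μ, ξ, hS⟩ := hex
    obtain ⟨rfl, rfl, rfl, hC⟩ := key y μ ξ hS
    exact hC.secondOrderSP_iff.1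
      (hC.secondOrderSP_of_isBiLocalSolution hB (hC.mfcqSP_iff_mfcqFP.2 hcq))
  · obtain ⟨rfl, rfl, rfl, hC⟩ := key y μ ξ hS
    obtain ⟨τ, -, hτ⟩ := hC.exists_multiplier_map
    exact ⟨⟨hC.contDiffAt_y, hC.contDiffAt_μ, hC.contDiffAt_ξ⟩, hC.contDiffAt_lagrangianSP,
      hC.secondOrderSP_of_isBiLocalSolution, hC.mfcqSP_iff_mfcqFP, hC.secondOrderSP_iff,
      hC.criticalConeFP_eq,
      fun lH lG hl => ⟨τ (lH, lG), (hτ lH lG _).2 ⟨hl, rfl⟩, fun t ht => ((hτ lH lG t).1 ht).2⟩,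
      fun lH lG t ht => ((hτ lH lG t).1 ht).1,
      fun d _ v => by rw [hC.image_hessQuad_eq]⟩
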